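/- Consider the following bargaining game with one-sided ultimatum and single demand types. The parameters satisfy $a_1,a_2\in(0,1)$, $D:=a_1+a_2-1>0$, $z_1,z_2\in(0,1)$, $r_1,r_2>0$, $\gamma_1\ge 0$, $0\le w_1<c_1<1$ and $0<k_2<1-w_1$. Player $i$ is justified with probability $z_i$, independently across players. A justified player never concedes; a justified player 1 challenges at Poisson rate $\gamma_1$, and a justified player 2 always sees a challenge. An unjustified player 1 chooses $\Sigma_1=(F_1,G_1)$, where $F_1(t)$ and $G_1(t)$, the probabilities of conceding and challenging by time $t\ge 0$, are nonnegative, nondecreasing, right-continuous and satisfy $F_1+G_1\le 1$. An unjustified player 2 chooses $\Sigma_2=(F_2,q_2)$, where $F_2\le 1$ is of the same kind and $q_2(t)\in[0,1]$, measurable in $t$, is her probability of yielding to a challenge at time $t$. Put $F_i(0^-)=G_1(0^-)=0$, so that values at $0$ are atoms at $0$. Conceding, respectively challenging, at time $t$ gives an unjustified player 1 the payoff $$U_1(t)=(1-z_2)\int_{[0,t)}a_1e^{-r_1s}\,dF_2(s)+[1-(1-z_2)F_2(t)]e^{-r_1t}(1-a_2)+(1-z_2)[F_2(t)-F_2(t^-)]e^{-r_1t}\tfrac{a_1+1-a_2}{2},$$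 $$V_1(t)=(1-z_2)\int_{[0,t]}a_1e^{-r_1s}\,dF_2(s)+[1-(1-z_2)F_2(t)]e^{-r_1t}(1-a_2-c_1D)+(1-z_2)[1-F_2(t)]e^{-r_1t}[(1-q_2(t))w_1+q_2(t)]D,$$ and conceding at time $t$ while responding to challenges by $q_2$ gives an unjustified player 2 the payoff $$\begin{aligned}U_2(t)={}&(1-z_1)\int_{[0,t)}a_2e^{-r_2s}\,dF_1(s)+z_1\int_0^t[1-a_1-(1-q_2(s))k_2D]e^{-r_2s}\gamma_1e^{-\gamma_1s}\,ds\\&+(1-z_1)\int_{[0,t)}\{1-a_1+(1-q_2(s))(1-w_1-k_2)D\}e^{-r_2s}\,dG_1(s)\\&+e^{-r_2t}(1-a_1)\big[1-(1-z_1)F_1(t)-(1-z_1)G_1(t^-)-z_1(1-e^{-\gamma_1t})\big]\\&+(1-z_1)[F_1(t)-F_1(t^-)]e^{-r_2t}\tfrac{a_2+1-a_1}{2}.\end{aligned}$$ The payoffs from strategies are $u_1=\int_{[0,\infty)}U_1\,dF_1+\int_{[0,\infty)}V_1\,dG_1$ and $u_2=\int_{[0,\infty)}U_2\,dF_2$.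 An equilibrium is a Bayesian Nash equilibrium: neither $\Sigma_1$ nor $\Sigma_2$ can be replaced by another strategy of the same player that gives that player a higher payoff. Let $$\lambda_1=\frac{r_2(1-a_1)}{D},\qquad \lambda_2=\frac{r_1(1-a_2)}{D},\qquad \nu_1^*=1-\frac{k_2}{1-w_1},$$ and let $$\mu_1(t)=\frac{z_1e^{-\gamma_1t}}{z_1e^{-\gamma_1t}+(1-z_1)[1-F_1(t^-)-G_1(t^-)]}$$ be the probability that player 1 is justified given that the game has not ended before $t$. The overall (that is, aggregated over types) probability that player 1 concedes by $t$ is $(1-z_1)F_1(t)$, that he challenges by $t$ is $z_1(1-e^{-\gamma_1t})+(1-z_1)G_1(t)$, and that player 2 concedes by $t$ is $(1-z_2)F_2(t)$, in each case if the opponent does not end the game before. The game survives past $t$ if neither player has conceded and player 1 has not challenged by $t$. The overall hazard rate at $t$ of an event is $$\lim_{\varepsilon\downarrow0}\varepsilon^{-1}\Pr(\text{event occurs in }(t,t+\varepsilon]\mid\text{survival past }t).$$ For a concession or a challenge the conditioning is on the acting player not having acted by $t$, which by independence gives the same rate as conditioning on survival of the game. The hazard rate of resolution is that of the end of the game by a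 concession or a challenge. **Proposition.** For every such game there are finite times $T$ and $T_1$ with $0\le T_1<T$, depending only on the game, such that the following holds in every equilibrium. 1. $T$ is the last time of concession of each unjustified player (the least $t\geq 0$ such that $F_i$ is constant on $[t,\infty)$, for $i=1$ and for $i=2$), and $T_1$ is the least $t\ge 0$ such that $G_1$ is constant on $[t,\infty)$. 2. For $i=1,2$, the overall hazard rate of concession of player $i$ exists and equals $\lambda_i$ at every $t\in[0,T)$. 3. The overall hazard rates $\widetilde\chi(t)$ of challenging and $\widetilde\rho(t)$ of resolution exist at every $t\ge 0$ with $t\neq T_1$, and $$\widetilde\chi(t)=\begin{cases}\frac{\mu_1(t)}{\nu_1^*}\gamma_1&\text{if }0<t<T_1,\\ \mu_1(t)\gamma_1&\text{if }T_1<t<T,\\ \gamma_1&\text{if }t\ge T,\end{cases}\qquad \widetilde\rho(t)=\begin{cases}\frac{\mu_1(t)}{\nu_1^*}\gamma_1+\lambda_1+\lambda_2&\text{if }0<t<T_1,\\ \mu_1(t)\gamma_1+\lambda_1+\lambda_2&\text{if }T_1<t<T,\\ \gamma_1&\text{if }t\ge T.\end{cases}$$ If $T_1>0$, the first line also holds at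 $t=0$ with $\mu_1(t)$ replaced by $\lim_{s\downarrow0}\mu_1(s)$, which exists. 4. $\widetilde\rho$ is discontinuous at $T$; if $T_1>0$, both $\widetilde\chi$ and $\widetilde\rho$ are discontinuous at $T_1$, whatever value they are given there. Both are nondecreasing on each of $(0,T_1)$, $(T_1,T)$ and $[T,\infty)$. -/

import Mathlib

open MeasureTheory Set Filter Topology

noncomputable section

/-- A bargaining game with one-sided ultimatum and single demand types. -/
structure BargainingGame where
  /-- Demand of the justified type of player 1. -/
  a₁ : ℝ
  /-- Demand of the justified type of player 2. -/
  a₂ : ℝ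
  /-- Prior probability that player 1 is justified. -/
  z₁ : ℝ
  /-- Prior probability that player 2 is justified. -/
  z₂ : ℝ
  /-- Discount rate of player 1. -/
  r₁ : ℝ
  /-- Discount rate of player 2. -/
  r₂ : ℝ
  /-- Arrival rate of challenge opportunities of a justified player 1. -/
  γ₁ : ℝ
  /-- Cost of challenging, as a proportion of the disagreement. -/
  c₁ : ℝ
  /-- Cost of seeing a challenge, as a proportion of the disagreement. -/
  k₂ : ℝ
  /-- Probability that an unjustified challenger wins against an unjustified defender. -/
  w₁ : ℝ
  a₁_pos : 0 < a₁
  a₁_lt_one : a₁ < 1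
  a₂_gt : 1 - a₁ < a₂
  a₂_lt_one : a₂ < 1
  z₁_pos : 0 < z₁
  z₁_lt_one : z₁ < 1
  z₂_pos : 0 < z₂
  z₂_lt_one : z₂ < 1
  r₁_pos : 0 < r₁
  r₂_pos : 0 < r₂
  γ₁_nonneg : 0 ≤ γ₁
  w₁_nonneg : 0 ≤ w₁
  w₁_lt_c₁ : w₁ < c₁
  c₁_lt_one : c₁ < 1
  k₂_pos : 0 < k₂
  k₂_lt : k₂ < 1 - w₁

/-- A strategy of the unjustified player 1: `F t` and `G t` are the probabilities that he concedes,
respectively challenges, by time `t` (included). They are extended by `0` to negative times, so that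
`F 0` and `G 0` are the atoms at time `0`; they may have total mass less than `1`. -/
structure Strategy₁ where
  F : StieltjesFunction ℝ
  G : StieltjesFunction ℝ
  F_neg : ∀ t, t < 0 → F t = 0
  G_neg : ∀ t, t < 0 → G t = 0
  add_le_one : ∀ t, F t + G t ≤ 1

/-- A strategy of the unjustified player 2: `F t` is the probability that she concedes by time `t`
(included), extended by `0` to negative times, and `q t` is the probability with which she yields to
a challenge made at time `t`. -/
structure Strategy₂ where
  F : StieltjesFunction ℝ
  q : ℝ → ℝ
  F_neg : ∀ t, t < 0 → F t = 0
  F_le_one : ∀ t, F t ≤ 1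
  q_measurable : Measurable q
  q_mem : ∀ t, q t ∈ Icc (0 : ℝ) 1

namespace BargainingGame

variable (B : BargainingGame)

/-- The amount of disagreement. -/
def D : ℝ := B.a₁ + B.a₂ - 1

def lam₁ : ℝ := B.r₂ * (1 - B.a₁) / B.D

def lam₂ : ℝ := B.r₁ * (1 - B.a₂) / B.D

/-- `ν₁*`, the reputation of a challenging player 1 that makes an unjustified player 2 indifferent
between yielding and seeing. -/
def nuStar : ℝ := 1 - B.k₂ / (1 - B.w₁)

/-- Time-zero expected utility of an unjustified player 1 who concedes at time `t`. The surplus is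
split equally if both players concede at the same time. -/
def U₁ (t : ℝ) (σ₂ : Strategy₂) : ℝ :=
  (1 - B.z₂) * (∫ s in Ico 0 t, B.a₁ * Real.exp (-B.r₁ * s) ∂σ₂.F.measure)
    + (1 - (1 - B.z₂) * σ₂.F t) * Real.exp (-B.r₁ * t) * (1 - B.a₂)
    + (1 - B.z₂) * (σ₂.F t - Function.leftLim σ₂.F t)
        * Real.exp (-B.r₁ * t) * ((B.a₁ + 1 - B.a₂) / 2)

/-- Time-zero expected utility of an unjustified player 1 who challenges at time `t`. A simultaneous
concession of player 2 takes precedence over the challenge. -/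
def V₁ (t : ℝ) (σ₂ : Strategy₂) : ℝ :=
  (1 - B.z₂) * (∫ s in Icc 0 t, B.a₁ * Real.exp (-B.r₁ * s) ∂σ₂.F.measure)
    + (1 - (1 - B.z₂) * σ₂.F t) * Real.exp (-B.r₁ * t) * (1 - B.a₂ - B.c₁ * B.D)
    + (1 - B.z₂) * (1 - σ₂.F t) * Real.exp (-B.r₁ * t)
        * ((1 - σ₂.q t) * B.w₁ + σ₂.q t) * B.D

/-- Expected utility of the unjustified player 1. -/
def u₁ (σ₁ : Strategy₁) (σ₂ : Strategy₂) : ℝ :=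
  (∫ s in Ici 0, B.U₁ s σ₂ ∂σ₁.F.measure) + ∫ s in Ici 0, B.V₁ s σ₂ ∂σ₁.G.measure

/-- Time-zero expected utility of an unjustified player 2 who concedes at time `t` and yields to
challenges according to `q`. A concession at time `t` takes precedence over a simultaneous
challenge. -/
def U₂ (t : ℝ) (q : ℝ → ℝ) (σ₁ : Strategy₁) : ℝ :=
  (1 - B.z₁) * (∫ s in Ico 0 t, B.a₂ * Real.exp (-B.r₂ * s) ∂σ₁.F.measure)
    + B.z₁ * (∫ s in (0 : ℝ)..t, (1 - B.a₁ - (1 - q s) * B.k₂ * B.D) * Real.exp (-B.r₂ * s)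
        * (B.γ₁ * Real.exp (-B.γ₁ * s)))
    + (1 - B.z₁) * (∫ s in Ico 0 t,
        (1 - B.a₁ + (1 - q s) * (1 - B.w₁ - B.k₂) * B.D) * Real.exp (-B.r₂ * s) ∂σ₁.G.measure)
    + Real.exp (-B.r₂ * t) * (1 - B.a₁)
        * (1 - (1 - B.z₁) * σ₁.F t - (1 - B.z₁) * Function.leftLim σ₁.G t
            - B.z₁ * (1 - Real.exp (-B.γ₁ * t)))
    + (1 - B.z₁) * (σ₁.F t - Function.leftLim σ₁.F t)
        * Real.exp (-B.r₂ * t) * ((B.a₂ + 1 - B.a₁) / 2)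

/-- Expected utility of the unjustified player 2. -/
def u₂ (σ₂ : Strategy₂) (σ₁ : Strategy₁) : ℝ :=
  ∫ s in Ici 0, B.U₂ s σ₂.q σ₁ ∂σ₂.F.measure

/-- Bayesian Nash equilibrium. -/
def IsEquilibrium (σ₁ : Strategy₁) (σ₂ : Strategy₂) : Prop :=
  (∀ σ₁' : Strategy₁, B.u₁ σ₁' σ₂ ≤ B.u₁ σ₁ σ₂) ∧
    ∀ σ₂' : Strategy₂, B.u₂ σ₂' σ₁ ≤ B.u₂ σ₂ σ₁

/-- Player 1's reputation `μ₁(t)`: the posterior probability that player 1 is justified given that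
the game has not ended before time `t`. -/
def reputation₁ (σ₁ : Strategy₁) (t : ℝ) : ℝ :=
  B.z₁ * Real.exp (-B.γ₁ * t) /
    (B.z₁ * Real.exp (-B.γ₁ * t)
      + (1 - B.z₁) * (1 - Function.leftLim σ₁.F t - Function.leftLim σ₁.G t))

/-- Overall probability, over both types, that player 1 concedes by time `t` if the game is not
ended by player 2 before. -/
def concessionProb₁ (σ₁ : Strategy₁) (t : ℝ) : ℝ := (1 - B.z₁) * σ₁.F t

/-- Overall probability, over both types, that player 2 concedes by time `t` if the game is not
ended by player 1 before. -/
def concessionProb₂ (σ₂ : Strategy₂) (t : ℝ) : ℝ := (1 - B.z₂) * σ₂.F t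

/-- Overall probability, over both types, that player 1 challenges by time `t` if the game is not
ended by player 2 before. -/
def challengeProb (σ₁ : Strategy₁) (t : ℝ) : ℝ :=
  B.z₁ * (1 - Real.exp (-B.γ₁ * t)) + (1 - B.z₁) * σ₁.G t

/-- Overall probability that player 1 neither concedes nor challenges by time `t`. -/
def survivalProb₁ (σ₁ : Strategy₁) (t : ℝ) : ℝ :=
  1 - B.concessionProb₁ σ₁ t - B.challengeProb σ₁ t

/-- Overall probability that player 2 does not concede by time `t`. -/
def survivalProb₂ (σ₂ : Strategy₂) (t : ℝ) : ℝ := 1 - B.concessionProb₂ σ₂ t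

/-- Probability that the game has not ended by time `t`; the types and the actions of the two
players are independent. -/
def gameSurvivalProb (σ₁ : Strategy₁) (σ₂ : Strategy₂) (t : ℝ) : ℝ :=
  B.survivalProb₁ σ₁ t * B.survivalProb₂ σ₂ t

end BargainingGame

/-- `h` is the hazard rate at time `t` of an event: the probability that the event occurs in
`(t, t + ε]`, conditional on survival past `t`, divided by `ε`, converges to `h` as `ε` decreases to
`0`. Here `A` is the probability that the event has occurred by a given time, and `S` is the
survival probability. -/
def IsHazardRate (A S : ℝ → ℝ) (t h : ℝ) : Prop :=
  0 < S t ∧ Tendsto (fun ε : ℝ => (A (t + ε) - A t) / S t / ε) (𝓝[>] 0) (𝓝 h)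

namespace BargainingGame

variable (B : BargainingGame)

/-- Overall hazard rate of concession of player 1. -/
def IsConcessionHazard₁ (σ₁ : Strategy₁) (t h : ℝ) : Prop :=
  IsHazardRate (B.concessionProb₁ σ₁) (B.survivalProb₁ σ₁) t h

/-- Overall hazard rate of concession of player 2. -/
def IsConcessionHazard₂ (σ₂ : Strategy₂) (t h : ℝ) : Prop :=
  IsHazardRate (B.concessionProb₂ σ₂) (B.survivalProb₂ σ₂) t h

/-- Overall hazard rate of challenging. -/
def IsChallengeHazard (σ₁ : Strategy₁) (t h : ℝ) : Prop :=
  IsHazardRate (B.challengeProb σ₁) (B.survivalProb₁ σ₁) t h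

/-- Overall hazard rate of resolution, that is, of the end of the game. -/
def IsResolutionHazard (σ₁ : Strategy₁) (σ₂ : Strategy₂) (t h : ℝ) : Prop :=
  IsHazardRate (fun s => 1 - B.gameSurvivalProb σ₁ σ₂ s) (B.gameSurvivalProb σ₁ σ₂) t h

end BargainingGame

/-- `T` is the last time at which a distribution function moves: the least time `t ≥ 0` from which
on it is constant. -/
def IsLastTime (F : ℝ → ℝ) (T : ℝ) : Prop :=
  IsLeast {t : ℝ | 0 ≤ t ∧ ∀ s, t ≤ s → F s = F t} T

end

/-! In equilibrium the concessions of the unjustified types form a war of attrition that the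
challenges do not disturb. The value of conceding right after a time never exceeds the equilibrium
payoff, and it equals that payoff almost everywhere with respect to the player's own concessions.
Yielding to a challenge pays player 2 exactly what conceding pays, and where she concedes she may be
taken to yield always (`U₂_one_eq`). So both players solve the same problem (`isAttrition`): waiting
costs interest on the concession payoff and gains `D` whenever the opponent concedes. Hence
concession has no gaps, and no atoms after time 0. It fills an interval `[0, T]`, on which each
player concedes at the rate that keeps the other indifferent (`exists_last_time`,
`hasDerivWithinAt`). `T` is finite because player 2 is justified with positive probability.

The challenges are pinned down by two comparisons of measures. Player 2 could see more challenges on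
any set, so the unjustified challenges, made only where `q > 0`, are at most a critical multiple of
the justified ones (`G_restrict_le`). She could also yield more, so where `q < 1` they are at least
that multiple (`critical_restrict_le`). Player 2's reputation is `exp (-λ₂ (T - t))`. While it is
below `1 - c₁`, certain yielding would make challenging strictly profitable; so `q < 1`, and the
challenges are critical. Once it is above `1 - c₁`, challenging loses even against certain yielding,
so it stops (`exists_hasProfile`).

The reciprocal of player 1's reputation therefore solves a linear equation with piecewise constant
coefficients and equals 1 at `T`. Its slope is negative and depends only on the remaining time
(`slope_eq_posteriorSlope`): reputation rises, which gives the monotonicity. It also gives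
uniqueness of `T` (`last_time_le`). If `T < T'`, the profile with the earlier end starts, after time
0, with the higher reputation, which takes an atom of player 1 at 0. Player 2 then has no atom
there, so her survival probability starts at 1; by the formula `z₂ exp (λ₂ T)` for it, the later end
would need one above 1. The challenge rate drops by the factor `ν*` when unjustified challenges
stop, and the resolution rate by `λ₁ + λ₂` when concession stops. -/

noncomputable section

/-! ### The abstract war of attrition -/

/-- Equilibrium conditions of a war of attrition between two players: `X i` is the probability that
player `i` has conceded, `S i` the probability that `i` has not stopped the game, `W i t` the value
to `i` of conceding right after `t`, and `w i` the equilibrium payoff of `i`. The set of `t` at which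
conceding is optimal for `i` carries `X i`. -/
structure IsAttrition (X S W : Bool → ℝ → ℝ) (w r c : Bool → ℝ) (D : ℝ) : Prop where
  D_pos : 0 < D
  r_pos : ∀ i, 0 < r i
  c_pos : ∀ i, 0 < c i
  mono : ∀ i, Monotone (X i)
  right_cont : ∀ i t, ContinuousWithinAt (X i) (Ici t) t
  neg : ∀ i t, t < 0 → X i t = 0
  S_pos : ∀ i t, 0 ≤ t → 0 < S i t
  S_anti : ∀ i, AntitoneOn (S i) (Ici 0)
  upper : ∀ i s t, 0 ≤ s → s ≤ t → W i t - W i s ≤ Real.exp (-r i * s) * D * (X (!i) t - X (!i) s)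
    - c i * (Real.exp (-r i * s) - Real.exp (-r i * t)) * S (!i) t
  lower : ∀ i s t, 0 ≤ s → s ≤ t → Real.exp (-r i * t) * D * (X (!i) t - X (!i) s)
    - c i * (Real.exp (-r i * s) - Real.exp (-r i * t)) * S (!i) s ≤ W i t - W i s
  le : ∀ i t, 0 ≤ t → W i t ≤ w i
  carrier : ∀ i s t, s < t → 0 ≤ t → X i s < X i t →
    ∃ x, s < x ∧ x ≤ t ∧ 0 ≤ x ∧ W i x = w i ∧ Function.leftLim (X (!i)) x = X (!i) x
  atom : ∀ i t, 0 ≤ t → Function.leftLim (X i) t < X i t →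
    W i t = w i ∧ Function.leftLim (X (!i)) t = X (!i) t

namespace IsAttrition

variable {X S W : Bool → ℝ → ℝ} {w r c : Bool → ℝ} {D : ℝ}

/-- The times at which conceding is optimal for player `i`. -/
def optimal (X W : Bool → ℝ → ℝ) (w : Bool → ℝ) (i : Bool) : Set ℝ :=
  {x | 0 ≤ x ∧ W i x = w i ∧ Function.leftLim (X (!i)) x = X (!i) x}

lemma tendsto_exp_sub (a s : ℝ) (l : Filter ℝ) (hl : l ≤ 𝓝 s) :
    Tendsto (fun t => Real.exp (-a * s) - Real.exp (-a * t)) l (𝓝 0) := by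
  have : Continuous fun t : ℝ => Real.exp (-a * s) - Real.exp (-a * t) := by fun_prop
  simpa using (this.tendsto s).mono_left hl

/-- Both increment bounds tend to 0 as `t ↓ s`, since the opponent's concession probability is
right-continuous. No left-continuity is available at an atom of the opponent. -/
lemma tendsto_right (h : IsAttrition X S W w r c D) (i : Bool) {s : ℝ} (hs : 0 ≤ s) :
    Tendsto (W i) (𝓝[>] s) (𝓝 (W i s)) := by
  have hX : Tendsto (X (!i)) (𝓝[>] s) (𝓝 (X (!i) s)) :=
    (h.right_cont (!i) s).mono_left (nhdsWithin_mono _ Ioi_subset_Ici_self)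
  have hX0 : Tendsto (fun t => Real.exp (-r i * s) * D * (X (!i) t - X (!i) s)) (𝓝[>] s) (𝓝 0) := by
    simpa using (hX.sub_const (X (!i) s)).const_mul (Real.exp (-r i * s) * D)
  have hE : Tendsto (fun t => -(c i * (Real.exp (-r i * s) - Real.exp (-r i * t)) * S (!i) s))
      (𝓝[>] s) (𝓝 0) := by
    simpa using (((tendsto_exp_sub (r i) s _ nhdsWithin_le_nhds).const_mul (c i)).mul_const
      (S (!i) s)).neg
  suffices hT : Tendsto (fun t => W i t - W i s) (𝓝[>] s) (𝓝 0) by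
    simpa using hT.add_const (W i s)
  refine tendsto_of_tendsto_of_tendsto_of_le_of_le' hE hX0 ?_ ?_
  · filter_upwards [self_mem_nhdsWithin] with t ht
    have := h.lower i s t hs (le_of_lt ht)
    have h1 : 0 ≤ Real.exp (-r i * t) * D * (X (!i) t - X (!i) s) :=
      mul_nonneg (mul_nonneg (Real.exp_pos _).le h.D_pos.le)
        (sub_nonneg.2 (h.mono _ (le_of_lt ht)))
    linarith
  · filter_upwards [self_mem_nhdsWithin] with t ht
    have := h.upper i s t hs (le_of_lt ht)
    have h1 : 0 ≤ c i * (Real.exp (-r i * s) - Real.exp (-r i * t)) * S (!i) t := by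
      refine mul_nonneg (mul_nonneg (h.c_pos i).le ?_) (h.S_pos _ t (hs.trans (le_of_lt ht))).le
      rw [sub_nonneg, Real.exp_le_exp]
      nlinarith [h.r_pos i, mem_Ioi.1 ht]
    linarith

/-- The opponent concedes with positive probability just before every optimal time. -/
lemma lt_of_value_le (h : IsAttrition X S W w r c D) (i : Bool) {s t : ℝ} (hs : 0 ≤ s) (hst : s < t)
    (hW : W i s ≤ W i t) :
    c i * (1 - Real.exp (-r i * (t - s))) * S (!i) t ≤ D * (X (!i) t - X (!i) s) := by
  have h1 := h.upper i s t hs hst.le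
  have h2 : Real.exp (-r i * t) = Real.exp (-r i * s) * Real.exp (-r i * (t - s)) := by
    rw [← Real.exp_add]; ring_nf
  rw [h2] at h1
  have h3 : 0 < Real.exp (-r i * s) := Real.exp_pos _
  refine le_of_mul_le_mul_left ?_ h3
  nlinarith

lemma one_sub_exp_pos (h : IsAttrition X S W w r c D) (i : Bool) {s t : ℝ} (hst : s < t) :
    0 < 1 - Real.exp (-r i * (t - s)) := by
  rw [sub_pos, Real.exp_lt_one_iff]
  nlinarith [h.r_pos i]

/-- Delay is costly, so a value that has not fallen must have been paid for by concessions of the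
opponent. -/
lemma X_lt (h : IsAttrition X S W w r c D) (i : Bool) {s t : ℝ} (hs : 0 ≤ s) (hst : s < t)
    (hW : W i s ≤ W i t) : X (!i) s < X (!i) t := by
  have h1 := h.lt_of_value_le i hs hst hW
  have h2 := mul_pos (mul_pos (h.c_pos i) (h.one_sub_exp_pos i hst))
    (h.S_pos (!i) t (hs.trans hst.le))
  have h3 := h.D_pos
  by_contra hc
  nlinarith

/-- Waiting until an optimal time must be rewarded by the opponent's concessions, and these are
carried by the opponent's own optimal times. -/
lemma exists_optimal_lt (h : IsAttrition X S W w r c D) (i : Bool) {s t : ℝ} (hs : 0 ≤ s)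
    (hst : s < t) (ht : t ∈ optimal X W w i) : ∃ x ∈ optimal X W w (!i), s < x ∧ x < t := by
  have h1 : X (!i) s < X (!i) t := h.X_lt i hs hst (ht.2.1 ▸ h.le i s hs)
  -- The opponent has no atom at an optimal time, so the growth takes place strictly before `t`.
  rw [← ht.2.2] at h1
  have h2 : ∀ᶠ t' in 𝓝[<] t, X (!i) s < X (!i) t' :=
    ((h.mono (!i)).tendsto_leftLim t).eventually (lt_mem_nhds h1)
  obtain ⟨t', h3, h4, h5⟩ := (h2.and (Ioo_mem_nhdsLT hst)).exists
  obtain ⟨x, hx1, hx2, hx3, hx4, hx5⟩ := h.carrier (!i) s t' h4 (hs.trans h4.le) h3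
  exact ⟨x, ⟨hx3, hx4, hx5⟩, hx1, hx2.trans_lt h5⟩

/-- There are no gaps in concession before an optimal time. -/
lemma exists_optimal_between (h : IsAttrition X S W w r c D) {i₀ : Bool} {p u t : ℝ} (hp : 0 ≤ p)
    (hpu : p < u) (hut : u ≤ t) (ht : t ∈ optimal X W w i₀) :
    ∃ i, ∃ x ∈ optimal X W w i, p < x ∧ x < u := by
  by_contra! hno
  set A : Set ℝ := {x | u ≤ x ∧ ∃ i, x ∈ optimal X W w i} with hA
  have hAne : A.Nonempty := ⟨t, hut, i₀, ht⟩
  have hAbd : BddBelow A := ⟨u, fun x hx => hx.1⟩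
  set b := sInf A with hb
  have hub : u ≤ b := le_csInf hAne fun x hx => hx.1
  -- An optimal `b` would have an optimal time in `(p, b)`, which lies either in the gap or below
  -- the infimum of `A`.
  have hnot : ∀ i, b ∉ optimal X W w i := by
    intro i hi
    obtain ⟨x, hx, hx1, hx2⟩ := h.exists_optimal_lt i hp (hpu.trans_le hub) hi
    rcases lt_or_ge x u with hxu | hxu
    · exact absurd hxu (not_lt.2 (hno _ x hx hx1))
    · exact absurd (csInf_le hAbd ⟨hxu, _, hx⟩) (not_le.2 hx2)
  -- The infimum is not attained, so optimal times accumulate at `b` from the right, and by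
  -- right-continuity some value at `b` is the optimal one.
  have hfreq : ∃ᶠ x in 𝓝[>] b, ∃ i, x ∈ optimal X W w i := by
    rw [frequently_nhdsWithin_iff, frequently_iff]
    intro U hU
    obtain ⟨e, he, heU⟩ := exists_Ico_subset_of_mem_nhds hU ⟨b + 1, by linarith⟩
    obtain ⟨x, hx, hxe⟩ := exists_lt_of_csInf_lt hAne he
    have hbx : b < x := lt_of_le_of_ne (csInf_le hAbd hx) fun hbx => by
      obtain ⟨i, hi⟩ := hx.2
      exact hnot i (hbx ▸ hi)
    exact ⟨x, heU ⟨hbx.le, hxe⟩, hx.2, hbx⟩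
  have hfreq' : ∃ i, ∃ᶠ x in 𝓝[>] b, x ∈ optimal X W w i := by
    have : ∃ᶠ x in 𝓝[>] b, x ∈ optimal X W w true ∨ x ∈ optimal X W w false :=
      hfreq.mono fun x ⟨i, hi⟩ => by cases i <;> simp [hi]
    rcases frequently_or_distrib.1 this with h1 | h1
    exacts [⟨_, h1⟩, ⟨_, h1⟩]
  obtain ⟨i, hi⟩ := hfreq'
  have hb0 : 0 ≤ b := hp.trans (hpu.le.trans hub)
  have hWb : W i b = w i := by
    by_contra hne
    have := (h.tendsto_right i hb0).eventually_ne hne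
    obtain ⟨x, hx, hx'⟩ := (hi.and_eventually this).exists
    exact hx' hx.2.1
  -- Either the opponent has no atom at `b` and `b` is optimal for `i`, or the atom makes `b`
  -- optimal for the opponent.
  by_cases hj : Function.leftLim (X (!i)) b = X (!i) b
  · exact hnot i ⟨hb0, hWb, hj⟩
  · have := h.atom (!i) b hb0 (lt_of_le_of_ne ((h.mono _).leftLim_le le_rfl) hj)
    exact hnot (!i) ⟨hb0, this⟩

/-- If the optimal time found in the interval belongs to the other player, one step to the left
switches players. Thus both sets of optimal times are dense before any optimal time. -/
lemma exists_optimal_mem_Ioo (h : IsAttrition X S W w r c D) (i : Bool) {i₀ : Bool} {p u t : ℝ}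
    (hp : 0 ≤ p) (hpu : p < u) (hut : u ≤ t) (ht : t ∈ optimal X W w i₀) :
    ∃ x ∈ optimal X W w i, p < x ∧ x < u := by
  obtain ⟨j, x, hx, hx1, hx2⟩ := h.exists_optimal_between hp hpu hut ht
  by_cases hji : j = i
  · exact ⟨x, hji ▸ hx, hx1, hx2⟩
  · obtain ⟨y, hy, hy1, hy2⟩ := h.exists_optimal_lt j hp hx1 hx
    have : (!j) = i := by revert hji; cases i <;> cases j <;> simp
    exact ⟨y, this ▸ hy, hy1, hy2.trans hx2⟩

/-- Density of optimal times together with right-continuity of the value. -/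
lemma value_eq_of_lt_optimal (h : IsAttrition X S W w r c D) (i : Bool) {i₀ : Bool} {s t : ℝ}
    (hs : 0 ≤ s) (hst : s < t) (ht : t ∈ optimal X W w i₀) : W i s = w i := by
  by_contra hne
  have h1 := (h.tendsto_right i hs).eventually_ne hne
  obtain ⟨e, he, heU⟩ := mem_nhdsGT_iff_exists_Ioo_subset.1 h1
  obtain ⟨x, hx, hx1, hx2⟩ := h.exists_optimal_mem_Ioo i hs (lt_min he hst) (min_le_right _ _) ht
  exact heU ⟨hx1, hx2.trans_le (min_le_left _ _)⟩ hx.2.1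

/-- A value which is constant just before `t` excludes an atom of the opponent at `t`. -/
lemma no_atom (h : IsAttrition X S W w r c D) (i : Bool) {t : ℝ} (ht : 0 < t)
    (hc : ∀ s, 0 ≤ s → s < t → W i s = w i) : Function.leftLim (X (!i)) t = X (!i) t := by
  refine le_antisymm ((h.mono _).leftLim_le le_rfl) ?_
  have hE : Tendsto (fun s => Real.exp (-r i * t) * D * (X (!i) t - X (!i) s)
      - c i * (Real.exp (-r i * s) - Real.exp (-r i * t)) * S (!i) 0) (𝓝[<] t)
      (𝓝 (Real.exp (-r i * t) * D * (X (!i) t - Function.leftLim (X (!i)) t) -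
        c i * 0 * S (!i) 0)) := by
    have h1 : Tendsto (fun s => Real.exp (-r i * s) - Real.exp (-r i * t)) (𝓝[<] t) (𝓝 0) := by
      simpa using (tendsto_exp_sub (r i) t _ nhdsWithin_le_nhds).neg
    exact ((((h.mono (!i)).tendsto_leftLim t).const_sub _).const_mul _).sub
      ((h1.const_mul _).mul_const _)
  -- In the limit `s ↑ t` only the gain from the jump remains; a positive jump would lift the value
  -- at `t` above its maximum.
  have h2 : Real.exp (-r i * t) * D * (X (!i) t - Function.leftLim (X (!i)) t) -
        c i * 0 * S (!i) 0 ≤ 0 := by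
    refine le_of_tendsto hE ?_
    filter_upwards [Ioo_mem_nhdsLT ht] with s hs
    have h3 := h.lower i s t hs.1.le hs.2.le
    have h4 := h.le i t ht.le
    have h5 := hc s hs.1.le hs.2
    have h6 : c i * (Real.exp (-r i * s) - Real.exp (-r i * t)) * S (!i) s ≤
        c i * (Real.exp (-r i * s) - Real.exp (-r i * t)) * S (!i) 0 := by
      refine mul_le_mul_of_nonneg_left (h.S_anti _ self_mem_Ici hs.1.le hs.1.le)
        (mul_nonneg (h.c_pos i).le ?_)
      rw [sub_nonneg, Real.exp_le_exp]
      nlinarith [h.r_pos i, hs.2]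
    linarith
  have h7 : 0 < Real.exp (-r i * t) * D := mul_pos (Real.exp_pos _) h.D_pos
  by_contra hcon
  nlinarith [mul_pos h7 (sub_pos.2 (not_le.1 hcon))]

/-- In every unit of time before an optimal time, player `j` must concede at least a fixed amount,
as the survival probability stays above `z`. The total is at most `C`. -/
lemma bddAbove_optimal (h : IsAttrition X S W w r c D) {j : Bool} {z C : ℝ} (hz : 0 < z)
    (hS : ∀ t, 0 ≤ t → z ≤ S j t) (hC : ∀ t, X j t ≤ C) :
    BddAbove {x | ∃ i, x ∈ optimal X W w i} := by
  obtain ⟨i, rfl⟩ : ∃ i, j = !i := ⟨!j, by simp⟩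
  -- The least concession that makes up for one unit of delay; `1 - 0` is the shape that
  -- `one_sub_exp_pos` produces.
  set η := c i * (1 - Real.exp (-r i * (1 - 0))) * z / D with hη
  have hη0 : 0 < η := div_pos (mul_pos (mul_pos (h.c_pos i) (h.one_sub_exp_pos i one_pos)) hz)
    h.D_pos
  obtain ⟨n, hn⟩ := exists_nat_gt (C / η)
  refine ⟨n, fun x ⟨i₀, hx⟩ => ?_⟩
  by_contra hlt
  push Not at hlt
  have key : ∀ m : ℕ, (m : ℝ) ≤ n → m * η ≤ X (!i) m := by
    intro m
    induction m with
    | zero =>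
      intro _
      simpa using (h.neg (!i) (-1) (by norm_num)).symm.le.trans (h.mono (!i) (by norm_num))
    | succ m ih =>
      intro hm
      push_cast at hm ⊢
      have h1 := ih (by linarith)
      have hm0 : (0 : ℝ) ≤ m := Nat.cast_nonneg m
      have h2 := h.lt_of_value_le i hm0 (lt_add_one (m : ℝ))
        ((h.value_eq_of_lt_optimal i hm0 (by linarith) hx).trans
          (h.value_eq_of_lt_optimal i (by linarith) (by linarith) hx).symm).le
      have h3 : η ≤ X (!i) (m + 1) - X (!i) m := by
        rw [hη, div_le_iff₀ h.D_pos]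
        have h4 := mul_le_mul_of_nonneg_left (hS (m + 1) (by linarith))
          (mul_pos (h.c_pos i) (h.one_sub_exp_pos i (lt_add_one (m : ℝ)))).le
        have h5 : (1 : ℝ) - 0 = m + 1 - m := by ring
        rw [h5]
        linarith
      linarith
  have h1 := key n le_rfl
  have h2 := hC n
  rw [div_lt_iff₀ hη0] at hn
  linarith

/-- Concession takes place on an interval `[0, T]`, at the rates that make the players
indifferent. -/
theorem exists_last_time (h : IsAttrition X S W w r c D) {j : Bool} {z C : ℝ} (hz : 0 < z)
    (hS : ∀ t, 0 ≤ t → z ≤ S j t) (hC : ∀ t, X j t ≤ C)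
    (hpos : (∀ i t, 0 ≤ t → X i t = X i 0) → ∀ i, 0 < X i 0) :
    ∃ T, 0 < T ∧ (∀ i t, 0 ≤ t → t ≤ T → W i t = w i) ∧
      (∀ i t, 0 < t → Function.leftLim (X i) t = X i t) ∧
      (∀ i t, T ≤ t → X i t = X i T) ∧
      (∀ i s t, 0 ≤ s → s < t → t ≤ T → X i s < X i t) := by
  have hbd := h.bddAbove_optimal hz hS hC
  have hconst : ∀ T, (∀ x, (∃ i, x ∈ optimal X W w i) → x ≤ T) → 0 ≤ T →
      ∀ i t, T ≤ t → X i t = X i T := by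
    intro T hT hT0 i t ht
    refine le_antisymm ?_ (h.mono i ht)
    by_contra hlt
    push Not at hlt
    have hTt : T < t := lt_of_le_of_ne ht (by rintro rfl; exact lt_irrefl _ hlt)
    obtain ⟨x, hx1, -, hx2⟩ := h.carrier i T t hTt (hT0.trans ht) hlt
    exact absurd (hT x ⟨i, hx2⟩) (not_le.2 hx1)
  -- Otherwise all concession happens at time 0, and `hpos` gives both players atoms there, which
  -- `atom` forbids.
  have hpos' : ∃ x, 0 < x ∧ ∃ i, x ∈ optimal X W w i := by
    by_contra! hno
    have h1 := hpos (hconst 0 (fun x ⟨i, hx⟩ => by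
      by_contra hlt
      exact hno x (not_le.1 hlt) i hx) le_rfl)
    have h2 : ∀ i, Function.leftLim (X i) 0 = 0 := by
      intro i
      have : Tendsto (X i) (𝓝[<] 0) (𝓝 0) :=
        tendsto_const_nhds.congr' (by
          filter_upwards [self_mem_nhdsWithin] with t ht using (h.neg i t ht).symm)
      exact tendsto_nhds_unique ((h.mono i).tendsto_leftLim 0) this
    have h3 := (h.atom true 0 le_rfl ((h2 true).trans_lt (h1 true))).2
    rw [h2] at h3
    exact absurd h3 (h1 _).ne
  obtain ⟨x₀, hx₀, i₀, hi₀⟩ := hpos'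
  set T := sSup {x | ∃ i, x ∈ optimal X W w i} with hTdef
  have hx₀T : x₀ ≤ T := le_csSup hbd ⟨i₀, hi₀⟩
  have hT0 : 0 < T := hx₀.trans_le hx₀T
  have hlt : ∀ i s, 0 ≤ s → s < T → W i s = w i := by
    intro i s hs hsT
    obtain ⟨x, ⟨k, hx⟩, hsx⟩ := exists_lt_of_lt_csSup
      (s := {x | ∃ i, x ∈ optimal X W w i}) ⟨x₀, i₀, hi₀⟩ hsT
    exact h.value_eq_of_lt_optimal i hs hsx hx
  have hcon := hconst T (fun x hx => le_csSup hbd hx) hT0.le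
  have hcont : ∀ i t, 0 < t → Function.leftLim (X i) t = X i t := by
    intro i t ht
    rcases le_or_gt t T with htT | htT
    · have := h.no_atom (!i) ht fun s hs hst => hlt (!i) s hs (hst.trans_le htT)
      simpa using this
    · have h1 := (h.mono i).le_leftLim htT
      have h2 := (h.mono i).leftLim_le (le_refl t)
      rw [hcon i t htT.le] at h2 ⊢
      exact le_antisymm h2 h1
  -- Strict growth up to and including `T` needs the value at `T` itself, where right-continuity is
  -- of no use.
  suffices hval : ∀ i t, 0 ≤ t → t ≤ T → W i t = w i by
    refine ⟨T, hT0, hval, hcont, hcon, fun i s t hs hst htT => ?_⟩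
    have := h.X_lt (!i) hs hst
      ((hval _ s hs (hst.le.trans htT)).trans (hval _ t (hs.trans hst.le) htT).symm).le
    simpa using this
  intro i t ht htT
  rcases htT.lt_or_eq with htT | htT'
  · exact hlt i t ht htT
  · have hT0 : 0 < t := htT' ▸ hT0
    replace hlt : ∀ s, 0 ≤ s → s < t → W i s = w i := htT' ▸ hlt i
    refine le_antisymm (h.le i t ht) ?_
    -- Dropping the gain from concessions in `lower` leaves a bound from below that tends to `w i`
    -- as `s ↑ t`.
    have hE : Tendsto (fun s => W i s - c i * (Real.exp (-r i * s) - Real.exp (-r i * t))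
        * S (!i) 0) (𝓝[<] t) (𝓝 (w i - c i * 0 * S (!i) 0)) := by
      have h1 : Tendsto (fun s => Real.exp (-r i * s) - Real.exp (-r i * t)) (𝓝[<] t) (𝓝 0) := by
        simpa using (tendsto_exp_sub (r i) t _ nhdsWithin_le_nhds).neg
      refine Tendsto.sub ?_ ((h1.const_mul _).mul_const _)
      exact tendsto_const_nhds.congr' (by
        filter_upwards [Ioo_mem_nhdsLT hT0] with s hs using (hlt s hs.1.le hs.2).symm)
    have h2 := le_of_tendsto (b := W i t) hE (by
      filter_upwards [Ioo_mem_nhdsLT hT0] with s hs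
      have h3 := h.lower i s t hs.1.le hs.2.le
      have h6 : c i * (Real.exp (-r i * s) - Real.exp (-r i * t)) * S (!i) s ≤
          c i * (Real.exp (-r i * s) - Real.exp (-r i * t)) * S (!i) 0 := by
        refine mul_le_mul_of_nonneg_left (h.S_anti _ self_mem_Ici hs.1.le hs.1.le)
          (mul_nonneg (h.c_pos i).le ?_)
        rw [sub_nonneg, Real.exp_le_exp]
        nlinarith [h.r_pos i, hs.2]
      have h7 : 0 ≤ Real.exp (-r i * t) * D * (X (!i) t - X (!i) s) :=
        mul_nonneg (mul_nonneg (Real.exp_pos _).le h.D_pos.le)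
          (sub_nonneg.2 (h.mono _ hs.2.le))
      linarith)
    linarith

/-- A player's concession rate is the one at which the opponent's value is constant. -/
theorem hasDerivWithinAt (h : IsAttrition X S W w r c D) (i : Bool) {s T : ℝ} (hs : 0 ≤ s)
    (hsT : s < T) (hW : ∀ t, 0 ≤ t → t ≤ T → W i t = w i)
    (hS : Tendsto (S (!i)) (𝓝[>] s) (𝓝 (S (!i) s))) :
    HasDerivWithinAt (X (!i)) (r i * c i / D * S (!i) s) (Ici s) s := by
  have hD := h.D_pos
  have hd : ∀ a : ℝ, HasDerivAt (fun t => Real.exp (a * (t - s))) a s := by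
    intro a
    have h0 : HasDerivAt (fun t => a * (t - s)) a s := by
      simpa using ((hasDerivAt_id s).sub_const s).const_mul a
    simpa using h0.exp
  have hsl : ∀ a : ℝ, Tendsto (fun t => (Real.exp (a * (t - s)) - 1) / (t - s)) (𝓝[>] s) (𝓝 a) := by
    intro a
    have := (hasDerivAt_iff_tendsto_slope.1 (hd a)).mono_left
      (nhdsWithin_mono s fun x hx => (ne_of_gt hx : x ≠ s))
    refine this.congr fun t => ?_
    simp [slope_def_field]
  rw [← hasDerivWithinAt_Ioi_iff_Ici, hasDerivWithinAt_iff_tendsto_slope' self_notMem_Ioi]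
  -- With equal values at `s` and `t`, the two increment bounds enclose the difference quotient. The
  -- bound from below involves survival at `t`, hence the hypothesis `hS`.
  have hlo : Tendsto (fun t => -(c i / D) * ((Real.exp (-r i * (t - s)) - 1) / (t - s)) * S (!i) t)
      (𝓝[>] s) (𝓝 (r i * c i / D * S (!i) s)) := by
    have := ((hsl (-r i)).const_mul (-(c i / D))).mul hS
    convert this using 2
    ring
  have hup : Tendsto (fun t => c i / D * ((Real.exp (r i * (t - s)) - 1) / (t - s)) * S (!i) s)
      (𝓝[>] s) (𝓝 (r i * c i / D * S (!i) s)) := by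
    have := ((hsl (r i)).const_mul (c i / D)).mul_const (S (!i) s)
    convert this using 2
    ring
  refine tendsto_of_tendsto_of_tendsto_of_le_of_le' hlo hup ?_ ?_
  · filter_upwards [Ioo_mem_nhdsGT hsT] with t ht
    have hts : 0 < t - s := sub_pos.2 ht.1
    have h1 := h.lt_of_value_le i hs ht.1
      ((hW s hs hsT.le).trans (hW t (hs.trans ht.1.le) ht.2.le).symm).le
    rw [slope_def_field, le_div_iff₀ hts]
    have h2 : -(c i / D) * ((Real.exp (-r i * (t - s)) - 1) / (t - s)) * S (!i) t * (t - s)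
        = c i * (1 - Real.exp (-r i * (t - s))) * S (!i) t / D := by
      field_simp
      ring
    rw [h2, div_le_iff₀ hD]
    linarith
  · filter_upwards [Ioo_mem_nhdsGT hsT] with t ht
    have hts : 0 < t - s := sub_pos.2 ht.1
    have h1 := h.lower i s t hs ht.1.le
    rw [hW s hs hsT.le, hW t (hs.trans ht.1.le) ht.2.le, sub_self] at h1
    rw [slope_def_field, div_le_iff₀ hts]
    have h2 : c i / D * ((Real.exp (r i * (t - s)) - 1) / (t - s)) * S (!i) s * (t - s)
        = c i * (Real.exp (r i * (t - s)) - 1) * S (!i) s / D := by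
      field_simp
    rw [h2, le_div_iff₀ hD]
    have h3 : Real.exp (-r i * s) = Real.exp (-r i * t) * Real.exp (r i * (t - s)) := by
      rw [← Real.exp_add]; ring_nf
    rw [h3] at h1
    have h4 : 0 < Real.exp (-r i * t) := Real.exp_pos _
    refine le_of_mul_le_mul_left ?_ h4
    nlinarith

end IsAttrition

/-! ### Measurability of parametric integrals and comparison of measures -/

section Measure

/-- The integral over a section is a parametric integral of an indicator on the product, so the
measurability half of Fubini applies. -/
lemma measurable_setIntegral_section {μ : Measure ℝ} [SFinite μ] {f : ℝ → ℝ} (hf : Measurable f)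
    {P : Set (ℝ × ℝ)} (hP : MeasurableSet P) :
    Measurable fun t => ∫ s in {s | (t, s) ∈ P}, f s ∂μ := by
  have h1 : (fun t => ∫ s in {s | (t, s) ∈ P}, f s ∂μ) =
      fun t => ∫ s, P.indicator (fun p => f p.2) (t, s) ∂μ := by
    funext t
    rw [← integral_indicator (show MeasurableSet {s | (t, s) ∈ P} from measurable_prodMk_left hP)]
    rfl
  rw [h1]
  exact (((hf.comp measurable_snd).indicator hP).stronglyMeasurable.integral_prod_right').measurable

lemma measurable_integral_Ico {μ : Measure ℝ} [SFinite μ] {f : ℝ → ℝ} (hf : Measurable f) :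
    Measurable fun t => ∫ s in Ico 0 t, f s ∂μ :=
  measurable_setIntegral_section hf (P := {p | 0 ≤ p.2 ∧ p.2 < p.1})
    ((measurableSet_le measurable_const measurable_snd).inter
      (measurableSet_lt measurable_snd measurable_fst))

lemma measurable_integral_Icc {μ : Measure ℝ} [SFinite μ] {f : ℝ → ℝ} (hf : Measurable f) :
    Measurable fun t => ∫ s in Icc 0 t, f s ∂μ :=
  measurable_setIntegral_section hf (P := {p | 0 ≤ p.2 ∧ p.2 ≤ p.1})
    ((measurableSet_le measurable_const measurable_snd).inter
      (measurableSet_le measurable_snd measurable_fst))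

lemma measurable_intervalIntegral {f : ℝ → ℝ} (hf : Measurable f) :
    Measurable fun t => ∫ s in (0 : ℝ)..t, f s := by
  unfold intervalIntegral
  refine Measurable.sub ?_ ?_
  · exact measurable_setIntegral_section hf (P := {p | 0 < p.2 ∧ p.2 ≤ p.1})
      ((measurableSet_lt measurable_const measurable_snd).inter
        (measurableSet_le measurable_snd measurable_fst))
  · exact measurable_setIntegral_section hf (P := {p | p.1 < p.2 ∧ p.2 ≤ 0})
      ((measurableSet_lt measurable_fst measurable_snd).inter
        (measurableSet_le measurable_snd measurable_const))

/-- If `μ` gives all its mass to the points where `f` is positive, then a comparison of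
`f` times `μ` and `f` times `ν` is a comparison of `μ` and `ν`. -/
lemma measure_le_of_setIntegral_le {μ ν : Measure ℝ} [IsFiniteMeasure μ] [IsFiniteMeasure ν]
    {f : ℝ → ℝ} (hf : Measurable f) (hf0 : ∀ x, 0 ≤ f x) (hμ : Integrable f μ)
    (hν : Integrable f ν) (hpos : ∀ᵐ x ∂μ, 0 < f x)
    (hle : ∀ A, MeasurableSet A → ∫ x in A, f x ∂μ ≤ ∫ x in A, f x ∂ν) : μ ≤ ν := by
  set g : ℝ → ENNReal := fun x => ENNReal.ofReal (f x) with hg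
  have hgm : Measurable g := hf.ennreal_ofReal
  have h1 : μ.withDensity g ≤ ν.withDensity g := by
    refine Measure.le_iff.2 fun A hA => ?_
    rw [withDensity_apply _ hA, withDensity_apply _ hA,
      ← ofReal_integral_eq_lintegral_ofReal hμ.integrableOn (ae_of_all _ hf0),
      ← ofReal_integral_eq_lintegral_ofReal hν.integrableOn (ae_of_all _ hf0)]
    exact ENNReal.ofReal_le_ofReal (hle A hA)
  -- Dividing by `f` recovers all of `μ`, which lives where `f > 0`. For `ν` an inequality suffices,
  -- so `f` may vanish on a set charged by `ν`.
  calc μ = (μ.withDensity g).withDensity g⁻¹ := by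
        refine (withDensity_inv_same hgm ?_ (ae_of_all _ fun x => ENNReal.ofReal_ne_top)).symm
        filter_upwards [hpos] with x hx
        simpa [hg] using hx
    _ ≤ (ν.withDensity g).withDensity g⁻¹ := by
        refine Measure.le_iff.2 fun A hA => ?_
        rw [withDensity_apply _ hA, withDensity_apply _ hA]
        exact lintegral_mono' (Measure.restrict_mono le_rfl h1) le_rfl
    _ ≤ ν := withDensity_inv_same_le hgm.aemeasurable

/-- If payoffs `f` and `g` are at most the total payoff, then the latter is attained almost
everywhere, and no mass is left. -/
lemma attained_of_integral_add_eq {μ ν : Measure ℝ} [IsFiniteMeasure μ] [IsFiniteMeasure ν]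
    {f g : ℝ → ℝ} {u : ℝ} (hu : 0 < u) (hf : Integrable f μ) (hg : Integrable g ν)
    (hfu : ∀ᵐ x ∂μ, f x ≤ u) (hgu : ∀ᵐ x ∂ν, g x ≤ u) (hmass : μ.real univ + ν.real univ ≤ 1)
    (heq : ∫ x, f x ∂μ + ∫ x, g x ∂ν = u) :
    (∀ᵐ x ∂μ, f x = u) ∧ (∀ᵐ x ∂ν, g x = u) ∧ μ.real univ + ν.real univ = 1 := by
  have hf' : Integrable (fun x => u - f x) μ := (integrable_const u).sub hf
  have hg' : Integrable (fun x => u - g x) ν := (integrable_const u).sub hg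
  have hf0 : 0 ≤ᵐ[μ] fun x => u - f x := by
    filter_upwards [hfu] with x hx using sub_nonneg.2 hx
  have hg0 : 0 ≤ᵐ[ν] fun x => u - g x := by
    filter_upwards [hgu] with x hx using sub_nonneg.2 hx
  have h1 : ∫ x, (u - f x) ∂μ = μ.real univ * u - ∫ x, f x ∂μ := by
    rw [integral_sub (integrable_const u) hf]; simp
  have h2 : ∫ x, (u - g x) ∂ν = ν.real univ * u - ∫ x, g x ∂ν := by
    rw [integral_sub (integrable_const u) hg]; simp
  have h3 := integral_nonneg_of_ae hf0
  have h4 := integral_nonneg_of_ae hg0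
  -- The nonnegative shortfalls sum to the total mass times `u`, minus `u`, so they vanish; then `u
  -- > 0` forces the mass to be 1.
  have h5 : (μ.real univ + ν.real univ) * u ≤ 1 * u := mul_le_mul_of_nonneg_right hmass hu.le
  refine ⟨?_, ?_, ?_⟩
  · have : ∫ x, (u - f x) ∂μ = 0 := by linarith
    filter_upwards [(integral_eq_zero_iff_of_nonneg_ae hf0 hf').1 this] with x hx
    simp only [Pi.zero_apply] at hx
    linarith
  · have : ∫ x, (u - g x) ∂ν = 0 := by linarith
    filter_upwards [(integral_eq_zero_iff_of_nonneg_ae hg0 hg').1 this] with x hx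
    simp only [Pi.zero_apply] at hx
    linarith
  · refine le_antisymm hmass ?_
    refine le_of_mul_le_mul_right ?_ hu
    linarith

end Measure

/-! ### Stieltjes measures carried by the half-line -/

namespace StieltjesFunction

variable {F : StieltjesFunction ℝ}

lemma tendsto_atBot_of_neg (h : ∀ t, t < 0 → F t = 0) : Tendsto F atBot (𝓝 0) :=
  tendsto_const_nhds.congr' (by
    filter_upwards [eventually_lt_atBot 0] with t ht using (h t ht).symm)

lemma leftLim_zero (h : ∀ t, t < 0 → F t = 0) : Function.leftLim F 0 = 0 := by
  have : Tendsto F (𝓝[<] 0) (𝓝 0) :=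
    tendsto_const_nhds.congr' (by
      filter_upwards [self_mem_nhdsWithin] with t ht using (h t ht).symm)
  exact tendsto_nhds_unique (F.mono.tendsto_leftLim 0) this

lemma nonneg_of_neg (h : ∀ t, t < 0 → F t = 0) (t : ℝ) : 0 ≤ F t := by
  rcases lt_or_ge t 0 with ht | ht
  · exact (h t ht).ge
  · exact (h (-1) (by norm_num)).symm.le.trans (F.mono (by linarith))

lemma measure_Iio_zero (h : ∀ t, t < 0 → F t = 0) : F.measure (Iio 0) = 0 := by
  rw [F.measure_Iio (tendsto_atBot_of_neg h), leftLim_zero h]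
  simp

lemma isFiniteMeasure_of_le (h : ∀ t, t < 0 → F t = 0) {C : ℝ} (hC : ∀ t, F t ≤ C) :
    IsFiniteMeasure F.measure :=
  F.isFiniteMeasure_of_forall_abs_le (C := C) fun t => by
    rw [abs_of_nonneg (nonneg_of_neg h t)]; exact hC t

lemma exists_tendsto_real_univ (h : ∀ t, t < 0 → F t = 0) {C : ℝ} (hC : ∀ t, F t ≤ C) :
    ∃ l, Tendsto F atTop (𝓝 l) ∧ F.measure.real univ = l := by
  have hbd : BddAbove (range F) := ⟨C, by rintro _ ⟨t, rfl⟩; exact hC t⟩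
  refine ⟨_, tendsto_atTop_ciSup F.mono hbd, ?_⟩
  rw [measureReal_def, F.measure_univ (tendsto_atBot_of_neg h) (tendsto_atTop_ciSup F.mono hbd),
    sub_zero, ENNReal.toReal_ofReal]
  exact (nonneg_of_neg h 0).trans (le_ciSup hbd 0)

lemma restrict_Ici_zero (h : ∀ t, t < 0 → F t = 0) : F.measure.restrict (Ici 0) = F.measure := by
  rw [Measure.restrict_eq_self_of_ae_mem]
  rw [ae_iff]
  convert measure_Iio_zero h using 2
  ext x; simp

/-- An almost sure property holds somewhere on every interval that is charged. -/
lemma exists_of_ae {p : ℝ → Prop} (hp : ∀ᵐ x ∂F.measure, p x) {s t : ℝ} (hst : F s < F t) :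
    ∃ x, s < x ∧ x ≤ t ∧ p x := by
  by_contra! hno
  have h1 : F.measure (Ioc s t) = 0 :=
    measure_mono_null (fun x hx => hno x hx.1 hx.2) (ae_iff.1 hp)
  rw [F.measure_Ioc, ENNReal.ofReal_eq_zero] at h1
  linarith

lemma of_ae_of_atom {p : ℝ → Prop} (hp : ∀ᵐ x ∂F.measure, p x) {t : ℝ}
    (ht : Function.leftLim F t < F t) : p t := by
  by_contra hno
  have h1 : F.measure {t} = 0 :=
    measure_mono_null (fun x hx => by rw [mem_singleton_iff.1 hx]; exact hno) (ae_iff.1 hp)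
  rw [F.measure_singleton, ENNReal.ofReal_eq_zero] at h1
  linarith

lemma integral_Icc_sub (h : ∀ t, t < 0 → F t = 0) {C : ℝ} (hC : ∀ t, F t ≤ C) {f : ℝ → ℝ}
    (hf : Continuous f) {s t : ℝ} (hs : 0 ≤ s) (hst : s ≤ t) :
    ∫ x in Icc 0 t, f x ∂F.measure - ∫ x in Icc 0 s, f x ∂F.measure
      = ∫ x in Ioc s t, f x ∂F.measure := by
  have hfin := isFiniteMeasure_of_le h hC
  rw [← Icc_union_Ioc_eq_Icc hs hst, setIntegral_union]
  · ring
  · exact Set.disjoint_left.2 fun x hx hx' => absurd hx'.1 (not_lt.2 hx.2)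
  · exact measurableSet_Ioc
  · exact hf.continuousOn.integrableOn_compact isCompact_Icc
  · exact (hf.continuousOn.integrableOn_compact isCompact_Icc).mono_set Ioc_subset_Icc_self

/-- The discount factor on `(s, t]` is bounded by its value at the left end. With the companion
bound by the right end, this replaces differentiation of Stieltjes integrals. -/
lemma integral_Icc_exp_sub_le (h : ∀ t, t < 0 → F t = 0) {C : ℝ} (hC : ∀ t, F t ≤ C) {a : ℝ}
    (ha : 0 ≤ a) {s t : ℝ} (hs : 0 ≤ s) (hst : s ≤ t) :
    ∫ x in Icc 0 t, Real.exp (-a * x) ∂F.measure - ∫ x in Icc 0 s, Real.exp (-a * x) ∂F.measure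
      ≤ Real.exp (-a * s) * (F t - F s) := by
  have hfin := isFiniteMeasure_of_le h hC
  have hc : Continuous fun x => Real.exp (-a * x) := by fun_prop
  rw [integral_Icc_sub h hC hc hs hst]
  have h1 : ∫ x in Ioc s t, Real.exp (-a * x) ∂F.measure
      ≤ ∫ x in Ioc s t, Real.exp (-a * s) ∂F.measure := by
    refine setIntegral_mono_on
      ((hc.continuousOn.integrableOn_compact isCompact_Icc).mono_set Ioc_subset_Icc_self)
      (integrable_const _).integrableOn measurableSet_Ioc fun x hx => ?_
    rw [Real.exp_le_exp]
    nlinarith [hx.1]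
  refine h1.trans_eq ?_
  rw [setIntegral_const, measureReal_def, F.measure_Ioc,
    ENNReal.toReal_ofReal (sub_nonneg.2 (F.mono hst)), smul_eq_mul, mul_comm]

lemma le_integral_Icc_exp_sub (h : ∀ t, t < 0 → F t = 0) {C : ℝ} (hC : ∀ t, F t ≤ C) {a : ℝ}
    (ha : 0 ≤ a) {s t : ℝ} (hs : 0 ≤ s) (hst : s ≤ t) :
    Real.exp (-a * t) * (F t - F s) ≤ ∫ x in Icc 0 t, Real.exp (-a * x) ∂F.measure
      - ∫ x in Icc 0 s, Real.exp (-a * x) ∂F.measure := by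
  have hfin := isFiniteMeasure_of_le h hC
  have hc : Continuous fun x => Real.exp (-a * x) := by fun_prop
  rw [integral_Icc_sub h hC hc hs hst]
  have h1 : ∫ x in Ioc s t, Real.exp (-a * t) ∂F.measure
      ≤ ∫ x in Ioc s t, Real.exp (-a * x) ∂F.measure := by
    refine setIntegral_mono_on (integrable_const _).integrableOn
      ((hc.continuousOn.integrableOn_compact isCompact_Icc).mono_set Ioc_subset_Icc_self)
      measurableSet_Ioc fun x hx => ?_
    rw [Real.exp_le_exp]
    nlinarith [hx.2]
  refine Eq.trans_le ?_ h1
  rw [setIntegral_const, measureReal_def, F.measure_Ioc,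
    ENNReal.toReal_ofReal (sub_nonneg.2 (F.mono hst)), smul_eq_mul, mul_comm]

lemma integral_Ico_eq (h : ∀ t, t < 0 → F t = 0) {C : ℝ} (hC : ∀ t, F t ≤ C) {f : ℝ → ℝ}
    (hf : Continuous f) {t : ℝ} (ht : 0 ≤ t) :
    ∫ x in Ico 0 t, f x ∂F.measure
      = ∫ x in Icc 0 t, f x ∂F.measure - (F t - Function.leftLim F t) * f t := by
  have hfin := isFiniteMeasure_of_le h hC
  rw [← Ico_union_right ht, setIntegral_union]
  · rw [integral_singleton, measureReal_def, F.measure_singleton, ENNReal.toReal_ofReal, smul_eq_mul]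
    · ring
    · exact sub_nonneg.2 (F.mono.leftLim_le le_rfl)
  · simp
  · exact measurableSet_singleton t
  · exact (hf.continuousOn.integrableOn_compact isCompact_Icc).mono_set Ico_subset_Icc_self
  · exact (hf.continuousOn.integrableOn_compact isCompact_Icc).mono_set
      (singleton_subset_iff.2 ⟨ht, le_rfl⟩)

end StieltjesFunction

/-! ### Bounded measurable functions, for the integrability of payoffs -/

/-- Measurable functions that are bounded on `[0, ∞)`. -/
def IsBoundedMeasurable (f : ℝ → ℝ) : Prop :=
  Measurable f ∧ ∃ C, ∀ t, 0 ≤ t → |f t| ≤ C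

namespace IsBoundedMeasurable

variable {f g : ℝ → ℝ}

lemma const (c : ℝ) : IsBoundedMeasurable fun _ => c :=
  ⟨measurable_const, |c|, fun _ _ => le_rfl⟩

lemma add (hf : IsBoundedMeasurable f) (hg : IsBoundedMeasurable g) :
    IsBoundedMeasurable fun t => f t + g t := by
  obtain ⟨hf, C, hC⟩ := hf
  obtain ⟨hg, E, hE⟩ := hg
  exact ⟨hf.add hg, C + E, fun t ht => (abs_add_le _ _).trans (add_le_add (hC t ht) (hE t ht))⟩

lemma mul (hf : IsBoundedMeasurable f) (hg : IsBoundedMeasurable g) :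
    IsBoundedMeasurable fun t => f t * g t := by
  obtain ⟨hf, C, hC⟩ := hf
  obtain ⟨hg, E, hE⟩ := hg
  refine ⟨hf.mul hg, C * E, fun t ht => ?_⟩
  rw [abs_mul]
  exact mul_le_mul (hC t ht) (hE t ht) (abs_nonneg _) ((abs_nonneg _).trans (hC t ht))

lemma sub (hf : IsBoundedMeasurable f) (hg : IsBoundedMeasurable g) :
    IsBoundedMeasurable fun t => f t - g t := by
  simpa [sub_eq_add_neg] using hf.add ((const (-1)).mul hg)

lemma exp {a : ℝ} (ha : 0 ≤ a) : IsBoundedMeasurable fun t => Real.exp (-a * t) := by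
  refine ⟨by fun_prop, 1, fun t ht => ?_⟩
  rw [abs_of_pos (Real.exp_pos _), Real.exp_le_one_iff]
  nlinarith

lemma stieltjes {F : StieltjesFunction ℝ} (h : ∀ t, t < 0 → F t = 0) {C : ℝ}
    (hC : ∀ t, F t ≤ C) : IsBoundedMeasurable F :=
  ⟨F.mono.measurable, C, fun t _ => by
    rw [abs_of_nonneg (StieltjesFunction.nonneg_of_neg h t)]; exact hC t⟩

lemma leftLim {F : StieltjesFunction ℝ} (h : ∀ t, t < 0 → F t = 0) {C : ℝ}
    (hC : ∀ t, F t ≤ C) : IsBoundedMeasurable (Function.leftLim F) := by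
  refine ⟨F.mono.leftLim.measurable, C, fun t _ => ?_⟩
  rw [abs_of_nonneg]
  · exact (F.mono.leftLim_le le_rfl).trans (hC t)
  · exact (StieltjesFunction.nonneg_of_neg h (t - 1)).trans (F.mono.le_leftLim (by linarith))

lemma integrableOn {μ : Measure ℝ} [IsFiniteMeasure μ] (hf : IsBoundedMeasurable f) {A : Set ℝ}
    (hA : MeasurableSet A) (hA0 : A ⊆ Ici 0) : IntegrableOn f A μ := by
  obtain ⟨hf, C, hC⟩ := hf
  refine Integrable.of_bound hf.aestronglyMeasurable C ?_
  filter_upwards [ae_restrict_mem hA] with t ht using hC t (hA0 ht)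

lemma abs_setIntegral_le {μ : Measure ℝ} [IsFiniteMeasure μ] {C : ℝ} (hC : ∀ t, 0 ≤ t → |f t| ≤ C)
    {A : Set ℝ} (hA0 : A ⊆ Ici 0) :
    |∫ s in A, f s ∂μ| ≤ C * μ.real univ := by
  have h0 : 0 ≤ C := (abs_nonneg _).trans (hC 0 le_rfl)
  refine (norm_setIntegral_le_of_norm_le_const (f := f) (C := C) (measure_lt_top μ A) fun x hx =>
    hC x (hA0 hx)).trans ?_
  exact mul_le_mul_of_nonneg_left (measureReal_mono (subset_univ A)) h0

lemma integral_Ico {μ : Measure ℝ} [IsFiniteMeasure μ] (hf : IsBoundedMeasurable f) :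
    IsBoundedMeasurable fun t => ∫ s in Ico 0 t, f s ∂μ := by
  obtain ⟨hf, C, hC⟩ := hf
  exact ⟨measurable_integral_Ico hf, C * μ.real univ, fun t _ =>
    abs_setIntegral_le hC fun x hx => hx.1⟩

lemma integral_Icc {μ : Measure ℝ} [IsFiniteMeasure μ] (hf : IsBoundedMeasurable f) :
    IsBoundedMeasurable fun t => ∫ s in Icc 0 t, f s ∂μ := by
  obtain ⟨hf, C, hC⟩ := hf
  exact ⟨measurable_integral_Icc hf, C * μ.real univ, fun t _ =>
    abs_setIntegral_le hC fun x hx => hx.1⟩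

lemma integrableOn_mul_exp (hf : IsBoundedMeasurable f) {a : ℝ} (ha : 0 < a) :
    IntegrableOn (fun t => f t * Real.exp (-a * t)) (Ioi 0) := by
  obtain ⟨hf, C, hC⟩ := hf
  refine (exp_neg_integrableOn_Ioi 0 ha).bdd_mul hf.aestronglyMeasurable (c := C) ?_
  filter_upwards [ae_restrict_mem measurableSet_Ioi] with t ht using hC t (le_of_lt ht)

/-- Discounting makes the integrand integrable on the whole half-line, so the bound is uniform in
`t`. -/
lemma intervalIntegral {a : ℝ} (hf : IsBoundedMeasurable f) (ha : 0 < a) :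
    IsBoundedMeasurable fun t => ∫ s in (0 : ℝ)..t, f s * Real.exp (-a * s) := by
  refine ⟨measurable_intervalIntegral (hf.1.mul (by fun_prop)),
    ∫ s in Ioi 0, |f s * Real.exp (-a * s)|, fun t ht => ?_⟩
  simp only [intervalIntegral.integral_of_le ht]
  refine (abs_integral_le_integral_abs).trans ?_
  exact setIntegral_mono_set (hf.integrableOn_mul_exp ha).abs (ae_of_all _ fun _ => abs_nonneg _)
    (Ioc_subset_Ioi_self.eventuallyLE)

end IsBoundedMeasurable

/-! ### Pure strategies as deviations -/

open ProbabilityTheory in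
lemma cdf_dirac_neg {t : ℝ} (ht : 0 ≤ t) (s : ℝ) (hs : s < 0) :
    cdf (Measure.dirac t) s = 0 := by
  rw [cdf_eq_real, measureReal_def, Measure.dirac_apply' _ measurableSet_Iic]
  simp [hs.trans_le ht]

namespace Strategy₁

variable (σ₁ : Strategy₁)

lemma F_nonneg (t : ℝ) : 0 ≤ σ₁.F t := StieltjesFunction.nonneg_of_neg σ₁.F_neg t

lemma G_nonneg (t : ℝ) : 0 ≤ σ₁.G t := StieltjesFunction.nonneg_of_neg σ₁.G_neg t

lemma F_le_one (t : ℝ) : σ₁.F t ≤ 1 := by linarith [σ₁.add_le_one t, σ₁.G_nonneg t]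

lemma G_le_one (t : ℝ) : σ₁.G t ≤ 1 := by linarith [σ₁.add_le_one t, σ₁.F_nonneg t]

instance : IsFiniteMeasure σ₁.F.measure :=
  StieltjesFunction.isFiniteMeasure_of_le σ₁.F_neg σ₁.F_le_one

instance : IsFiniteMeasure σ₁.G.measure :=
  StieltjesFunction.isFiniteMeasure_of_le σ₁.G_neg σ₁.G_le_one

open ProbabilityTheory in
/-- Conceding at time `t`. -/
def concedeAt (t : ℝ) (ht : 0 ≤ t) : Strategy₁ where
  F := cdf (Measure.dirac t)
  G := 0
  F_neg := cdf_dirac_neg ht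
  G_neg _ _ := rfl
  add_le_one s := by simpa using cdf_le_one _ s

open ProbabilityTheory in
/-- Challenging at time `t`. -/
def challengeAt (t : ℝ) (ht : 0 ≤ t) : Strategy₁ where
  F := 0
  G := cdf (Measure.dirac t)
  F_neg _ _ := rfl
  G_neg := cdf_dirac_neg ht
  add_le_one s := by simpa using cdf_le_one _ s

end Strategy₁

namespace Strategy₂

variable (σ₂ : Strategy₂)

lemma F_nonneg (t : ℝ) : 0 ≤ σ₂.F t := StieltjesFunction.nonneg_of_neg σ₂.F_neg t

instance : IsFiniteMeasure σ₂.F.measure :=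
  StieltjesFunction.isFiniteMeasure_of_le σ₂.F_neg σ₂.F_le_one

open ProbabilityTheory in
/-- Conceding at time `t` and yielding according to `q`. -/
def concedeAt (t : ℝ) (ht : 0 ≤ t) (q : ℝ → ℝ) (hq : Measurable q) (hq' : ∀ s, q s ∈ Icc (0 : ℝ) 1) :
    Strategy₂ where
  F := cdf (Measure.dirac t)
  q := q
  F_neg := cdf_dirac_neg ht
  F_le_one := cdf_le_one _
  q_measurable := hq
  q_mem := hq'

lemma isBoundedMeasurable_q : IsBoundedMeasurable σ₂.q :=
  ⟨σ₂.q_measurable, 1, fun t _ => abs_le.2 ⟨by linarith [(σ₂.q_mem t).1], (σ₂.q_mem t).2⟩⟩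

end Strategy₂

/-! ### Payoffs in terms of the value of conceding right after a time -/

namespace BargainingGame

variable (B : BargainingGame)

lemma D_pos : 0 < B.D := by unfold D; linarith [B.a₂_gt]

lemma w₁_lt_one : B.w₁ < 1 := B.w₁_lt_c₁.trans B.c₁_lt_one

/-- Value to player 1 of conceding right after time `t`. -/
def value₁ (σ₂ : Strategy₂) (t : ℝ) : ℝ :=
  (1 - B.z₂) * (B.a₁ * ∫ s in Icc 0 t, Real.exp (-B.r₁ * s) ∂σ₂.F.measure)
    + B.survivalProb₂ σ₂ t * Real.exp (-B.r₁ * t) * (1 - B.a₂)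

/-- Value to player 2 of yielding to all challenges and conceding right after time `t`. -/
def value₂ (σ₁ : Strategy₁) (t : ℝ) : ℝ :=
  (1 - B.z₁) * (B.a₂ * ∫ s in Icc 0 t, Real.exp (-B.r₂ * s) ∂σ₁.F.measure)
    + (1 - B.a₁) * (B.z₁ * (∫ s in (0 : ℝ)..t, Real.exp (-B.r₂ * s)
        * (B.γ₁ * Real.exp (-B.γ₁ * s)))
      + (1 - B.z₁) * ∫ s in Icc 0 t, Real.exp (-B.r₂ * s) ∂σ₁.G.measure)
    + B.survivalProb₁ σ₁ t * Real.exp (-B.r₂ * t) * (1 - B.a₁)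

/-- Conceding at an atom of the opponent yields the even split instead of `a₁`, a loss of `D / 2`.
-/
lemma U₁_eq (σ₂ : Strategy₂) {t : ℝ} (ht : 0 ≤ t) :
    B.U₁ t σ₂ = B.value₁ σ₂ t - (1 - B.z₂) * (σ₂.F t - Function.leftLim σ₂.F t)
      * Real.exp (-B.r₁ * t) * (B.D / 2) := by
  unfold U₁ value₁ survivalProb₂ concessionProb₂ D
  rw [integral_const_mul,
    StieltjesFunction.integral_Ico_eq σ₂.F_neg σ₂.F_le_one (by fun_prop) ht]
  ring

/-- Against conceding right after `t`, a challenge costs `c₁ D` and wins `D` from an unjustified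
player 2, surely if she yields and with probability `w₁` if she sees. -/
lemma V₁_eq (σ₂ : Strategy₂) (t : ℝ) :
    B.V₁ t σ₂ = B.value₁ σ₂ t + Real.exp (-B.r₁ * t) * B.D *
      ((B.survivalProb₂ σ₂ t - B.z₂) * (B.w₁ + σ₂.q t * (1 - B.w₁))
        - B.c₁ * B.survivalProb₂ σ₂ t) := by
  unfold V₁ value₁ survivalProb₂ concessionProb₂
  rw [integral_const_mul]
  ring

/-- A yielded challenge pays `1 - a₁`, the concession payoff, so a challenge at the instant of
conceding makes no difference; only an atom of player 1's concessions costs `D / 2`. -/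
lemma U₂_one (σ₁ : Strategy₁) {t : ℝ} (ht : 0 ≤ t) :
    B.U₂ t (fun _ => 1) σ₁ = B.value₂ σ₁ t - (1 - B.z₁) * (σ₁.F t - Function.leftLim σ₁.F t)
      * Real.exp (-B.r₂ * t) * (B.D / 2) := by
  unfold U₂ value₂ survivalProb₁ concessionProb₁ challengeProb D
  simp only [sub_self, zero_mul, sub_zero, add_zero]
  rw [integral_const_mul, integral_const_mul,
    StieltjesFunction.integral_Ico_eq σ₁.F_neg σ₁.F_le_one (by fun_prop) ht,
    StieltjesFunction.integral_Ico_eq σ₁.G_neg σ₁.G_le_one (by fun_prop) ht]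
  simp only [mul_assoc]
  rw [intervalIntegral.integral_const_mul]
  ring

lemma isBoundedMeasurable_U₁ (σ₂ : Strategy₂) : IsBoundedMeasurable fun t => B.U₁ t σ₂ := by
  have hr := B.r₁_pos.le
  have h1 := IsBoundedMeasurable.stieltjes σ₂.F_neg σ₂.F_le_one
  have h2 := IsBoundedMeasurable.leftLim σ₂.F_neg σ₂.F_le_one
  have h3 := ((IsBoundedMeasurable.const B.a₁).mul (IsBoundedMeasurable.exp hr)).integral_Ico
    (μ := σ₂.F.measure)
  exact ((((IsBoundedMeasurable.const _).mul h3).add ((((IsBoundedMeasurable.const _).sub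
    ((IsBoundedMeasurable.const _).mul h1)).mul (.exp hr)).mul (.const _)))).add
    ((((IsBoundedMeasurable.const _).mul (h1.sub h2)).mul (.exp hr)).mul (.const _))

lemma isBoundedMeasurable_V₁ (σ₂ : Strategy₂) : IsBoundedMeasurable fun t => B.V₁ t σ₂ := by
  have hr := B.r₁_pos.le
  have h1 := IsBoundedMeasurable.stieltjes σ₂.F_neg σ₂.F_le_one
  have hq := σ₂.isBoundedMeasurable_q
  have h3 := ((IsBoundedMeasurable.const B.a₁).mul (IsBoundedMeasurable.exp hr)).integral_Icc
    (μ := σ₂.F.measure)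
  exact ((((IsBoundedMeasurable.const _).mul h3).add ((((IsBoundedMeasurable.const _).sub
    ((IsBoundedMeasurable.const _).mul h1)).mul (.exp hr)).mul (.const _)))).add
    (((((IsBoundedMeasurable.const _).mul ((IsBoundedMeasurable.const _).sub h1)).mul
      (.exp hr)).mul ((((IsBoundedMeasurable.const _).sub hq).mul (.const _)).add hq)).mul (.const _))

lemma isBoundedMeasurable_U₂ (σ₁ : Strategy₁) {q : ℝ → ℝ} (hq : IsBoundedMeasurable q) :
    IsBoundedMeasurable fun t => B.U₂ t q σ₁ := by
  have hr := B.r₂_pos.le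
  have hγ := B.γ₁_nonneg
  have h1 := IsBoundedMeasurable.stieltjes σ₁.F_neg σ₁.F_le_one
  have h2 := IsBoundedMeasurable.leftLim σ₁.F_neg σ₁.F_le_one
  have h2' := IsBoundedMeasurable.leftLim σ₁.G_neg σ₁.G_le_one
  have h3 := ((IsBoundedMeasurable.const B.a₂).mul (IsBoundedMeasurable.exp hr)).integral_Ico
    (μ := σ₁.F.measure)
  have h4 := ((((IsBoundedMeasurable.const (1 - B.a₁)).add
    ((((IsBoundedMeasurable.const 1).sub hq).mul (.const (1 - B.w₁ - B.k₂))).mul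
      (.const B.D))).mul (IsBoundedMeasurable.exp hr))).integral_Ico (μ := σ₁.G.measure)
  have h5 := ((((IsBoundedMeasurable.const (1 - B.a₁)).sub
    ((((IsBoundedMeasurable.const 1).sub hq).mul (.const B.k₂)).mul
      (.const B.D))).mul ((IsBoundedMeasurable.const B.γ₁).mul (.exp hγ)))).intervalIntegral B.r₂_pos
  have h5' : IsBoundedMeasurable fun t => ∫ s in (0 : ℝ)..t,
      (1 - B.a₁ - (1 - q s) * B.k₂ * B.D) * Real.exp (-B.r₂ * s)
        * (B.γ₁ * Real.exp (-B.γ₁ * s)) := by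
    have h6 : ∀ s, (1 - B.a₁ - (1 - q s) * B.k₂ * B.D) * Real.exp (-B.r₂ * s)
        * (B.γ₁ * Real.exp (-B.γ₁ * s)) = (1 - B.a₁ - (1 - q s) * B.k₂ * B.D) *
          (B.γ₁ * Real.exp (-B.γ₁ * s)) * Real.exp (-B.r₂ * s) := fun s => by ring
    simp only [h6]
    exact h5
  exact (((((IsBoundedMeasurable.const _).mul h3).add ((IsBoundedMeasurable.const _).mul h5')).add
    ((IsBoundedMeasurable.const _).mul h4)).add ((((IsBoundedMeasurable.exp hr).mul (.const _)).mul
      ((((IsBoundedMeasurable.const _).sub ((IsBoundedMeasurable.const _).mul h1)).sub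
        ((IsBoundedMeasurable.const _).mul h2')).sub ((IsBoundedMeasurable.const _).mul
        ((IsBoundedMeasurable.const _).sub (.exp hγ))))))).add
    ((((IsBoundedMeasurable.const _).mul (h1.sub h2)).mul (.exp hr)).mul (.const _))

lemma u₁_concedeAt (σ₂ : Strategy₂) {t : ℝ} (ht : 0 ≤ t) :
    B.u₁ (Strategy₁.concedeAt t ht) σ₂ = B.U₁ t σ₂ := by
  classical
  unfold u₁ Strategy₁.concedeAt
  simp only [ProbabilityTheory.measure_cdf, StieltjesFunction.measure_zero]
  rw [setIntegral_dirac]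
  simp [ht]

lemma u₁_challengeAt (σ₂ : Strategy₂) {t : ℝ} (ht : 0 ≤ t) :
    B.u₁ (Strategy₁.challengeAt t ht) σ₂ = B.V₁ t σ₂ := by
  classical
  unfold u₁ Strategy₁.challengeAt
  simp only [ProbabilityTheory.measure_cdf, StieltjesFunction.measure_zero]
  rw [setIntegral_dirac]
  simp [ht]

lemma u₂_concedeAt (σ₁ : Strategy₁) {t : ℝ} (ht : 0 ≤ t) {q : ℝ → ℝ} (hq : Measurable q)
    (hq' : ∀ s, q s ∈ Icc (0 : ℝ) 1) :
    B.u₂ (Strategy₂.concedeAt t ht q hq hq') σ₁ = B.U₂ t q σ₁ := by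
  classical
  unfold u₂ Strategy₂.concedeAt
  simp only [ProbabilityTheory.measure_cdf]
  rw [setIntegral_dirac]
  simp [ht]

variable {B} {σ₁ : Strategy₁} {σ₂ : Strategy₂}

/-! ### Best replies are attained almost everywhere -/

namespace IsEquilibrium

lemma U₁_le (h : B.IsEquilibrium σ₁ σ₂) {t : ℝ} (ht : 0 ≤ t) : B.U₁ t σ₂ ≤ B.u₁ σ₁ σ₂ :=
  (B.u₁_concedeAt σ₂ ht).symm.trans_le (h.1 _)

lemma V₁_le (h : B.IsEquilibrium σ₁ σ₂) {t : ℝ} (ht : 0 ≤ t) : B.V₁ t σ₂ ≤ B.u₁ σ₁ σ₂ :=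
  (B.u₁_challengeAt σ₂ ht).symm.trans_le (h.1 _)

lemma U₂_le (h : B.IsEquilibrium σ₁ σ₂) {t : ℝ} (ht : 0 ≤ t) {q : ℝ → ℝ} (hq : Measurable q)
    (hq' : ∀ s, q s ∈ Icc (0 : ℝ) 1) : B.U₂ t q σ₁ ≤ B.u₂ σ₂ σ₁ :=
  (B.u₂_concedeAt σ₁ ht hq hq').symm.trans_le (h.2 _)

/-- Conceding at once already pays something. Positivity is what rules out mass that never acts. -/
lemma u₁_pos (h : B.IsEquilibrium σ₁ σ₂) : 0 < B.u₁ σ₁ σ₂ := by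
  refine lt_of_lt_of_le ?_ (h.U₁_le le_rfl)
  have hz := B.z₂_pos
  have hz' := B.z₂_lt_one
  have ha := B.a₂_lt_one
  have ha' := B.a₁_pos
  have h0 := σ₂.F_nonneg 0
  have h1 := σ₂.F_le_one 0
  unfold U₁
  rw [StieltjesFunction.leftLim_zero σ₂.F_neg]
  simp only [Ico_self, Measure.restrict_empty, integral_zero_measure, mul_zero, zero_add, sub_zero,
    Real.exp_zero, mul_one]
  have h2 : 0 < 1 - (1 - B.z₂) * σ₂.F 0 := by nlinarith
  have h3 : 0 ≤ (1 - B.z₂) * σ₂.F 0 * ((B.a₁ + 1 - B.a₂) / 2) :=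
    mul_nonneg (mul_nonneg (by linarith) h0) (by linarith)
  have h4 := mul_pos h2 (sub_pos.2 ha)
  linarith

lemma u₂_pos (h : B.IsEquilibrium σ₁ σ₂) : 0 < B.u₂ σ₂ σ₁ := by
  refine lt_of_lt_of_le ?_ (h.U₂_le le_rfl σ₂.q_measurable σ₂.q_mem)
  have hz := B.z₁_pos
  have hz' := B.z₁_lt_one
  have ha := B.a₁_lt_one
  have ha' := B.a₂_gt
  have h0 := σ₁.F_nonneg 0
  have h1 := σ₁.F_le_one 0
  unfold U₂
  rw [StieltjesFunction.leftLim_zero σ₁.F_neg, StieltjesFunction.leftLim_zero σ₁.G_neg]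
  simp only [Ico_self, Measure.restrict_empty, integral_zero_measure, mul_zero, zero_add, sub_zero,
    Real.exp_zero, mul_one, intervalIntegral.integral_same, sub_self, one_mul]
  have h2 : 0 < 1 - (1 - B.z₁) * σ₁.F 0 := by nlinarith
  have h3 : 0 ≤ (1 - B.z₁) * σ₁.F 0 * ((B.a₂ + 1 - B.a₁) / 2) :=
    mul_nonneg (mul_nonneg (by linarith) h0) (by linarith)
  have h4 := mul_pos (sub_pos.2 ha) h2
  linarith

lemma ae_nonneg_of_neg {F : StieltjesFunction ℝ} (hF : ∀ t, t < 0 → F t = 0) :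
    ∀ᵐ x ∂F.measure, 0 ≤ x := by
  rw [ae_iff]
  simpa [Iio_def] using StieltjesFunction.measure_Iio_zero hF

/-- The equilibrium payoff is an average of pure payoffs, none of which exceeds it because each is a
deviation; being positive, it also leaves no mass unused. -/
lemma attained₁ (h : B.IsEquilibrium σ₁ σ₂) :
    (∀ᵐ x ∂σ₁.F.measure, 0 ≤ x ∧ B.U₁ x σ₂ = B.u₁ σ₁ σ₂) ∧
      (∀ᵐ x ∂σ₁.G.measure, 0 ≤ x ∧ B.V₁ x σ₂ = B.u₁ σ₁ σ₂) ∧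
      ∃ l₁ l₂, Tendsto σ₁.F atTop (𝓝 l₁) ∧ Tendsto σ₁.G atTop (𝓝 l₂) ∧ l₁ + l₂ = 1 := by
  have hF0 := ae_nonneg_of_neg σ₁.F_neg
  have hG0 := ae_nonneg_of_neg σ₁.G_neg
  obtain ⟨l₁, hl₁, hl₁'⟩ := StieltjesFunction.exists_tendsto_real_univ σ₁.F_neg σ₁.F_le_one
  obtain ⟨l₂, hl₂, hl₂'⟩ := StieltjesFunction.exists_tendsto_real_univ σ₁.G_neg σ₁.G_le_one
  have hU := (B.isBoundedMeasurable_U₁ σ₂).integrableOn (μ := σ₁.F.measure) measurableSet_Ici le_rfl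
  have hV := (B.isBoundedMeasurable_V₁ σ₂).integrableOn (μ := σ₁.G.measure) measurableSet_Ici le_rfl
  rw [IntegrableOn, StieltjesFunction.restrict_Ici_zero σ₁.F_neg] at hU
  rw [IntegrableOn, StieltjesFunction.restrict_Ici_zero σ₁.G_neg] at hV
  have heq : ∫ x, B.U₁ x σ₂ ∂σ₁.F.measure + ∫ x, B.V₁ x σ₂ ∂σ₁.G.measure = B.u₁ σ₁ σ₂ := by
    unfold u₁
    rw [StieltjesFunction.restrict_Ici_zero σ₁.F_neg, StieltjesFunction.restrict_Ici_zero σ₁.G_neg]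
  have hmass : σ₁.F.measure.real univ + σ₁.G.measure.real univ ≤ 1 := by
    rw [hl₁', hl₂']
    exact le_of_tendsto (hl₁.add hl₂) (Eventually.of_forall σ₁.add_le_one)
  obtain ⟨h1, h2, h3⟩ := attained_of_integral_add_eq h.u₁_pos hU hV
    (hF0.mono fun x hx => h.U₁_le hx) (hG0.mono fun x hx => h.V₁_le hx) hmass heq
  exact ⟨hF0.and h1, hG0.and h2, l₁, l₂, hl₁, hl₂, by rw [← hl₁', ← hl₂', h3]⟩

lemma attained₂ (h : B.IsEquilibrium σ₁ σ₂) :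
    (∀ᵐ x ∂σ₂.F.measure, 0 ≤ x ∧ B.U₂ x σ₂.q σ₁ = B.u₂ σ₂ σ₁) ∧ Tendsto σ₂.F atTop (𝓝 1) := by
  have hF0 := ae_nonneg_of_neg σ₂.F_neg
  obtain ⟨l, hl, hl'⟩ := StieltjesFunction.exists_tendsto_real_univ σ₂.F_neg σ₂.F_le_one
  have hU := (B.isBoundedMeasurable_U₂ σ₁ σ₂.isBoundedMeasurable_q).integrableOn
    (μ := σ₂.F.measure) measurableSet_Ici le_rfl
  rw [IntegrableOn, StieltjesFunction.restrict_Ici_zero σ₂.F_neg] at hU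
  -- The zero measure fills the second slot of `attained_of_integral_add_eq`.
  have heq : ∫ x, B.U₂ x σ₂.q σ₁ ∂σ₂.F.measure + ∫ _, (0 : ℝ) ∂(0 : Measure ℝ) = B.u₂ σ₂ σ₁ := by
    unfold u₂
    rw [StieltjesFunction.restrict_Ici_zero σ₂.F_neg]
    simp
  have hmass : σ₂.F.measure.real univ + (0 : Measure ℝ).real univ ≤ 1 := by
    rw [hl']
    simpa using le_of_tendsto hl (Eventually.of_forall σ₂.F_le_one)
  obtain ⟨h1, -, h3⟩ := attained_of_integral_add_eq h.u₂_pos hU (integrable_zero _ _ _)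
    (hF0.mono fun x hx => h.U₂_le hx σ₂.q_measurable σ₂.q_mem) (by simp) hmass heq
  refine ⟨hF0.and h1, ?_⟩
  rw [hl'] at h3
  have : l = 1 := by simpa using h3
  exact this ▸ hl

end IsEquilibrium

/-! ### The critical distribution of challenges -/

variable (B : BargainingGame)

/-- The ratio of the challenges of an unjustified to those of a justified player 1 at which an
unjustified player 2 is indifferent between yielding and seeing. -/
def criticalRatio : ℝ := B.z₁ * B.k₂ / ((1 - B.z₁) * (1 - B.w₁ - B.k₂))

/-- The distribution of challenges of the unjustified player 1 that makes player 2 indifferent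
between yielding and seeing. -/
def criticalMeasure : Measure ℝ :=
  volume.withDensity fun x => ENNReal.ofReal (B.criticalRatio * (B.γ₁ * Real.exp (-B.γ₁ * x)))

lemma criticalRatio_pos : 0 < B.criticalRatio := by
  have h1 := B.k₂_lt
  have h2 := B.z₁_lt_one
  exact div_pos (mul_pos B.z₁_pos B.k₂_pos) (mul_pos (by linarith) (by linarith))

instance : IsLocallyFiniteMeasure B.criticalMeasure :=
  IsLocallyFiniteMeasure.withDensity_ofReal (by fun_prop)

lemma criticalDensity_nonneg (x : ℝ) :
    0 ≤ B.criticalRatio * (B.γ₁ * Real.exp (-B.γ₁ * x)) :=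
  mul_nonneg B.criticalRatio_pos.le (mul_nonneg B.γ₁_nonneg (Real.exp_pos _).le)

lemma setIntegral_criticalMeasure (f : ℝ → ℝ) {A : Set ℝ} (hA : MeasurableSet A) :
    ∫ x in A, f x ∂B.criticalMeasure
      = ∫ x in A, B.criticalRatio * (B.γ₁ * Real.exp (-B.γ₁ * x)) * f x := by
  unfold criticalMeasure
  rw [setIntegral_withDensity_eq_setIntegral_toReal_smul _ _ _ hA]
  · refine integral_congr_ae (ae_of_all _ fun x => ?_)
    simp only [smul_eq_mul]
    rw [ENNReal.toReal_ofReal (B.criticalDensity_nonneg x)]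
  · exact Measurable.ennreal_ofReal (by fun_prop)
  · exact ae_of_all _ fun x => ENNReal.ofReal_lt_top

lemma integral_exp_density (a b : ℝ) :
    ∫ x in a..b, B.γ₁ * Real.exp (-B.γ₁ * x) = Real.exp (-B.γ₁ * a) - Real.exp (-B.γ₁ * b) := by
  have h : ∀ x ∈ uIcc a b, HasDerivAt (fun x => -Real.exp (-B.γ₁ * x))
      (B.γ₁ * Real.exp (-B.γ₁ * x)) x := by
    intro x _
    have h0 : HasDerivAt (fun x => -B.γ₁ * x) (-B.γ₁) x := by
      simpa using (hasDerivAt_id x).const_mul (-B.γ₁)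
    exact h0.exp.neg.congr_deriv (by ring)
  rw [intervalIntegral.integral_eq_sub_of_hasDerivAt h
    (Continuous.intervalIntegrable (by fun_prop) _ _)]
  ring

lemma criticalMeasure_Ioc {a b : ℝ} (hab : a ≤ b) : B.criticalMeasure (Ioc a b)
    = ENNReal.ofReal (B.criticalRatio * (Real.exp (-B.γ₁ * a) - Real.exp (-B.γ₁ * b))) := by
  unfold criticalMeasure
  rw [withDensity_apply _ measurableSet_Ioc, ← ofReal_integral_eq_lintegral_ofReal
    ((Continuous.integrableOn_Ioc (by fun_prop)))
    (ae_of_all _ B.criticalDensity_nonneg), ← intervalIntegral.integral_of_le hab,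
    intervalIntegral.integral_const_mul, B.integral_exp_density]

lemma criticalMeasure_singleton (a : ℝ) : B.criticalMeasure {a} = 0 :=
  withDensity_absolutelyContinuous _ _ (Real.volume_singleton)

/-- The effect of the yielding strategy on the payoff of player 2. -/
lemma U₂_sub (σ₁ : Strategy₁) {q q' : ℝ → ℝ} (hq : IsBoundedMeasurable q)
    (hq' : IsBoundedMeasurable q') {t : ℝ} (ht : 0 ≤ t) :
    B.U₂ t q' σ₁ - B.U₂ t q σ₁ = (1 - B.z₁) * (1 - B.w₁ - B.k₂) * B.D *
      (∫ x in Ico 0 t, (q' x - q x) * Real.exp (-B.r₂ * x) ∂B.criticalMeasure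
        - ∫ x in Ico 0 t, (q' x - q x) * Real.exp (-B.r₂ * x) ∂σ₁.G.measure) := by
  have hr := B.r₂_pos.le
  have hγ := B.γ₁_nonneg
  have hG : ∀ {p : ℝ → ℝ}, IsBoundedMeasurable p → IntegrableOn (fun x =>
      (1 - B.a₁ + (1 - p x) * (1 - B.w₁ - B.k₂) * B.D) * Real.exp (-B.r₂ * x)) (Ico 0 t)
      σ₁.G.measure := fun {p} hp => IsBoundedMeasurable.integrableOn
    (((IsBoundedMeasurable.const _).add ((((IsBoundedMeasurable.const _).sub hp).mul
      (.const _)).mul (.const _))).mul (.exp hr)) measurableSet_Ico fun x hx => hx.1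
  have hV : ∀ {p : ℝ → ℝ}, IsBoundedMeasurable p → IntegrableOn (fun x =>
      (1 - B.a₁ - (1 - p x) * B.k₂ * B.D) * Real.exp (-B.r₂ * x) *
        (B.γ₁ * Real.exp (-B.γ₁ * x))) (Ico 0 t) volume := by
    intro p hp
    obtain ⟨hm, C, hC⟩ := ((((IsBoundedMeasurable.const (1 - B.a₁)).sub
      ((((IsBoundedMeasurable.const 1).sub hp).mul
      (.const B.k₂)).mul (.const B.D))).mul (.exp hr)).mul
        ((IsBoundedMeasurable.const B.γ₁).mul (.exp hγ)))
    refine Integrable.of_bound hm.aestronglyMeasurable C ?_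
    filter_upwards [ae_restrict_mem measurableSet_Ico] with x hx using hC x hx.1
  have h1 : ∫ x in Ico 0 t, (1 - B.a₁ + (1 - q' x) * (1 - B.w₁ - B.k₂) * B.D) *
        Real.exp (-B.r₂ * x) ∂σ₁.G.measure
      - ∫ x in Ico 0 t, (1 - B.a₁ + (1 - q x) * (1 - B.w₁ - B.k₂) * B.D) *
        Real.exp (-B.r₂ * x) ∂σ₁.G.measure
      = -((1 - B.w₁ - B.k₂) * B.D) *
        ∫ x in Ico 0 t, (q' x - q x) * Real.exp (-B.r₂ * x) ∂σ₁.G.measure := by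
    rw [← integral_sub (hG hq') (hG hq), ← integral_const_mul]
    refine integral_congr_ae (ae_of_all _ fun x => ?_)
    ring
  have h2 : (∫ s in (0 : ℝ)..t, (1 - B.a₁ - (1 - q' s) * B.k₂ * B.D) * Real.exp (-B.r₂ * s)
        * (B.γ₁ * Real.exp (-B.γ₁ * s)))
      - ∫ s in (0 : ℝ)..t, (1 - B.a₁ - (1 - q s) * B.k₂ * B.D) * Real.exp (-B.r₂ * s)
        * (B.γ₁ * Real.exp (-B.γ₁ * s))
      = B.k₂ * B.D / B.criticalRatio *
        ∫ x in Ico 0 t, (q' x - q x) * Real.exp (-B.r₂ * x) ∂B.criticalMeasure := by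
    rw [B.setIntegral_criticalMeasure _ measurableSet_Ico, intervalIntegral.integral_of_le ht,
      intervalIntegral.integral_of_le ht, ← integral_Ico_eq_integral_Ioc,
      ← integral_Ico_eq_integral_Ioc, ← integral_sub (hV hq') (hV hq), ← integral_const_mul]
    refine integral_congr_ae (ae_of_all _ fun x => ?_)
    have := B.criticalRatio_pos.ne'
    simp only
    field_simp
    ring
  -- This is the choice of the critical ratio: the loss from seeing justified challengers balances
  -- the gain from seeing unjustified ones.
  have h3 : B.z₁ * (B.k₂ * B.D / B.criticalRatio) = (1 - B.z₁) * (1 - B.w₁ - B.k₂) * B.D := by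
    have h4 := B.k₂_lt
    have h5 := B.z₁_lt_one
    have h6 : (1 - B.w₁ - B.k₂) ≠ 0 := by linarith
    have h7 : (1 - B.z₁) ≠ 0 := by linarith
    have h8 := B.z₁_pos.ne'
    have h9 := B.k₂_pos.ne'
    unfold criticalRatio
    field_simp
  unfold U₂
  linear_combination B.z₁ * h2 + (1 - B.z₁) * h1 + h3 *
    ∫ x in Ico 0 t, (q' x - q x) * Real.exp (-B.r₂ * x) ∂B.criticalMeasure

/-! ### Survival probabilities and increments of the values -/

lemma survivalProb₁_eq (σ₁ : Strategy₁) (t : ℝ) : B.survivalProb₁ σ₁ t =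
    B.z₁ * Real.exp (-B.γ₁ * t) + (1 - B.z₁) * (1 - σ₁.F t - σ₁.G t) := by
  unfold survivalProb₁ concessionProb₁ challengeProb
  ring

lemma survivalProb₂_eq (σ₂ : Strategy₂) (t : ℝ) : B.survivalProb₂ σ₂ t =
    B.z₂ + (1 - B.z₂) * (1 - σ₂.F t) := by
  unfold survivalProb₂ concessionProb₂
  ring

lemma survivalProb₁_pos (σ₁ : Strategy₁) (t : ℝ) : 0 < B.survivalProb₁ σ₁ t := by
  rw [survivalProb₁_eq]
  have h1 := mul_pos B.z₁_pos (Real.exp_pos (-B.γ₁ * t))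
  have h2 := mul_nonneg (sub_nonneg.2 B.z₁_lt_one.le)
    (by linarith [σ₁.add_le_one t] : 0 ≤ 1 - σ₁.F t - σ₁.G t)
  linarith

lemma z₂_le_survivalProb₂ (σ₂ : Strategy₂) (t : ℝ) : B.z₂ ≤ B.survivalProb₂ σ₂ t := by
  rw [survivalProb₂_eq]
  have h2 := mul_nonneg (sub_nonneg.2 B.z₂_lt_one.le)
    (by linarith [σ₂.F_le_one t] : 0 ≤ 1 - σ₂.F t)
  linarith

lemma survivalProb₂_pos (σ₂ : Strategy₂) (t : ℝ) : 0 < B.survivalProb₂ σ₂ t :=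
  B.z₂_pos.trans_le (B.z₂_le_survivalProb₂ σ₂ t)

lemma exp_anti {a : ℝ} (ha : 0 ≤ a) {s t : ℝ} (hst : s ≤ t) :
    Real.exp (-a * t) ≤ Real.exp (-a * s) := by
  rw [Real.exp_le_exp]
  nlinarith

lemma antitone_survivalProb₁ (σ₁ : Strategy₁) : Antitone (B.survivalProb₁ σ₁) := by
  intro s t hst
  rw [survivalProb₁_eq, survivalProb₁_eq]
  have h1 := mul_le_mul_of_nonneg_left (exp_anti B.γ₁_nonneg hst) B.z₁_pos.le
  have h2 := mul_le_mul_of_nonneg_left (by linarith [σ₁.F.mono hst, σ₁.G.mono hst] :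
    1 - σ₁.F t - σ₁.G t ≤ 1 - σ₁.F s - σ₁.G s) (sub_nonneg.2 B.z₁_lt_one.le)
  linarith

lemma antitone_survivalProb₂ (σ₂ : Strategy₂) : Antitone (B.survivalProb₂ σ₂) := by
  intro s t hst
  rw [survivalProb₂_eq, survivalProb₂_eq]
  have h2 := mul_le_mul_of_nonneg_left (by linarith [σ₂.F.mono hst] :
    1 - σ₂.F t ≤ 1 - σ₂.F s) (sub_nonneg.2 B.z₂_lt_one.le)
  linarith

/-- Waiting gains `D` at each concession of player 2 and loses interest on `1 - a₂` while she holds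
out; the bound discounts the gain from `s` and counts survival at `t`. -/
lemma value₁_sub_le (σ₂ : Strategy₂) {s t : ℝ} (hs : 0 ≤ s) (hst : s ≤ t) :
    B.value₁ σ₂ t - B.value₁ σ₂ s ≤ Real.exp (-B.r₁ * s) * B.D *
        (B.concessionProb₂ σ₂ t - B.concessionProb₂ σ₂ s)
      - (1 - B.a₂) * (Real.exp (-B.r₁ * s) - Real.exp (-B.r₁ * t)) * B.survivalProb₂ σ₂ t := by
  have h1 := StieltjesFunction.integral_Icc_exp_sub_le σ₂.F_neg σ₂.F_le_one B.r₁_pos.le hs hst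
  have h2 := mul_le_mul_of_nonneg_left h1
    (mul_nonneg (sub_nonneg.2 B.z₂_lt_one.le) B.a₁_pos.le)
  unfold value₁ survivalProb₂ concessionProb₂ D
  linarith

lemma le_value₁_sub (σ₂ : Strategy₂) {s t : ℝ} (hs : 0 ≤ s) (hst : s ≤ t) :
    Real.exp (-B.r₁ * t) * B.D * (B.concessionProb₂ σ₂ t - B.concessionProb₂ σ₂ s)
      - (1 - B.a₂) * (Real.exp (-B.r₁ * s) - Real.exp (-B.r₁ * t)) * B.survivalProb₂ σ₂ s
      ≤ B.value₁ σ₂ t - B.value₁ σ₂ s := by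
  have h1 := StieltjesFunction.le_integral_Icc_exp_sub σ₂.F_neg σ₂.F_le_one B.r₁_pos.le hs hst
  have h2 := mul_le_mul_of_nonneg_left h1
    (mul_nonneg (sub_nonneg.2 B.z₂_lt_one.le) B.a₁_pos.le)
  unfold value₁ survivalProb₂ concessionProb₂ D
  linarith

lemma integral_challenge_sub (s t : ℝ) :
    (∫ x in (0 : ℝ)..t, Real.exp (-B.r₂ * x) * (B.γ₁ * Real.exp (-B.γ₁ * x)))
      - (∫ x in (0 : ℝ)..s, Real.exp (-B.r₂ * x) * (B.γ₁ * Real.exp (-B.γ₁ * x)))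
      = ∫ x in s..t, Real.exp (-B.r₂ * x) * (B.γ₁ * Real.exp (-B.γ₁ * x)) :=
  intervalIntegral.integral_interval_sub_left
    (Continuous.intervalIntegrable (by fun_prop) _ _)
    (Continuous.intervalIntegrable (by fun_prop) _ _)

lemma integral_challenge_le {s t : ℝ} (hst : s ≤ t) :
    ∫ x in s..t, Real.exp (-B.r₂ * x) * (B.γ₁ * Real.exp (-B.γ₁ * x))
      ≤ Real.exp (-B.r₂ * s) * (Real.exp (-B.γ₁ * s) - Real.exp (-B.γ₁ * t)) := by
  rw [← B.integral_exp_density, ← intervalIntegral.integral_const_mul]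
  refine intervalIntegral.integral_mono_on hst (Continuous.intervalIntegrable (by fun_prop) _ _)
    (Continuous.intervalIntegrable (by fun_prop) _ _) fun x hx => ?_
  exact mul_le_mul_of_nonneg_right (exp_anti B.r₂_pos.le hx.1)
    (mul_nonneg B.γ₁_nonneg (Real.exp_pos _).le)

lemma le_integral_challenge {s t : ℝ} (hst : s ≤ t) :
    Real.exp (-B.r₂ * t) * (Real.exp (-B.γ₁ * s) - Real.exp (-B.γ₁ * t))
      ≤ ∫ x in s..t, Real.exp (-B.r₂ * x) * (B.γ₁ * Real.exp (-B.γ₁ * x)) := by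
  rw [← B.integral_exp_density, ← intervalIntegral.integral_const_mul]
  refine intervalIntegral.integral_mono_on hst (Continuous.intervalIntegrable (by fun_prop) _ _)
    (Continuous.intervalIntegrable (by fun_prop) _ _) fun x hx => ?_
  exact mul_le_mul_of_nonneg_right (exp_anti B.r₂_pos.le hx.2)
    (mul_nonneg B.γ₁_nonneg (Real.exp_pos _).le)

/-- Only concessions bring the gain `D`: the challenge terms cancel against the fall of the survival
probability, as a yielded challenge pays what conceding pays. -/
lemma value₂_sub_le (σ₁ : Strategy₁) {s t : ℝ} (hs : 0 ≤ s) (hst : s ≤ t) :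
    B.value₂ σ₁ t - B.value₂ σ₁ s ≤ Real.exp (-B.r₂ * s) * B.D *
        (B.concessionProb₁ σ₁ t - B.concessionProb₁ σ₁ s)
      - (1 - B.a₁) * (Real.exp (-B.r₂ * s) - Real.exp (-B.r₂ * t)) * B.survivalProb₁ σ₁ t := by
  have hz := sub_nonneg.2 B.z₁_lt_one.le
  have ha := sub_nonneg.2 B.a₁_lt_one.le
  have ha₂ : 0 ≤ B.a₂ := by linarith [B.a₂_gt]
  have h1 := mul_le_mul_of_nonneg_left (StieltjesFunction.integral_Icc_exp_sub_le σ₁.F_neg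
    σ₁.F_le_one B.r₂_pos.le hs hst) (mul_nonneg hz ha₂)
  have h2 := mul_le_mul_of_nonneg_left (StieltjesFunction.integral_Icc_exp_sub_le σ₁.G_neg
    σ₁.G_le_one B.r₂_pos.le hs hst) (mul_nonneg ha hz)
  have h3 := mul_le_mul_of_nonneg_left (B.integral_challenge_le hst) (mul_nonneg ha B.z₁_pos.le)
  have h4 := B.integral_challenge_sub s t
  rw [← h4] at h3
  unfold value₂ survivalProb₁ concessionProb₁ challengeProb D
  linarith

lemma le_value₂_sub (σ₁ : Strategy₁) {s t : ℝ} (hs : 0 ≤ s) (hst : s ≤ t) :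
    Real.exp (-B.r₂ * t) * B.D * (B.concessionProb₁ σ₁ t - B.concessionProb₁ σ₁ s)
      - (1 - B.a₁) * (Real.exp (-B.r₂ * s) - Real.exp (-B.r₂ * t)) * B.survivalProb₁ σ₁ s
      ≤ B.value₂ σ₁ t - B.value₂ σ₁ s := by
  have hz := sub_nonneg.2 B.z₁_lt_one.le
  have ha := sub_nonneg.2 B.a₁_lt_one.le
  have ha₂ : 0 ≤ B.a₂ := by linarith [B.a₂_gt]
  have h1 := mul_le_mul_of_nonneg_left (StieltjesFunction.le_integral_Icc_exp_sub σ₁.F_neg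
    σ₁.F_le_one B.r₂_pos.le hs hst) (mul_nonneg hz ha₂)
  have h2 := mul_le_mul_of_nonneg_left (StieltjesFunction.le_integral_Icc_exp_sub σ₁.G_neg
    σ₁.G_le_one B.r₂_pos.le hs hst) (mul_nonneg ha hz)
  have h3 := mul_le_mul_of_nonneg_left (B.le_integral_challenge hst) (mul_nonneg ha B.z₁_pos.le)
  have h4 := B.integral_challenge_sub s t
  rw [← h4] at h3
  unfold value₂ survivalProb₁ concessionProb₁ challengeProb D
  linarith

/-- An upper bound on a value at the times without an atom of the opponent holds at all times. -/
lemma value_le_of_lower {F : StieltjesFunction ℝ} {W X S : ℝ → ℝ} {a c d u : ℝ}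
    (hd : 0 ≤ d) (hX : Monotone X)
    (hlow : ∀ s t, 0 ≤ s → s ≤ t → Real.exp (-a * t) * d * (X t - X s)
      - c * (Real.exp (-a * s) - Real.exp (-a * t)) * S s ≤ W t - W s)
    (hle : ∀ t, 0 ≤ t → Function.leftLim F t = F t → W t ≤ u) {s : ℝ} (hs : 0 ≤ s) : W s ≤ u := by
  have hE : Tendsto (fun t => u + c * (Real.exp (-a * s) - Real.exp (-a * t)) * S s) (𝓝[>] s)
      (𝓝 (u + c * 0 * S s)) :=
    (((IsAttrition.tendsto_exp_sub a s _ nhdsWithin_le_nhds).const_mul c).mul_const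
      (S s)).const_add u
  by_contra hlt
  push Not at hlt
  have h1 : ∀ᶠ t in 𝓝[>] s, u + c * (Real.exp (-a * s) - Real.exp (-a * t)) * S s < W s :=
    hE.eventually (gt_mem_nhds (by simpa using hlt))
  obtain ⟨e, he, heU⟩ := mem_nhdsGT_iff_exists_Ioo_subset.1 h1
  -- Atoms are countable, so there are times without one arbitrarily soon after `s`; by `hlow` the
  -- value falls little until then.
  have hdense : Dense {x | Function.leftLim F x ≠ F x}ᶜ := F.countable_leftLim_ne.dense_compl ℝ
  obtain ⟨t, ht, ht'⟩ := hdense.inter_open_nonempty _ isOpen_Ioo (nonempty_Ioo.2 he)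
  have h2 : u + c * (Real.exp (-a * s) - Real.exp (-a * t)) * S s < W s := heU ht
  have h3 := hlow s t hs ht.1.le
  have h4 := hle t (hs.trans ht.1.le) (by simpa using ht')
  have h5 := mul_nonneg (mul_nonneg (Real.exp_pos (-a * t)).le hd) (sub_nonneg.2 (hX ht.1.le))
  linarith

variable {B} {σ₁ : Strategy₁} {σ₂ : Strategy₂}

lemma monotone_concessionProb₁ : Monotone (B.concessionProb₁ σ₁) := fun _ _ h =>
  mul_le_mul_of_nonneg_left (σ₁.F.mono h) (sub_nonneg.2 B.z₁_lt_one.le)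

lemma monotone_concessionProb₂ : Monotone (B.concessionProb₂ σ₂) := fun _ _ h =>
  mul_le_mul_of_nonneg_left (σ₂.F.mono h) (sub_nonneg.2 B.z₂_lt_one.le)

/-! ### Player 2's response to challenges bounds their distribution -/

namespace IsEquilibrium

lemma value₁_le (h : B.IsEquilibrium σ₁ σ₂) {t : ℝ} (ht : 0 ≤ t) :
    B.value₁ σ₂ t ≤ B.u₁ σ₁ σ₂ := by
  refine value_le_of_lower (F := σ₂.F) B.D_pos.le monotone_concessionProb₂
    (fun s t hs hst => B.le_value₁_sub σ₂ hs hst) (fun t ht htF => ?_) ht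
  have := h.U₁_le ht
  rw [B.U₁_eq σ₂ ht, htF] at this
  simpa using this

lemma value₂_le (h : B.IsEquilibrium σ₁ σ₂) {t : ℝ} (ht : 0 ≤ t) :
    B.value₂ σ₁ t ≤ B.u₂ σ₂ σ₁ := by
  refine value_le_of_lower (F := σ₁.F) B.D_pos.le monotone_concessionProb₁
    (fun s t hs hst => B.le_value₂_sub σ₁ hs hst) (fun t ht htF => ?_) ht
  have := h.U₂_le ht measurable_const (q := fun _ => 1) fun _ => by simp
  rw [B.U₂_one σ₁ ht, htF] at this
  simpa using this

/-- The unjustified player 1 challenges only where he is yielded to with positive probability. -/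
lemma challenge_ae (h : B.IsEquilibrium σ₁ σ₂) :
    ∀ᵐ x ∂σ₁.G.measure, 0 ≤ x ∧ B.c₁ * B.survivalProb₂ σ₂ x ≤
      (B.survivalProb₂ σ₂ x - B.z₂) * (B.w₁ + σ₂.q x * (1 - B.w₁)) := by
  filter_upwards [h.attained₁.2.1] with x ⟨hx0, hx⟩
  refine ⟨hx0, ?_⟩
  rw [B.V₁_eq] at hx
  have h1 := h.value₁_le hx0
  have h2 : 0 < Real.exp (-B.r₁ * x) * B.D := mul_pos (Real.exp_pos _) B.D_pos
  by_contra hlt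
  push Not at hlt
  have := mul_neg_of_pos_of_neg h2 (sub_neg.2 hlt)
  linarith

/-- A challenge that is certainly seen succeeds with probability at most `w₁`, which is less than
its cost `c₁`. -/
lemma q_pos_ae (h : B.IsEquilibrium σ₁ σ₂) : ∀ᵐ x ∂σ₁.G.measure, 0 < σ₂.q x := by
  filter_upwards [h.challenge_ae] with x ⟨hx0, hx⟩
  have h1 := B.z₂_pos
  have h2 := B.z₂_le_survivalProb₂ σ₂ x
  by_contra hq
  have hq0 : σ₂.q x = 0 := le_antisymm (not_lt.1 hq) (σ₂.q_mem x).1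
  rw [hq0, zero_mul, add_zero] at hx
  have h3 := B.w₁_lt_c₁
  have h4 := B.w₁_nonneg
  nlinarith

/-- Deviations of player 2 to other yielding strategies are not profitable. -/
lemma deviation_le (h : B.IsEquilibrium σ₁ σ₂) {s : ℝ} (hs : 0 ≤ s)
    (hU : B.U₂ s σ₂.q σ₁ = B.u₂ σ₂ σ₁) {φ : ℝ → ℝ} (hφ : Measurable φ)
    (hφq : ∀ x, σ₂.q x + φ x ∈ Icc (0 : ℝ) 1) :
    ∫ x in Ico 0 s, φ x * Real.exp (-B.r₂ * x) ∂B.criticalMeasure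
      ≤ ∫ x in Ico 0 s, φ x * Real.exp (-B.r₂ * x) ∂σ₁.G.measure := by
  have hm := σ₂.q_measurable.add hφ
  have h1 := h.U₂_le hs hm hφq
  have h2 := B.U₂_sub σ₁ σ₂.isBoundedMeasurable_q (q' := fun x => σ₂.q x + φ x)
    ⟨hm, 1, fun t _ => abs_le.2 ⟨by linarith [(hφq t).1], (hφq t).2⟩⟩ hs
  simp only [add_sub_cancel_left] at h2
  have h3 : B.U₂ s (fun x => σ₂.q x + φ x) σ₁ ≤ B.u₂ σ₂ σ₁ := h1
  have h4 : 0 < (1 - B.z₁) * (1 - B.w₁ - B.k₂) * B.D :=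
    mul_pos (mul_pos (sub_pos.2 B.z₁_lt_one) (by linarith [B.k₂_lt])) B.D_pos
  by_contra hlt
  push Not at hlt
  have := mul_pos h4 (sub_pos.2 hlt)
  linarith

lemma isFiniteMeasure_critical (B : BargainingGame) (s : ℝ) :
    IsFiniteMeasure (B.criticalMeasure.restrict (Ico 0 s)) :=
  ⟨by simpa using measure_Ico_lt_top⟩

/-- If unjustified challenges were overweight on some set, seeing all challenges there would pay.
The comparison carries the weight `q`, which is positive wherever challenges are made. -/
lemma G_restrict_le (h : B.IsEquilibrium σ₁ σ₂) {s : ℝ} (hs : 0 ≤ s)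
    (hU : B.U₂ s σ₂.q σ₁ = B.u₂ σ₂ σ₁) :
    σ₁.G.measure.restrict (Ico 0 s) ≤ B.criticalMeasure.restrict (Ico 0 s) := by
  have := isFiniteMeasure_critical B s
  have hb := σ₂.isBoundedMeasurable_q.mul (.exp B.r₂_pos.le)
  have hi : ∀ (m : Measure ℝ) [IsFiniteMeasure (m.restrict (Ico 0 s))],
      Integrable (fun x => σ₂.q x * Real.exp (-B.r₂ * x)) (m.restrict (Ico 0 s)) := by
    intro m _
    have := hb.integrableOn (μ := m.restrict (Ico 0 s)) (A := Ico 0 s) measurableSet_Ico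
      fun x hx => hx.1
    rwa [IntegrableOn, Measure.restrict_restrict measurableSet_Ico, inter_self] at this
  refine measure_le_of_setIntegral_le (f := fun x => σ₂.q x * Real.exp (-B.r₂ * x)) hb.1
    (fun x => mul_nonneg (σ₂.q_mem x).1 (Real.exp_pos _).le) (hi _) (hi _) ?_ ?_
  · refine ae_restrict_of_ae ?_
    filter_upwards [h.q_pos_ae] with x hx using mul_pos hx (Real.exp_pos _)
  · intro A hA
    -- The deviation sees every challenge on `A`.
    have h1 := h.deviation_le hs hU (φ := fun x => -A.indicator σ₂.q x)
      (σ₂.q_measurable.indicator hA).neg fun x => by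
        by_cases hx : x ∈ A
        · simp [hx]
        · simpa [hx] using σ₂.q_mem x
    have h2 : ∀ x, -A.indicator σ₂.q x * Real.exp (-B.r₂ * x)
        = -A.indicator (fun x => σ₂.q x * Real.exp (-B.r₂ * x)) x := by
      intro x
      by_cases hx : x ∈ A <;> simp [hx]
    simp only [h2, integral_neg, integral_indicator hA] at h1
    linarith

/-- The mirror image: where yielding is not yet certain, too few unjustified challenges would make
more yielding pay. -/
lemma critical_restrict_le (h : B.IsEquilibrium σ₁ σ₂) {b s : ℝ} (hs : 0 ≤ s) (hbs : b ≤ s)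
    (hU : B.U₂ s σ₂.q σ₁ = B.u₂ σ₂ σ₁) (hq : ∀ x, 0 ≤ x → x < b → σ₂.q x < 1) :
    B.criticalMeasure.restrict (Ico 0 b) ≤ σ₁.G.measure.restrict (Ico 0 b) := by
  have := isFiniteMeasure_critical B b
  have hb := ((IsBoundedMeasurable.const 1).sub σ₂.isBoundedMeasurable_q).mul (.exp B.r₂_pos.le)
  have hi : ∀ (m : Measure ℝ) [IsFiniteMeasure (m.restrict (Ico 0 b))],
      Integrable (fun x => (1 - σ₂.q x) * Real.exp (-B.r₂ * x)) (m.restrict (Ico 0 b)) := by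
    intro m _
    have := hb.integrableOn (μ := m.restrict (Ico 0 b)) (A := Ico 0 b) measurableSet_Ico
      fun x hx => hx.1
    rwa [IntegrableOn, Measure.restrict_restrict measurableSet_Ico, inter_self] at this
  refine measure_le_of_setIntegral_le (f := fun x => (1 - σ₂.q x) * Real.exp (-B.r₂ * x)) hb.1
    (fun x => mul_nonneg (sub_nonneg.2 (σ₂.q_mem x).2) (Real.exp_pos _).le) (hi _) (hi _) ?_ ?_
  · filter_upwards [ae_restrict_mem measurableSet_Ico] with x hx using
      mul_pos (sub_pos.2 (hq x hx.1 hx.2)) (Real.exp_pos _)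
  · intro A hA
    have hA' : MeasurableSet (A ∩ Ico 0 b) := hA.inter measurableSet_Ico
    have h1 := h.deviation_le hs hU (φ := fun x => (A ∩ Ico 0 b).indicator (fun x => 1 - σ₂.q x) x)
      ((measurable_const.sub σ₂.q_measurable).indicator hA') fun x => by
        by_cases hx : x ∈ A ∩ Ico 0 b
        · simp [indicator_of_mem hx]
        · simpa [indicator_of_notMem hx] using σ₂.q_mem x
    have h2 : ∀ x, (A ∩ Ico 0 b).indicator (fun x => 1 - σ₂.q x) x * Real.exp (-B.r₂ * x)
        = (A ∩ Ico 0 b).indicator (fun x => (1 - σ₂.q x) * Real.exp (-B.r₂ * x)) x := by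
      intro x
      by_cases hx : x ∈ A ∩ Ico 0 b
      · simp [indicator_of_mem hx]
      · simp [indicator_of_notMem hx]
    have h3 : A ∩ Ico 0 b ∩ Ico 0 s = A ∩ Ico 0 b := inter_eq_left.2 fun x hx =>
      ⟨hx.2.1, hx.2.2.trans_le hbs⟩
    simp only [h2, integral_indicator hA', Measure.restrict_restrict hA', h3] at h1
    rwa [Measure.restrict_restrict hA, Measure.restrict_restrict hA]

/-- Where player 2 concedes, she may as well yield to all challenges. -/
lemma U₂_one_eq (h : B.IsEquilibrium σ₁ σ₂) {s : ℝ} (hs : 0 ≤ s)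
    (hU : B.U₂ s σ₂.q σ₁ = B.u₂ σ₂ σ₁) : B.U₂ s (fun _ => 1) σ₁ = B.u₂ σ₂ σ₁ := by
  refine le_antisymm (h.U₂_le hs measurable_const fun _ => by simp) ?_
  have := isFiniteMeasure_critical B s
  have hb := ((IsBoundedMeasurable.const 1).sub σ₂.isBoundedMeasurable_q).mul (.exp B.r₂_pos.le)
  have h2 := B.U₂_sub σ₁ σ₂.isBoundedMeasurable_q (.const 1) hs
  -- Challenges are at most critical, so yielding more costs nothing.
  have h3 : ∫ x in Ico 0 s, (1 - σ₂.q x) * Real.exp (-B.r₂ * x) ∂σ₁.G.measure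
      ≤ ∫ x in Ico 0 s, (1 - σ₂.q x) * Real.exp (-B.r₂ * x) ∂B.criticalMeasure := by
    refine integral_mono_measure (h.G_restrict_le hs hU) (ae_of_all _ fun x =>
      mul_nonneg (sub_nonneg.2 (σ₂.q_mem x).2) (Real.exp_pos _).le) ?_
    have := hb.integrableOn (μ := B.criticalMeasure.restrict (Ico 0 s)) (A := Ico 0 s)
      measurableSet_Ico fun x hx => hx.1
    rwa [IntegrableOn, Measure.restrict_restrict measurableSet_Ico, inter_self] at this
  have h4 : 0 < (1 - B.z₁) * (1 - B.w₁ - B.k₂) * B.D :=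
    mul_pos (mul_pos (sub_pos.2 B.z₁_lt_one) (by linarith [B.k₂_lt])) B.D_pos
  have := mul_nonneg h4.le (sub_nonneg.2 h3)
  linarith

end IsEquilibrium

/-! ### Equilibrium concession as a war of attrition -/

lemma leftLim_const_mul {f : ℝ → ℝ} (hf : Monotone f) (c x : ℝ) :
    Function.leftLim (fun t => c * f t) x = c * Function.leftLim f x :=
  leftLim_eq_of_tendsto ((hf.tendsto_leftLim x).const_mul c)

variable {B : BargainingGame} {σ₁ : Strategy₁} {σ₂ : Strategy₂}

lemma leftLim_concessionProb₁ (x : ℝ) : Function.leftLim (B.concessionProb₁ σ₁) x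
    = (1 - B.z₁) * Function.leftLim σ₁.F x := leftLim_const_mul σ₁.F.mono _ _

lemma leftLim_concessionProb₂ (x : ℝ) : Function.leftLim (B.concessionProb₂ σ₂) x
    = (1 - B.z₂) * Function.leftLim σ₂.F x := leftLim_const_mul σ₂.F.mono _ _

lemma eq_of_sub_mul_eq {v u p c : ℝ} (hv : v ≤ u) (hp : 0 ≤ p) (hc : 0 < c) (h : v - p * c = u) :
    v = u ∧ p = 0 := by
  have h1 : p * c = 0 := le_antisymm (by linarith) (mul_nonneg hp hc.le)
  have h2 : p = 0 := by simpa [hc.ne'] using h1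
  exact ⟨by linarith, h2⟩

namespace IsEquilibrium

/-- The value right after `x` is at most the equilibrium payoff, so attaining that payoff at `x`
leaves no room for the loss from a tie. -/
lemma optimal₁ (h : B.IsEquilibrium σ₁ σ₂) {x : ℝ} (hx : 0 ≤ x) (hU : B.U₁ x σ₂ = B.u₁ σ₁ σ₂) :
    B.value₁ σ₂ x = B.u₁ σ₁ σ₂ ∧
      Function.leftLim (B.concessionProb₂ σ₂) x = B.concessionProb₂ σ₂ x := by
  rw [B.U₁_eq σ₂ hx, mul_assoc] at hU
  obtain ⟨h1, h2⟩ := eq_of_sub_mul_eq (h.value₁_le hx) (mul_nonneg (sub_nonneg.2 B.z₂_lt_one.le)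
    (sub_nonneg.2 (σ₂.F.mono.leftLim_le le_rfl)))
    (mul_pos (Real.exp_pos _) (half_pos B.D_pos)) hU
  refine ⟨h1, ?_⟩
  rw [leftLim_concessionProb₂]
  unfold concessionProb₂
  linarith

lemma optimal₂ (h : B.IsEquilibrium σ₁ σ₂) {x : ℝ} (hx : 0 ≤ x)
    (hU : B.U₂ x σ₂.q σ₁ = B.u₂ σ₂ σ₁) : B.value₂ σ₁ x = B.u₂ σ₂ σ₁ ∧
      Function.leftLim (B.concessionProb₁ σ₁) x = B.concessionProb₁ σ₁ x := by
  replace hU := h.U₂_one_eq hx hU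
  rw [B.U₂_one σ₁ hx, mul_assoc] at hU
  obtain ⟨h1, h2⟩ := eq_of_sub_mul_eq (h.value₂_le hx) (mul_nonneg (sub_nonneg.2 B.z₁_lt_one.le)
    (sub_nonneg.2 (σ₁.F.mono.leftLim_le le_rfl)))
    (mul_pos (Real.exp_pos _) (half_pos B.D_pos)) hU
  refine ⟨h1, ?_⟩
  rw [leftLim_concessionProb₁]
  unfold concessionProb₁
  linarith

lemma lt_of_concessionProb₁_lt {s t : ℝ} (h : (1 - B.z₁) * s < (1 - B.z₁) * t) : s < t :=
  lt_of_mul_lt_mul_left h (sub_nonneg.2 B.z₁_lt_one.le)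

lemma lt_of_concessionProb₂_lt {s t : ℝ} (h : (1 - B.z₂) * s < (1 - B.z₂) * t) : s < t :=
  lt_of_mul_lt_mul_left h (sub_nonneg.2 B.z₂_lt_one.le)

/-- In equilibrium, concessions form a war of attrition; player 2 is indexed by `true`. -/
theorem isAttrition (h : B.IsEquilibrium σ₁ σ₂) : IsAttrition
    (fun i => cond i (B.concessionProb₂ σ₂) (B.concessionProb₁ σ₁))
    (fun i => cond i (B.survivalProb₂ σ₂) (B.survivalProb₁ σ₁))
    (fun i => cond i (B.value₂ σ₁) (B.value₁ σ₂))
    (fun i => cond i (B.u₂ σ₂ σ₁) (B.u₁ σ₁ σ₂))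
    (fun i => cond i B.r₂ B.r₁) (fun i => cond i (1 - B.a₁) (1 - B.a₂)) B.D where
  D_pos := B.D_pos
  r_pos i := by cases i; exacts [B.r₁_pos, B.r₂_pos]
  c_pos i := by cases i; exacts [sub_pos.2 B.a₂_lt_one, sub_pos.2 B.a₁_lt_one]
  mono i := by cases i; exacts [monotone_concessionProb₁, monotone_concessionProb₂]
  right_cont i t := by
    cases i
    exacts [(σ₁.F.right_continuous t).const_mul _, (σ₂.F.right_continuous t).const_mul _]
  neg i t ht := by
    cases i
    · simp [concessionProb₁, σ₁.F_neg t ht]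
    · simp [concessionProb₂, σ₂.F_neg t ht]
  S_pos i t _ := by cases i; exacts [B.survivalProb₁_pos σ₁ t, B.survivalProb₂_pos σ₂ t]
  S_anti i := by
    cases i
    exacts [(B.antitone_survivalProb₁ σ₁).antitoneOn _, (B.antitone_survivalProb₂ σ₂).antitoneOn _]
  upper i s t hs hst := by
    cases i
    exacts [B.value₁_sub_le σ₂ hs hst, B.value₂_sub_le σ₁ hs hst]
  lower i s t hs hst := by
    cases i
    exacts [B.le_value₁_sub σ₂ hs hst, B.le_value₂_sub σ₁ hs hst]
  le i t ht := by cases i; exacts [h.value₁_le ht, h.value₂_le ht]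
  carrier i s t hst ht hX := by
    cases i
    · obtain ⟨x, h1, h2, h3, h4⟩ := StieltjesFunction.exists_of_ae h.attained₁.1
        (lt_of_concessionProb₁_lt hX)
      exact ⟨x, h1, h2, h3, h.optimal₁ h3 h4⟩
    · obtain ⟨x, h1, h2, h3, h4⟩ := StieltjesFunction.exists_of_ae h.attained₂.1
        (lt_of_concessionProb₂_lt hX)
      exact ⟨x, h1, h2, h3, h.optimal₂ h3 h4⟩
  atom i t ht hX := by
    cases i
    · simp only [cond_false, leftLim_concessionProb₁] at hX
      exact h.optimal₁ ht (StieltjesFunction.of_ae_of_atom h.attained₁.1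
        (lt_of_concessionProb₁_lt hX)).2
    · simp only [cond_true, leftLim_concessionProb₂] at hX
      exact h.optimal₂ ht (StieltjesFunction.of_ae_of_atom h.attained₂.1
        (lt_of_concessionProb₂_lt hX)).2

lemma eq_of_tendsto_of_eventually_const {f : ℝ → ℝ} {l t : ℝ} (h : Tendsto f atTop (𝓝 l))
    (hc : ∀ s, t ≤ s → f s = f t) : f t = l :=
  tendsto_nhds_unique (tendsto_const_nhds.congr' (by
    filter_upwards [eventually_ge_atTop t] with s hs using (hc s hs).symm)) h

/-- The unjustified player 1 does not challenge once player 2 is likely to be justified. -/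
lemma G_const (h : B.IsEquilibrium σ₁ σ₂) {a : ℝ}
    (ha : ∀ x, a < x → 0 ≤ x → (1 - B.c₁) * B.survivalProb₂ σ₂ x < B.z₂) {t : ℝ} (hat : a ≤ t) :
    σ₁.G t = σ₁.G a := by
  refine le_antisymm ?_ (σ₁.G.mono hat)
  by_contra hlt
  push Not at hlt
  obtain ⟨x, h1, -, h3, h4⟩ := StieltjesFunction.exists_of_ae h.challenge_ae hlt
  have h5 := ha x h1 h3
  have h6 : B.w₁ + σ₂.q x * (1 - B.w₁) ≤ 1 := by
    nlinarith [(σ₂.q_mem x).2, B.w₁_lt_one]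
  have h7 := mul_le_mul_of_nonneg_left h6 (sub_nonneg.2 (B.z₂_le_survivalProb₂ σ₂ x))
  linarith

lemma survivalProb₂_of_F_eq_one {t : ℝ} (ht : σ₂.F t = 1) : B.survivalProb₂ σ₂ t = B.z₂ := by
  rw [survivalProb₂_eq, ht]; ring

lemma one_sub_c₁_mul_z₂_lt (B : BargainingGame) : (1 - B.c₁) * B.z₂ < B.z₂ := by
  have h1 := B.w₁_lt_c₁
  have h2 := B.w₁_nonneg
  nlinarith [B.z₂_pos]

/-- The justified player 2 never concedes, which bounds the war. In the degenerate case of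
concession at 0 only, player 2 is known to be justified afterwards, so player 1 does not challenge
either and both unjustified types concede at 0. -/
theorem exists_last_concession (h : B.IsEquilibrium σ₁ σ₂) : ∃ T, 0 < T ∧
    (∀ t, 0 ≤ t → t ≤ T → B.value₁ σ₂ t = B.u₁ σ₁ σ₂) ∧
    (∀ t, 0 ≤ t → t ≤ T → B.value₂ σ₁ t = B.u₂ σ₂ σ₁) ∧
    (∀ t, 0 < t → Function.leftLim σ₁.F t = σ₁.F t) ∧
    (∀ t, 0 < t → Function.leftLim σ₂.F t = σ₂.F t) ∧
    (∀ t, T ≤ t → σ₁.F t = σ₁.F T) ∧ (∀ t, T ≤ t → σ₂.F t = 1) ∧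
    (∀ s t, 0 ≤ s → s < t → t ≤ T → σ₁.F s < σ₁.F t) ∧
    (∀ s t, 0 ≤ s → s < t → t ≤ T → σ₂.F s < σ₂.F t) := by
  have hz₁ := sub_pos.2 B.z₁_lt_one
  have hz₂ := sub_pos.2 B.z₂_lt_one
  obtain ⟨T, hT, hW, hcont, hcon, hlt⟩ := h.isAttrition.exists_last_time (j := true) B.z₂_pos
    (fun t _ => B.z₂_le_survivalProb₂ σ₂ t) (C := 1 - B.z₂) (fun t => by
      simpa [concessionProb₂] using mul_le_mul_of_nonneg_left (σ₂.F_le_one t) hz₂.le)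
    (fun hc => by
      have h2 : σ₂.F 0 = 1 := eq_of_tendsto_of_eventually_const h.attained₂.2 fun s hs =>
        mul_left_cancel₀ hz₂.ne' (hc true s hs)
      have h2' : ∀ x, 0 ≤ x → σ₂.F x = 1 := fun x hx =>
        le_antisymm (σ₂.F_le_one x) (h2 ▸ σ₂.F.mono hx)
      -- Starting from a negative time, where `G` is 0, also excludes an atom of challenges at 0.
      have hG : ∀ t, -1 ≤ t → σ₁.G t = σ₁.G (-1) := fun t ht => h.G_const (fun x _ hx => by
        rw [survivalProb₂_of_F_eq_one (h2' x hx)]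
        exact one_sub_c₁_mul_z₂_lt B) ht
      obtain ⟨l₁, l₂, hl₁, hl₂, hl⟩ := h.attained₁.2.2
      have h3 := eq_of_tendsto_of_eventually_const hl₂ hG
      rw [σ₁.G_neg _ (by norm_num)] at h3
      have h1 : σ₁.F 0 = l₁ := eq_of_tendsto_of_eventually_const hl₁ fun s hs =>
        mul_left_cancel₀ hz₁.ne' (hc false s hs)
      have h1' : σ₁.F 0 = 1 := by linarith
      intro i
      cases i
      · simpa [concessionProb₁, h1'] using B.z₁_lt_one
      · simpa [concessionProb₂, h2] using B.z₂_lt_one)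
  refine ⟨T, hT, hW false, hW true, fun t ht => ?_, fun t ht => ?_, fun t ht => ?_, ?_,
    fun s t h1 h2 h3 => lt_of_concessionProb₁_lt (hlt false s t h1 h2 h3),
    fun s t h1 h2 h3 => lt_of_concessionProb₂_lt (hlt true s t h1 h2 h3)⟩
  · have := hcont false t ht
    simp only [cond_false, leftLim_concessionProb₁] at this
    exact mul_left_cancel₀ hz₁.ne' this
  · have := hcont true t ht
    simp only [cond_true, leftLim_concessionProb₂] at this
    exact mul_left_cancel₀ hz₂.ne' this
  · exact mul_left_cancel₀ hz₁.ne' (hcon false t ht)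
  · have hc : ∀ t, T ≤ t → σ₂.F t = σ₂.F T := fun t ht =>
      mul_left_cancel₀ hz₂.ne' (hcon true t ht)
    have h1 := eq_of_tendsto_of_eventually_const h.attained₂.2 hc
    exact fun t ht => (hc t ht).trans h1

end IsEquilibrium

/-! ### The common profile of all equilibria -/

lemma continuousOn_of_leftLim {F : StieltjesFunction ℝ}
    (h : ∀ t, 0 < t → Function.leftLim F t = F t) : ContinuousOn F (Ici 0) := by
  intro t ht
  rcases (mem_Ici.1 ht).eq_or_lt with rfl | ht
  · exact F.right_continuous 0
  · exact (F.mono.continuousAt_iff_leftLim_eq_rightLim.2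
      ((h t ht).trans (F.rightLim_eq t).symm)).continuousWithinAt

/-- Linear equations for the right derivative have only exponential solutions. -/
lemma eq_mul_exp_of_hasDerivWithinAt {f : ℝ → ℝ} {k a b : ℝ} (hf : ContinuousOn f (Icc a b))
    (hd : ∀ x ∈ Ico a b, HasDerivWithinAt f (k * f x) (Ici x) x) {t : ℝ} (ht : t ∈ Icc a b) :
    f t = f a * Real.exp (k * (t - a)) := by
  have hE : ∀ x, HasDerivAt (fun x => Real.exp (-k * (x - a))) (Real.exp (-k * (x - a)) * -k) x := by
    intro x
    have h0 : HasDerivAt (fun x => -k * (x - a)) (-k) x := by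
      simpa using ((hasDerivAt_id x).sub_const a).const_mul (-k)
    exact h0.exp
  have h1 := constant_of_has_deriv_right_zero (f := fun x => f x * Real.exp (-k * (x - a)))
    (hf.mul (by fun_prop)) (fun x hx =>
      ((hd x hx).mul (hE x).hasDerivWithinAt).congr_deriv (by ring)) t ht
  simp only [sub_self, mul_zero, Real.exp_zero, mul_one] at h1
  rw [← h1, mul_assoc, ← Real.exp_add]
  ring_nf
  simp

variable (B) in
/-- The time before the end of concession at which player 2's reputation makes challenging
unprofitable. -/
def quietTime : ℝ := -Real.log (1 - B.c₁) / B.lam₂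

variable (B) in
/-- The time at which challenging becomes unprofitable if concession ends at `T`. -/
def cutoff (T : ℝ) : ℝ := max 0 (T - B.quietTime)

lemma lam₁_pos : 0 < B.lam₁ := div_pos (mul_pos B.r₂_pos (sub_pos.2 B.a₁_lt_one)) B.D_pos

lemma lam₂_pos : 0 < B.lam₂ := div_pos (mul_pos B.r₁_pos (sub_pos.2 B.a₂_lt_one)) B.D_pos

lemma c₁_pos : 0 < B.c₁ := B.w₁_nonneg.trans_lt B.w₁_lt_c₁

lemma quietTime_pos : 0 < B.quietTime :=
  div_pos (neg_pos.2 (Real.log_neg (sub_pos.2 B.c₁_lt_one) (by linarith [B.c₁_pos]))) lam₂_pos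

lemma cutoff_nonneg (T : ℝ) : 0 ≤ B.cutoff T := le_max_left _ _

lemma cutoff_lt {T : ℝ} (hT : 0 < T) : B.cutoff T < T :=
  max_lt hT (by linarith [B.quietTime_pos])

/-- The properties that all equilibria share. -/
structure HasProfile (B : BargainingGame) (σ₁ : Strategy₁) (σ₂ : Strategy₂) (T : ℝ) : Prop where
  T_pos : 0 < T
  F₁_const : ∀ t, T ≤ t → σ₁.F t = σ₁.F T
  F₂_const : ∀ t, T ≤ t → σ₂.F t = 1
  F₁_lt : ∀ s t, 0 ≤ s → s < t → t ≤ T → σ₁.F s < σ₁.F t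
  F₂_lt : ∀ s t, 0 ≤ s → s < t → t ≤ T → σ₂.F s < σ₂.F t
  F₁_leftLim : ∀ t, 0 < t → Function.leftLim σ₁.F t = σ₁.F t
  F₁_cont : ContinuousOn σ₁.F (Ici 0)
  total : σ₁.F T + σ₁.G T = 1
  survivalProb₂_eq : ∀ t ∈ Icc 0 T, B.survivalProb₂ σ₂ t = B.z₂ * Real.exp (B.lam₂ * (T - t))
  G_eq : ∀ t, 0 ≤ t → σ₁.G t = B.criticalRatio * (1 - Real.exp (-B.γ₁ * min t (B.cutoff T)))
  deriv₁ : ∀ t ∈ Ico 0 T, HasDerivWithinAt (B.concessionProb₁ σ₁)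
    (B.lam₁ * B.survivalProb₁ σ₁ t) (Ici t) t
  deriv₂ : ∀ t ∈ Ico 0 T, HasDerivWithinAt (B.concessionProb₂ σ₂)
    (B.lam₂ * B.survivalProb₂ σ₂ t) (Ici t) t
  no_atom : σ₁.F 0 = 0 ∨ σ₂.F 0 = 0

namespace IsEquilibrium

/-- The critical bound is evaluated on `[0, t]`; including 0 also excludes an atom of challenges
there. -/
lemma G_sub_le (h : B.IsEquilibrium σ₁ σ₂) {s : ℝ} (hs : 0 ≤ s)
    (hU : B.U₂ s σ₂.q σ₁ = B.u₂ σ₂ σ₁) {t : ℝ} (ht : 0 ≤ t) (hts : t < s) :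
    σ₁.G t ≤ B.criticalRatio * (1 - Real.exp (-B.γ₁ * t)) := by
  have hle := Measure.le_iff'.1 (h.G_restrict_le hs hU)
  have h1 := hle (Icc 0 t)
  have hsub : Icc 0 t ∩ Ico 0 s = Icc 0 t :=
    inter_eq_left.2 fun x hx => ⟨hx.1, hx.2.trans_lt hts⟩
  rw [Measure.restrict_apply measurableSet_Icc, Measure.restrict_apply measurableSet_Icc, hsub,
    σ₁.G.measure_Icc, StieltjesFunction.leftLim_zero σ₁.G_neg, ← Ioc_union_left ht] at h1
  have h2 := h1.trans (measure_union_le _ _)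
  rw [B.criticalMeasure_Ioc ht, B.criticalMeasure_singleton, add_zero, sub_zero, mul_zero,
    Real.exp_zero] at h2
  refine (ENNReal.ofReal_le_ofReal_iff ?_).1 h2
  have h3 : Real.exp (-B.γ₁ * t) ≤ 1 := by
    rw [Real.exp_le_one_iff]; nlinarith [B.γ₁_nonneg]
  exact mul_nonneg B.criticalRatio_pos.le (sub_nonneg.2 h3)

lemma le_G (h : B.IsEquilibrium σ₁ σ₂) {b s : ℝ} (hs : 0 ≤ s) (hbs : b ≤ s)
    (hU : B.U₂ s σ₂.q σ₁ = B.u₂ σ₂ σ₁) (hq : ∀ x, 0 ≤ x → x < b → σ₂.q x < 1) {t : ℝ}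
    (ht : 0 ≤ t) (htb : t < b) : B.criticalRatio * (1 - Real.exp (-B.γ₁ * t)) ≤ σ₁.G t := by
  have hle := Measure.le_iff'.1 (h.critical_restrict_le hs hbs hU hq)
  have h1 := hle (Ioc 0 t)
  have hsub : Ioc 0 t ∩ Ico 0 b = Ioc 0 t :=
    inter_eq_left.2 fun x hx => ⟨hx.1.le, hx.2.trans_lt htb⟩
  rw [Measure.restrict_apply measurableSet_Ioc, Measure.restrict_apply measurableSet_Ioc, hsub,
    σ₁.G.measure_Ioc, B.criticalMeasure_Ioc ht, mul_zero, Real.exp_zero,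
    ENNReal.ofReal_le_ofReal_iff (sub_nonneg.2 (σ₁.G.mono ht))] at h1
  linarith [σ₁.G_nonneg 0]

/-- Every equilibrium has the same structure. -/
theorem exists_hasProfile (h : B.IsEquilibrium σ₁ σ₂) : ∃ T, B.HasProfile σ₁ σ₂ T := by
  obtain ⟨T, hT, hW₁, hW₂, hL₁, hL₂, hC₁, hC₂, hlt₁, hlt₂⟩ := h.exists_last_concession
  have hz₂ := sub_pos.2 B.z₂_lt_one
  have hc₁ := sub_pos.2 B.c₁_lt_one
  have hF₁ := continuousOn_of_leftLim hL₁
  have hF₂ := continuousOn_of_leftLim hL₂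
  have hS₂cont : ContinuousOn (B.survivalProb₂ σ₂) (Icc 0 T) :=
    continuousOn_const.sub (continuousOn_const.mul (hF₂.mono Icc_subset_Ici_self))
  have hright : ∀ (F : StieltjesFunction ℝ) (t : ℝ), Tendsto F (𝓝[>] t) (𝓝 (F t)) := fun F t =>
    (F.right_continuous t).mono_left (nhdsWithin_mono _ Ioi_subset_Ici_self)
  have hd₁ : ∀ t ∈ Ico 0 T, HasDerivWithinAt (B.concessionProb₁ σ₁)
      (B.lam₁ * B.survivalProb₁ σ₁ t) (Ici t) t := by
    intro t ht
    -- The indifference of player 2, indexed by `true`, fixes the concession rate of player 1.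
    refine h.isAttrition.hasDerivWithinAt true ht.1 ht.2 hW₂ ?_
    have hK : Continuous fun t => B.z₁ * (1 - Real.exp (-B.γ₁ * t)) := by fun_prop
    exact ((hright σ₁.F t).const_mul _).const_sub 1 |>.sub
      (((hK.tendsto t).mono_left nhdsWithin_le_nhds).add ((hright σ₁.G t).const_mul _))
  have hd₂ : ∀ t ∈ Ico 0 T, HasDerivWithinAt (B.concessionProb₂ σ₂)
      (B.lam₂ * B.survivalProb₂ σ₂ t) (Ici t) t := fun t ht =>
    h.isAttrition.hasDerivWithinAt false ht.1 ht.2 hW₁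
      (((hright σ₂.F t).const_mul _).const_sub 1)
  have hS₂T : B.survivalProb₂ σ₂ T = B.z₂ := survivalProb₂_of_F_eq_one (hC₂ T le_rfl)
  -- Solved backwards from `T`, when only the justified player 2 is left.
  have hS₂ : ∀ t ∈ Icc 0 T, B.survivalProb₂ σ₂ t = B.z₂ * Real.exp (B.lam₂ * (T - t)) := by
    intro t ht
    have h1 := eq_mul_exp_of_hasDerivWithinAt (k := -B.lam₂)
      (hS₂cont.mono (Icc_subset_Icc_left ht.1)) (fun x hx =>
        ((hd₂ x ⟨ht.1.trans hx.1, hx.2⟩).const_sub 1).congr_deriv (by ring)) ⟨ht.2, le_rfl⟩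
    rw [hS₂T] at h1
    rw [h1, mul_assoc, ← Real.exp_add]
    simp
  have hθ₀ := B.cutoff_nonneg T
  have hθT := B.cutoff_lt hT
  have hlog : Real.exp (B.lam₂ * B.quietTime) = 1 / (1 - B.c₁) := by
    unfold quietTime
    rw [mul_div_cancel₀ _ (lam₂_pos (B := B)).ne', Real.exp_neg, Real.exp_log hc₁, one_div]
  have hquiet : ∀ x, B.cutoff T < x → 0 ≤ x → (1 - B.c₁) * B.survivalProb₂ σ₂ x < B.z₂ := by
    intro x hx hx0
    rcases le_or_gt x T with hxT | hxT
    · rw [hS₂ x ⟨hx0, hxT⟩]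
      have h1 : T - x < B.quietTime := by
        have := (le_max_right 0 (T - B.quietTime)).trans_lt hx
        linarith
      have h2 := Real.exp_lt_exp.2 (mul_lt_mul_of_pos_left h1 (lam₂_pos (B := B)))
      rw [hlog, lt_div_iff₀ hc₁] at h2
      nlinarith [B.z₂_pos]
    · rw [survivalProb₂_of_F_eq_one (hC₂ x hxT.le)]
      exact one_sub_c₁_mul_z₂_lt B
  have hGconst : ∀ t, B.cutoff T ≤ t → σ₁.G t = σ₁.G (B.cutoff T) := fun t ht =>
    h.G_const hquiet ht
  -- Player 2 also concedes optimally at some `s` after the cutoff, so her responses to all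
  -- challenges up to the cutoff must be optimal.
  obtain ⟨s, hsθ, hsT, hs0, hsU⟩ := StieltjesFunction.exists_of_ae h.attained₂.1
    (hlt₂ _ _ hθ₀ hθT le_rfl)
  have hup : ∀ t, 0 ≤ t → t ≤ B.cutoff T →
      σ₁.G t ≤ B.criticalRatio * (1 - Real.exp (-B.γ₁ * t)) := fun t ht htθ =>
    h.G_sub_le hs0 hsU ht (htθ.trans_lt hsθ)
  -- Certain yielding at `x` would make a challenge there pay more than the equilibrium payoff.
  have hq : ∀ x, 0 ≤ x → x < B.cutoff T → σ₂.q x < 1 := by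
    intro x hx0 hx
    have hxT := hx.le.trans hθT.le
    have h1 := h.V₁_le hx0
    rw [B.V₁_eq, hW₁ x hx0 hxT] at h1
    have h2 : B.quietTime < T - x := by
      rcases lt_max_iff.1 hx with h3 | h3 <;> linarith
    have h3 := Real.exp_lt_exp.2 (mul_lt_mul_of_pos_left h2 (lam₂_pos (B := B)))
    rw [hlog, div_lt_iff₀ hc₁] at h3
    have h4 : B.z₂ < (1 - B.c₁) * B.survivalProb₂ σ₂ x := by
      rw [hS₂ x ⟨hx0, hxT⟩]
      nlinarith [B.z₂_pos]
    by_contra hq1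
    have hq1' : σ₂.q x = 1 := le_antisymm (σ₂.q_mem x).2 (not_lt.1 hq1)
    rw [hq1'] at h1
    have h5 : 0 < Real.exp (-B.r₁ * x) * B.D := mul_pos (Real.exp_pos _) B.D_pos
    have h6 := mul_pos h5 (sub_pos.2 h4)
    linarith
  have hlo : ∀ t, 0 ≤ t → t < B.cutoff T →
      B.criticalRatio * (1 - Real.exp (-B.γ₁ * t)) ≤ σ₁.G t := fun t ht htθ =>
    h.le_G hs0 hsθ.le hsU hq ht htθ
  have hGθ : σ₁.G (B.cutoff T) = B.criticalRatio * (1 - Real.exp (-B.γ₁ * B.cutoff T)) := by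
    refine le_antisymm (hup _ hθ₀ le_rfl) ?_
    rcases hθ₀.eq_or_lt with h0 | h0
    · rw [← h0]
      simpa using σ₁.G_nonneg 0
    · have hK : Continuous fun t => B.criticalRatio * (1 - Real.exp (-B.γ₁ * t)) := by fun_prop
      refine le_of_tendsto ((hK.tendsto (B.cutoff T)).mono_left
        (nhdsWithin_le_nhds (s := Iio (B.cutoff T)))) ?_
      filter_upwards [Ioo_mem_nhdsLT h0] with t ht
      exact (hlo t ht.1.le ht.2).trans (σ₁.G.mono ht.2.le)
  refine ⟨T, hT, hC₁, hC₂, hlt₁, hlt₂, hL₁, hF₁, ?_, hS₂, ?_, hd₁, hd₂, ?_⟩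
  · obtain ⟨l₁, l₂, hl₁, hl₂, hl⟩ := h.attained₁.2.2
    rw [eq_of_tendsto_of_eventually_const hl₁ hC₁, eq_of_tendsto_of_eventually_const hl₂ fun t ht =>
      (hGconst t (hθT.le.trans ht)).trans (hGconst T hθT.le).symm]
    exact hl
  · intro t ht
    rcases le_or_gt (B.cutoff T) t with htθ | htθ
    · rw [min_eq_right htθ, hGconst t htθ, hGθ]
    · rw [min_eq_left htθ.le]
      exact le_antisymm (hup t ht htθ.le) (hlo t ht htθ)
  -- An atom of player 1 at 0 is optimal for him only if player 2 has none.
  · by_contra! hne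
    have h1 : Function.leftLim σ₁.F 0 < σ₁.F 0 := by
      rw [StieltjesFunction.leftLim_zero σ₁.F_neg]
      exact lt_of_le_of_ne (σ₁.F_nonneg 0) hne.1.symm
    have h2 := (h.optimal₁ le_rfl (StieltjesFunction.of_ae_of_atom h.attained₁.1 h1).2).2
    rw [leftLim_concessionProb₂, StieltjesFunction.leftLim_zero σ₂.F_neg, mul_zero] at h2
    exact mul_ne_zero hz₂.ne' hne.2 h2.symm

end IsEquilibrium

/-! ### The inverse posterior and the uniqueness of the last time -/

variable {B : BargainingGame} {σ₁ : Strategy₁} {σ₂ : Strategy₂} {T : ℝ}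

variable (B) in
/-- The ratio of overall challenges to challenges by a justified player 1, if concession ends
at `T`. -/
def challengeFactor (T t : ℝ) : ℝ := if t < B.cutoff T then 1 / B.nuStar else 1

variable (B) in
/-- The inverse of the probability that player 1 is justified given survival past `t`. -/
def inversePosterior (σ₁ : Strategy₁) (t : ℝ) : ℝ :=
  B.survivalProb₁ σ₁ t * Real.exp (B.γ₁ * t) / B.z₁

variable (B) in
/-- The derivative of the inverse posterior when concession ends in `x` units of time. -/
def posteriorSlope (x : ℝ) : ℝ :=
  if x ≤ B.quietTime then -B.lam₁ * Real.exp (-(B.γ₁ - B.lam₁) * x)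
  else -(B.lam₁ * Real.exp (-(B.γ₁ - B.lam₁) * B.quietTime) + B.γ₁ * (1 / B.nuStar - 1))
    * Real.exp (-(B.γ₁ - B.lam₁) * (x - B.quietTime))

lemma nuStar_pos : 0 < B.nuStar := by
  have h1 := B.w₁_lt_one
  unfold nuStar
  rw [sub_pos, div_lt_one (by linarith)]
  exact B.k₂_lt

lemma nuStar_lt_one : B.nuStar < 1 := by
  have h1 := B.w₁_lt_one
  have := div_pos B.k₂_pos (sub_pos.2 h1)
  unfold nuStar
  linarith

lemma one_lt_inv_nuStar : 1 < 1 / B.nuStar := (one_lt_div nuStar_pos).2 nuStar_lt_one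

lemma z₁_add_criticalRatio : B.z₁ + (1 - B.z₁) * B.criticalRatio = 1 / B.nuStar * B.z₁ := by
  have h1 := B.w₁_lt_one
  have h2 := B.k₂_lt
  have h3 := B.z₁_lt_one
  have h4 : 1 - B.w₁ - B.k₂ ≠ 0 := by linarith
  have h5 : 1 - B.w₁ ≠ 0 := by linarith
  have h6 : 1 - B.z₁ ≠ 0 := by linarith
  have h7 : B.nuStar = (1 - B.w₁ - B.k₂) / (1 - B.w₁) := by
    unfold nuStar; field_simp
  rw [h7]
  unfold criticalRatio
  field_simp
  ring

lemma inversePosterior_pos (t : ℝ) : 0 < B.inversePosterior σ₁ t :=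
  div_pos (mul_pos (B.survivalProb₁_pos σ₁ t) (Real.exp_pos _)) B.z₁_pos

lemma hasDerivAt_exp_mul (k x : ℝ) :
    HasDerivAt (fun x => Real.exp (k * x)) (Real.exp (k * x) * k) x := by
  have h0 : HasDerivAt (fun x => k * x) k x := by simpa using (hasDerivAt_id x).const_mul k
  exact h0.exp

namespace HasProfile

lemma cutoff_lt (hp : B.HasProfile σ₁ σ₂ T) : B.cutoff T < T := B.cutoff_lt hp.T_pos

lemma G_cont (hp : B.HasProfile σ₁ σ₂ T) : ContinuousOn σ₁.G (Ici 0) := by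
  have h : Continuous fun t => B.criticalRatio * (1 - Real.exp (-B.γ₁ * min t (B.cutoff T))) := by
    fun_prop
  exact h.continuousOn.congr fun t ht => hp.G_eq t ht

lemma leftLim_G (hp : B.HasProfile σ₁ σ₂ T) {t : ℝ} (ht : 0 < t) :
    Function.leftLim σ₁.G t = σ₁.G t :=
  ((hp.G_cont t ht.le).continuousAt (Ici_mem_nhds ht)).continuousWithinAt.leftLim_eq

lemma G_of_le (hp : B.HasProfile σ₁ σ₂ T) {t : ℝ} (ht : B.cutoff T ≤ t) :
    σ₁.G t = σ₁.G (B.cutoff T) := by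
  rw [hp.G_eq t ((B.cutoff_nonneg T).trans ht), hp.G_eq _ (B.cutoff_nonneg T), min_eq_right ht,
    min_self]

lemma survivalProb₁_cont (hp : B.HasProfile σ₁ σ₂ T) :
    ContinuousOn (B.survivalProb₁ σ₁) (Ici 0) := by
  have h : ContinuousOn (fun t => B.z₁ * (1 - Real.exp (-B.γ₁ * t))) (Ici 0) := by fun_prop
  exact (continuousOn_const.sub (continuousOn_const.mul hp.F₁_cont)).sub
    (h.add (continuousOn_const.mul hp.G_cont))

/-- By `T` the unjustified type has acted with probability 1, so only the justified one remains. -/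
lemma survivalProb₁_of_le (hp : B.HasProfile σ₁ σ₂ T) {t : ℝ} (ht : T ≤ t) :
    B.survivalProb₁ σ₁ t = B.z₁ * Real.exp (-B.γ₁ * t) := by
  have h1 := hp.F₁_const t ht
  have h2 := hp.G_of_le (hp.cutoff_lt.le.trans ht)
  have h3 := hp.G_of_le hp.cutoff_lt.le
  have h4 := hp.total
  rw [B.survivalProb₁_eq, h1, h2, ← h3]
  linear_combination (-(1 - B.z₁)) * h4

lemma inversePosterior_cont (hp : B.HasProfile σ₁ σ₂ T) :
    ContinuousOn (B.inversePosterior σ₁) (Ici 0) :=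
  (hp.survivalProb₁_cont.mul (by fun_prop)).div_const _

lemma inversePosterior_of_le (hp : B.HasProfile σ₁ σ₂ T) {t : ℝ} (ht : T ≤ t) :
    B.inversePosterior σ₁ t = 1 := by
  unfold inversePosterior
  rw [hp.survivalProb₁_of_le ht, mul_assoc, ← Real.exp_add]
  simp [B.z₁_pos.ne']

lemma hasDerivWithinAt_challengeProb (hp : B.HasProfile σ₁ σ₂ T) {t : ℝ} (ht : 0 ≤ t) :
    HasDerivWithinAt (B.challengeProb σ₁)
      (B.challengeFactor T t * (B.z₁ * (B.γ₁ * Real.exp (-B.γ₁ * t)))) (Ici t) t := by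
  have hE := hasDerivAt_exp_mul (-B.γ₁) t
  unfold challengeFactor
  split_ifs with hθ
  · have h1 : HasDerivWithinAt
        (fun s => (B.z₁ + (1 - B.z₁) * B.criticalRatio) * (1 - Real.exp (-B.γ₁ * s)))
        (1 / B.nuStar * (B.z₁ * (B.γ₁ * Real.exp (-B.γ₁ * t)))) (Ici t) t := by
      rw [z₁_add_criticalRatio]
      exact (((hE.const_sub 1).const_mul _).congr_deriv (by ring)).hasDerivWithinAt
    refine h1.congr_of_eventuallyEq_of_mem ?_ self_mem_Ici
    filter_upwards [Ico_mem_nhdsGE hθ] with s hs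
    unfold challengeProb
    rw [hp.G_eq s (ht.trans hs.1), min_eq_left hs.2.le]
    ring
  · have h1 : HasDerivWithinAt
        (fun s => B.z₁ * (1 - Real.exp (-B.γ₁ * s)) + (1 - B.z₁) * σ₁.G (B.cutoff T))
        (1 * (B.z₁ * (B.γ₁ * Real.exp (-B.γ₁ * t)))) (Ici t) t :=
      ((((hE.const_sub 1).const_mul _).add_const _).congr_deriv (by ring)).hasDerivWithinAt
    refine h1.congr_of_mem (fun s hs => ?_) self_mem_Ici
    unfold challengeProb
    rw [hp.G_of_le ((not_lt.1 hθ).trans hs)]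

lemma hasDerivWithinAt_survivalProb₁ (hp : B.HasProfile σ₁ σ₂ T) {t : ℝ} (ht : t ∈ Ico 0 T) :
    HasDerivWithinAt (B.survivalProb₁ σ₁) (-(B.lam₁ * B.survivalProb₁ σ₁ t
      + B.challengeFactor T t * (B.z₁ * (B.γ₁ * Real.exp (-B.γ₁ * t))))) (Ici t) t :=
  (((hp.deriv₁ t ht).const_sub 1).sub (hp.hasDerivWithinAt_challengeProb ht.1)).congr_deriv
    (by ring)

/-- Scaling survival by the justified type's own survival removes the exponential from the challenge
term, leaving an equation with piecewise constant coefficients. -/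
lemma hasDerivWithinAt_inversePosterior (hp : B.HasProfile σ₁ σ₂ T) {t : ℝ} (ht : t ∈ Ico 0 T) :
    HasDerivWithinAt (B.inversePosterior σ₁) ((B.γ₁ - B.lam₁) * B.inversePosterior σ₁ t
      - B.challengeFactor T t * B.γ₁) (Ici t) t := by
  have h1 := ((hp.hasDerivWithinAt_survivalProb₁ ht).mul
    (hasDerivAt_exp_mul B.γ₁ t).hasDerivWithinAt).div_const B.z₁
  refine h1.congr_deriv ?_
  have hz := B.z₁_pos.ne'
  have he : Real.exp (-(B.γ₁ * t)) * Real.exp (B.γ₁ * t) = 1 := by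
    rw [← Real.exp_add]; simp
  unfold inversePosterior
  field_simp
  linear_combination (-(B.challengeFactor T t * B.z₁ * B.γ₁)) * he

/-- On an interval with a constant challenge factor `m`, the slope of the inverse posterior is
exponential. -/
lemma slope_eq (hp : B.HasProfile σ₁ σ₂ T) {m a b : ℝ} (ha : 0 ≤ a) (hab : a ≤ b) (hb : b ≤ T)
    (hm : ∀ x ∈ Ico a b, B.challengeFactor T x = m) :
    (B.γ₁ - B.lam₁) * B.inversePosterior σ₁ a - m * B.γ₁ =
      ((B.γ₁ - B.lam₁) * B.inversePosterior σ₁ b - m * B.γ₁)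
        * Real.exp (-(B.γ₁ - B.lam₁) * (b - a)) := by
  have h1 := eq_mul_exp_of_hasDerivWithinAt (k := B.γ₁ - B.lam₁) (a := a) (b := b)
    (f := fun x => (B.γ₁ - B.lam₁) * B.inversePosterior σ₁ x - m * B.γ₁)
    ((continuousOn_const.mul (hp.inversePosterior_cont.mono fun x hx => ha.trans hx.1)).sub
      continuousOn_const) (fun x hx => by
        have h2 := ((hp.hasDerivWithinAt_inversePosterior
          ⟨ha.trans hx.1, hx.2.trans_le hb⟩).const_mul (B.γ₁ - B.lam₁)).sub_const (m * B.γ₁)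
        rw [hm x hx] at h2
        exact h2) (right_mem_Icc.2 hab)
  rw [h1, mul_assoc, ← Real.exp_add, ← add_mul, add_neg_cancel, zero_mul, Real.exp_zero, mul_one]

/-- The slope is `-λ₁` at `T`, where the inverse posterior is 1, and evolves exponentially
backwards. At the cutoff the inverse posterior is continuous while the slope changes by `γ₁ (1 / ν*
- 1)`. Only the remaining time enters. -/
lemma slope_eq_posteriorSlope (hp : B.HasProfile σ₁ σ₂ T) {t : ℝ} (ht : t ∈ Ico 0 T) :
    (B.γ₁ - B.lam₁) * B.inversePosterior σ₁ t - B.challengeFactor T t * B.γ₁ =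
      B.posteriorSlope (T - t) := by
  have hlate : ∀ x, 0 ≤ x → B.cutoff T ≤ x → x ≤ T →
      (B.γ₁ - B.lam₁) * B.inversePosterior σ₁ x - 1 * B.γ₁ =
        -B.lam₁ * Real.exp (-(B.γ₁ - B.lam₁) * (T - x)) := by
    intro x hx hxθ hxT
    rw [hp.slope_eq hx hxT le_rfl (m := 1) fun y hy => if_neg (not_lt.2 (hxθ.trans hy.1)),
      hp.inversePosterior_of_le le_rfl]
    ring
  by_cases hθ : t < B.cutoff T
  · have hq : B.quietTime < T - t := by
      rcases lt_max_iff.1 hθ with h3 | h3 <;> linarith [ht.1]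
    have hθ' : B.cutoff T = T - B.quietTime := max_eq_right (by linarith [ht.1])
    have h1 := hp.slope_eq ht.1 hθ.le hp.cutoff_lt.le (m := 1 / B.nuStar) fun y hy => if_pos hy.2
    have h2 := hlate _ (B.cutoff_nonneg T) le_rfl hp.cutoff_lt.le
    have h3 : T - B.cutoff T = B.quietTime := by rw [hθ']; ring
    have h4 : B.cutoff T - t = T - t - B.quietTime := by rw [hθ']; ring
    rw [h3] at h2
    unfold posteriorSlope challengeFactor
    rw [if_pos hθ, if_neg (not_le.2 hq), h1, h4]
    congr 1
    linear_combination h2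
  · have hq : T - t ≤ B.quietTime := by
      have := (le_max_right 0 (T - B.quietTime)).trans (not_lt.1 hθ)
      linarith
    unfold posteriorSlope challengeFactor
    rw [if_neg hθ, if_pos hq]
    exact hlate t ht.1 (not_lt.1 hθ) ht.2.le

end HasProfile

/-- The extra challenges before the cutoff only make the slope more negative. -/
lemma posteriorSlope_le (x : ℝ) :
    B.posteriorSlope x ≤ -B.lam₁ * Real.exp (-(B.γ₁ - B.lam₁) * x) := by
  unfold posteriorSlope
  split_ifs
  · exact le_rfl
  · have h1 : 0 ≤ B.γ₁ * (1 / B.nuStar - 1) :=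
      mul_nonneg B.γ₁_nonneg (sub_nonneg.2 one_lt_inv_nuStar.le)
    have h2 : Real.exp (-(B.γ₁ - B.lam₁) * x) = Real.exp (-(B.γ₁ - B.lam₁) * B.quietTime)
        * Real.exp (-(B.γ₁ - B.lam₁) * (x - B.quietTime)) := by
      rw [← Real.exp_add]; ring_nf
    rw [h2]
    have h3 := mul_nonneg h1 (Real.exp_pos (-(B.γ₁ - B.lam₁) * (x - B.quietTime))).le
    linarith

namespace HasProfile

lemma strictAntiOn_inversePosterior (hp : B.HasProfile σ₁ σ₂ T) :
    StrictAntiOn (B.inversePosterior σ₁) (Icc 0 T) := by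
  intro a ha b hb hab
  -- The absolute value makes the bound uniform on `[0, T]` whichever of `γ₁` and `λ₁` is larger.
  set ε := B.lam₁ * Real.exp (-|B.γ₁ - B.lam₁| * T) with hε
  have hε0 : 0 < ε := mul_pos lam₁_pos (Real.exp_pos _)
  have hB : ∀ x, HasDerivAt (fun x => B.inversePosterior σ₁ a + -ε * (x - a)) (-ε) x := by
    intro x
    simpa using (((hasDerivAt_id x).sub_const a).const_mul (-ε)).const_add
      (B.inversePosterior σ₁ a)
  have h1 := image_le_of_deriv_right_le_deriv_boundary (a := a) (b := b)
    (f := B.inversePosterior σ₁) (f' := fun t => B.posteriorSlope (T - t))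
    (B := fun x => B.inversePosterior σ₁ a + -ε * (x - a)) (B' := fun _ => -ε)
    (hp.inversePosterior_cont.mono fun x hx => ha.1.trans hx.1)
    (fun x hx => by
      have hx' : x ∈ Ico 0 T := ⟨ha.1.trans hx.1, hx.2.trans_le hb.2⟩
      rw [← hp.slope_eq_posteriorSlope hx']
      exact hp.hasDerivWithinAt_inversePosterior hx')
    (by simp) (fun x hx => (hB x).continuousAt.continuousWithinAt)
    (fun x hx => (hB x).hasDerivWithinAt) (fun x hx => by
      refine (posteriorSlope_le _).trans ?_
      rw [hε, neg_mul, neg_le_neg_iff]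
      refine mul_le_mul_of_nonneg_left (Real.exp_le_exp.2 ?_) lam₁_pos.le
      have hx0 : 0 ≤ x := ha.1.trans hx.1
      have hxT : x ≤ T := hx.2.le.trans hb.2
      nlinarith [le_abs_self (B.γ₁ - B.lam₁), abs_nonneg (B.γ₁ - B.lam₁)])
    (right_mem_Icc.2 hab.le)
  nlinarith

/-- The last time of concession is the same in all equilibria. -/
theorem last_time_le {σ₁' : Strategy₁} {σ₂' : Strategy₂} {T' : ℝ} (hp : B.HasProfile σ₁ σ₂ T)
    (hp' : B.HasProfile σ₁' σ₂' T') : T' ≤ T := by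
  by_contra hlt
  push Not at hlt
  have hT := hp.T_pos
  have hT' := hp'.T_pos
  set d := T' - T with hd
  have hd0 : 0 < d := sub_pos.2 hlt
  -- Shifting by `d` aligns the remaining times, so the two inverse posteriors have the same slope
  -- and the same final value 1.
  have hshift : ∀ x ∈ Ico 0 T, HasDerivWithinAt (fun x => B.inversePosterior σ₁' (x + d))
      (B.posteriorSlope (T - x)) (Ici x) x := by
    intro x hx
    have hx' : x + d ∈ Ico 0 T' := ⟨by linarith [hx.1], by linarith [hx.2]⟩
    have h1 := hp'.hasDerivWithinAt_inversePosterior hx'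
    rw [hp'.slope_eq_posteriorSlope hx', show T' - (x + d) = T - x by rw [hd]; ring] at h1
    have h2 := h1.scomp_of_eq x (((hasDerivAt_id x).add_const d).hasDerivWithinAt (s := Ici x))
      (fun y hy => by simpa using hy) rfl
    exact h2.congr_deriv (one_smul _ _)
  have hconst := constant_of_has_deriv_right_zero
    (f := fun x => B.inversePosterior σ₁ x - B.inversePosterior σ₁' (x + d)) (a := 0) (b := T)
    ((hp.inversePosterior_cont.mono Icc_subset_Ici_self).sub
      (hp'.inversePosterior_cont.comp (by fun_prop) fun x hx => by
        have := hx.1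
        simp only [mem_Ici]; linarith))
    (fun x hx => by
      have h1 := hp.hasDerivWithinAt_inversePosterior hx
      rw [hp.slope_eq_posteriorSlope hx] at h1
      exact (h1.sub (hshift x hx)).congr_deriv (sub_self _)) T (right_mem_Icc.2 hT.le)
  simp only [zero_add] at hconst
  rw [hp.inversePosterior_of_le le_rfl, hp'.inversePosterior_of_le (by linarith)] at hconst
  -- The earlier-ending path starts where the other one is at time `d`, after a strict decrease.
  have h1 : B.inversePosterior σ₁ 0 < B.inversePosterior σ₁' 0 := by
    have := hp'.strictAntiOn_inversePosterior (left_mem_Icc.2 hT'.le)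
      (show d ∈ Icc 0 T' from ⟨hd0.le, by linarith⟩) hd0
    linarith
  have hG : ∀ {τ₁ : Strategy₁} {τ₂ : Strategy₂} {t : ℝ}, B.HasProfile τ₁ τ₂ t → τ₁.G 0 = 0 := by
    intro τ₁ τ₂ t h
    rw [h.G_eq 0 le_rfl, min_eq_left (B.cutoff_nonneg t)]
    simp
  have hS : ∀ {τ₁ : Strategy₁} {τ₂ : Strategy₂} {t : ℝ}, B.HasProfile τ₁ τ₂ t →
      B.inversePosterior τ₁ 0 = (1 - (1 - B.z₁) * τ₁.F 0) / B.z₁ := by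
    intro τ₁ τ₂ t h
    unfold inversePosterior
    rw [B.survivalProb₁_eq, hG h]
    simp only [mul_zero, Real.exp_zero, mul_one, sub_zero]
    ring
  rw [hS hp, hS hp', div_lt_div_iff_of_pos_right B.z₁_pos] at h1
  have hz₁ := sub_pos.2 B.z₁_lt_one
  have hz₂ := sub_pos.2 B.z₂_lt_one
  -- Without an atom of player 1 the earlier-ending profile could not start lower; without one of
  -- player 2 its survival probability for her starts at 1, and the other would start above 1.
  rcases hp.no_atom with h0 | h0
  · rw [h0] at h1
    have := mul_nonneg hz₁.le (σ₁'.F_nonneg 0)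
    linarith
  · have h2 := hp.survivalProb₂_eq 0 (left_mem_Icc.2 hT.le)
    have h3 := hp'.survivalProb₂_eq 0 (left_mem_Icc.2 hT'.le)
    have h4 : B.z₂ * Real.exp (B.lam₂ * (T - 0)) < B.z₂ * Real.exp (B.lam₂ * (T' - 0)) := by
      refine mul_lt_mul_of_pos_left (Real.exp_lt_exp.2 ?_) B.z₂_pos
      exact mul_lt_mul_of_pos_left (by linarith) lam₂_pos
    rw [← h2, ← h3] at h4
    unfold survivalProb₂ concessionProb₂ at h4
    rw [h0] at h4
    have := mul_nonneg hz₂.le (σ₂'.F_nonneg 0)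
    linarith

end HasProfile

end BargainingGame

/-! ### Hazard rates, their jumps and their monotonicity -/

/-- The hazard rate is the right derivative divided by the survival probability. -/
lemma IsHazardRate.of_hasDerivWithinAt {A S : ℝ → ℝ} {t d : ℝ} (hS : 0 < S t)
    (h : HasDerivWithinAt A d (Ici t) t) : IsHazardRate A S t (d / S t) := by
  refine ⟨hS, ?_⟩
  have h1 := (hasDerivWithinAt_iff_tendsto_slope' self_notMem_Ioi).1 h.Ioi_of_Ici
  have h2 : Tendsto (fun ε => t + ε) (𝓝[>] (0 : ℝ)) (𝓝[>] t) := by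
    refine tendsto_nhdsWithin_of_tendsto_nhds_of_eventually_within _ ?_ ?_
    · have : Continuous fun ε => t + ε := by fun_prop
      simpa using (this.tendsto 0).mono_left (nhdsWithin_le_nhds (s := Ioi 0))
    · filter_upwards [self_mem_nhdsWithin] with ε hε
      simpa using hε
  refine ((h1.comp h2).div_const (S t)).congr fun ε => ?_
  simp only [Function.comp, slope_def_field, add_sub_cancel_left]
  rw [div_right_comm]

/-- A function with different one-sided limits is discontinuous. -/
lemma not_continuousAt_of_ne_oneSided {f : ℝ → ℝ} {x l r : ℝ} (hl : Tendsto f (𝓝[<] x) (𝓝 l))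
    (hr : Tendsto f (𝓝[>] x) (𝓝 r)) (hlr : l ≠ r) : ¬ ContinuousAt f x := fun hf =>
  hlr ((tendsto_nhds_unique hl (hf.mono_left nhdsWithin_le_nhds)).trans
    (tendsto_nhds_unique hr (hf.mono_left nhdsWithin_le_nhds)).symm)

namespace BargainingGame

variable {B : BargainingGame} {σ₁ : Strategy₁} {σ₂ : Strategy₂} {T : ℝ}

variable (B) in
/-- The last time of a challenge by an unjustified player 1 if concession ends at `T`. -/
def lastChallengeTime (T : ℝ) : ℝ := if B.γ₁ = 0 then 0 else B.cutoff T

variable (B) in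
/-- The overall hazard rate of challenging if concession ends at `T`. -/
def challengeRate (σ₁ : Strategy₁) (T t : ℝ) : ℝ :=
  B.challengeFactor T t * ((B.inversePosterior σ₁ t)⁻¹ * B.γ₁)

variable (B) in
/-- The overall hazard rate of resolution if concession ends at `T`. -/
def resolutionRate (σ₁ : Strategy₁) (T t : ℝ) : ℝ :=
  if t < T then B.challengeRate σ₁ T t + B.lam₁ + B.lam₂ else B.challengeRate σ₁ T t

lemma lastChallengeTime_nonneg (T : ℝ) : 0 ≤ B.lastChallengeTime T := by
  unfold lastChallengeTime
  split_ifs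
  exacts [le_rfl, B.cutoff_nonneg T]

lemma lastChallengeTime_lt (hT : 0 < T) : B.lastChallengeTime T < T := by
  unfold lastChallengeTime
  split_ifs
  exacts [hT, B.cutoff_lt hT]

lemma lastChallengeTime_of_pos (h : 0 < B.lastChallengeTime T) :
    0 < B.γ₁ ∧ B.lastChallengeTime T = B.cutoff T := by
  unfold lastChallengeTime at h ⊢
  split_ifs at h ⊢ with hγ
  · exact absurd h (lt_irrefl 0)
  · exact ⟨lt_of_le_of_ne B.γ₁_nonneg (Ne.symm hγ), rfl⟩

lemma challengeRate_eq (t : ℝ) : B.challengeRate σ₁ T t =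
    B.challengeFactor T t * (B.z₁ * (B.γ₁ * Real.exp (-B.γ₁ * t))) / B.survivalProb₁ σ₁ t := by
  unfold challengeRate inversePosterior
  rw [neg_mul, Real.exp_neg]
  have h1 := (B.survivalProb₁_pos σ₁ t).ne'
  have h2 := B.z₁_pos.ne'
  field_simp

lemma challengeRate_of_lt {t : ℝ} (ht : t < B.lastChallengeTime T) (h0 : 0 ≤ t) :
    B.challengeRate σ₁ T t = (B.inversePosterior σ₁ t)⁻¹ / B.nuStar * B.γ₁ := by
  rw [(lastChallengeTime_of_pos (h0.trans_lt ht)).2] at ht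
  unfold challengeRate challengeFactor
  rw [if_pos ht]
  ring

lemma challengeRate_of_gt {t : ℝ} (ht : B.lastChallengeTime T < t) :
    B.challengeRate σ₁ T t = (B.inversePosterior σ₁ t)⁻¹ * B.γ₁ := by
  unfold lastChallengeTime at ht
  unfold challengeRate challengeFactor
  split_ifs at ht with hγ
  · simp [hγ]
  · rw [if_neg (not_lt.2 ht.le), one_mul]

namespace HasProfile

/-- For positive times there are no atoms, so left limits are values. At 0 this fails if player 1
has an atom of concession. -/
lemma reputation₁_eq (hp : B.HasProfile σ₁ σ₂ T) {t : ℝ} (ht : 0 < t) :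
    B.reputation₁ σ₁ t = (B.inversePosterior σ₁ t)⁻¹ := by
  have h1 := (B.survivalProb₁_pos σ₁ t).ne'
  have h2 := B.z₁_pos.ne'
  unfold reputation₁ inversePosterior
  rw [hp.F₁_leftLim t ht, hp.leftLim_G ht, ← B.survivalProb₁_eq, neg_mul, Real.exp_neg]
  field_simp

lemma challengeRate_of_le (hp : B.HasProfile σ₁ σ₂ T) {t : ℝ} (ht : T ≤ t) :
    B.challengeRate σ₁ T t = B.γ₁ := by
  rw [challengeRate_of_gt ((lastChallengeTime_lt hp.T_pos).trans_le ht),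
    hp.inversePosterior_of_le ht, inv_one, one_mul]

lemma isChallengeHazard (hp : B.HasProfile σ₁ σ₂ T) {t : ℝ} (ht : 0 ≤ t) :
    B.IsChallengeHazard σ₁ t (B.challengeRate σ₁ T t) := by
  rw [challengeRate_eq]
  exact .of_hasDerivWithinAt (B.survivalProb₁_pos σ₁ t) (hp.hasDerivWithinAt_challengeProb ht)

lemma isConcessionHazard₁ (hp : B.HasProfile σ₁ σ₂ T) {t : ℝ} (ht : t ∈ Ico 0 T) :
    B.IsConcessionHazard₁ σ₁ t B.lam₁ := by
  have h := IsHazardRate.of_hasDerivWithinAt (B.survivalProb₁_pos σ₁ t) (hp.deriv₁ t ht)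
  rwa [mul_div_cancel_right₀ _ (B.survivalProb₁_pos σ₁ t).ne'] at h

lemma isConcessionHazard₂ (hp : B.HasProfile σ₁ σ₂ T) {t : ℝ} (ht : t ∈ Ico 0 T) :
    B.IsConcessionHazard₂ σ₂ t B.lam₂ := by
  have h := IsHazardRate.of_hasDerivWithinAt (B.survivalProb₂_pos σ₂ t) (hp.deriv₂ t ht)
  rwa [mul_div_cancel_right₀ _ (B.survivalProb₂_pos σ₂ t).ne'] at h

/-- Game survival is a product, so by the product rule the players' hazard rates add; from `T` on
only justified challenges remain. -/
lemma isResolutionHazard (hp : B.HasProfile σ₁ σ₂ T) {t : ℝ} (ht : 0 ≤ t) :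
    B.IsResolutionHazard σ₁ σ₂ t (B.resolutionRate σ₁ T t) := by
  have h1 := B.survivalProb₁_pos σ₁ t
  have h2 := B.survivalProb₂_pos σ₂ t
  have hpos : 0 < B.gameSurvivalProb σ₁ σ₂ t := mul_pos h1 h2
  rcases lt_or_ge t T with htT | htT
  · have hd := ((hp.hasDerivWithinAt_survivalProb₁ ⟨ht, htT⟩).mul
      ((hp.deriv₂ t ⟨ht, htT⟩).const_sub 1)).const_sub 1
    have h := IsHazardRate.of_hasDerivWithinAt hpos hd
    refine cast (congrArg _ ?_) h
    unfold resolutionRate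
    rw [if_pos htT, challengeRate_eq]
    change _ / (B.survivalProb₁ σ₁ t * B.survivalProb₂ σ₂ t) = _
    rw [show 1 - B.concessionProb₂ σ₂ t = B.survivalProb₂ σ₂ t from rfl]
    field_simp
    ring
  · have hd : HasDerivWithinAt (fun s => 1 - B.gameSurvivalProb σ₁ σ₂ s)
        (B.γ₁ * B.gameSurvivalProb σ₁ σ₂ t) (Ici t) t := by
      have hform : ∀ s ∈ Ici t, 1 - B.gameSurvivalProb σ₁ σ₂ s =
          1 - B.z₁ * Real.exp (-B.γ₁ * s) * B.z₂ := fun s hs => by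
        unfold gameSurvivalProb
        rw [hp.survivalProb₁_of_le (htT.trans hs),
          IsEquilibrium.survivalProb₂_of_F_eq_one (hp.F₂_const s (htT.trans hs))]
      refine HasDerivWithinAt.congr_of_mem ?_ hform self_mem_Ici
      refine (((hasDerivAt_exp_mul (-B.γ₁) t).const_mul B.z₁).mul_const B.z₂ |>.const_sub 1
        |>.hasDerivWithinAt).congr_deriv ?_
      have := hform t self_mem_Ici
      linear_combination B.γ₁ * this
    have h := IsHazardRate.of_hasDerivWithinAt hpos hd
    rw [mul_div_cancel_right₀ _ hpos.ne'] at h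
    unfold resolutionRate
    rw [if_neg (not_lt.2 htT), hp.challengeRate_of_le htT]
    exact h

lemma isLastTime_F₁ (hp : B.HasProfile σ₁ σ₂ T) : IsLastTime σ₁.F T := by
  refine ⟨⟨hp.T_pos.le, hp.F₁_const⟩, fun t ⟨ht0, ht⟩ => ?_⟩
  by_contra hlt
  push Not at hlt
  exact (hp.F₁_lt t T ht0 hlt le_rfl).ne' (ht T hlt.le)

lemma isLastTime_F₂ (hp : B.HasProfile σ₁ σ₂ T) : IsLastTime σ₂.F T := by
  refine ⟨⟨hp.T_pos.le, fun s hs => (hp.F₂_const s hs).trans (hp.F₂_const T le_rfl).symm⟩,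
    fun t ⟨ht0, ht⟩ => ?_⟩
  by_contra hlt
  push Not at hlt
  exact (hp.F₂_lt t T ht0 hlt le_rfl).ne' (ht T hlt.le)

lemma isLastTime_G (hp : B.HasProfile σ₁ σ₂ T) : IsLastTime σ₁.G (B.lastChallengeTime T) := by
  refine ⟨⟨lastChallengeTime_nonneg T, fun s hs => ?_⟩, fun t ⟨ht0, ht⟩ => ?_⟩
  · have h0 := lastChallengeTime_nonneg (B := B) T
    by_cases hγ : B.γ₁ = 0
    · rw [hp.G_eq s (h0.trans hs), hp.G_eq _ h0, hγ]
      simp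
    · have h1 : B.lastChallengeTime T = B.cutoff T := if_neg hγ
      rw [h1] at hs ⊢
      exact hp.G_of_le hs
  · by_contra hlt
    push Not at hlt
    obtain ⟨hγ, h1⟩ := lastChallengeTime_of_pos (ht0.trans_lt hlt)
    have h2 := ht _ hlt.le
    rw [h1] at h2 hlt
    rw [hp.G_eq t ht0, hp.G_eq _ (B.cutoff_nonneg T), min_self, min_eq_left hlt.le] at h2
    have h3 := mul_left_cancel₀ B.criticalRatio_pos.ne' h2
    have h4 : Real.exp (-B.γ₁ * B.cutoff T) < Real.exp (-B.γ₁ * t) := by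
      rw [Real.exp_lt_exp]; nlinarith
    linarith

lemma monotoneOn_inv (hp : B.HasProfile σ₁ σ₂ T) :
    MonotoneOn (fun t => (B.inversePosterior σ₁ t)⁻¹) (Icc 0 T) := fun _ ha b hb hab =>
  inv_anti₀ (inversePosterior_pos b) (hp.strictAntiOn_inversePosterior.antitoneOn ha hb hab)

lemma continuousOn_inv (hp : B.HasProfile σ₁ σ₂ T) :
    ContinuousOn (fun t => (B.inversePosterior σ₁ t)⁻¹) (Ici 0) :=
  hp.inversePosterior_cont.inv₀ fun t _ => (inversePosterior_pos t).ne'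

lemma monotoneOn_challengeRate_left (hp : B.HasProfile σ₁ σ₂ T) :
    MonotoneOn (B.challengeRate σ₁ T) (Ioo 0 (B.lastChallengeTime T)) := by
  have hT := lastChallengeTime_lt (B := B) hp.T_pos
  intro a ha b hb hab
  rw [challengeRate_of_lt ha.2 ha.1.le, challengeRate_of_lt hb.2 hb.1.le]
  exact mul_le_mul_of_nonneg_right (div_le_div_of_nonneg_right
    (hp.monotoneOn_inv ⟨ha.1.le, (ha.2.trans hT).le⟩ ⟨hb.1.le, (hb.2.trans hT).le⟩ hab)
    nuStar_pos.le) B.γ₁_nonneg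

lemma monotoneOn_challengeRate_right (hp : B.HasProfile σ₁ σ₂ T) :
    MonotoneOn (B.challengeRate σ₁ T) (Ioo (B.lastChallengeTime T) T) := by
  have h0 := lastChallengeTime_nonneg (B := B) T
  intro a ha b hb hab
  rw [challengeRate_of_gt ha.1, challengeRate_of_gt hb.1]
  exact mul_le_mul_of_nonneg_right (hp.monotoneOn_inv ⟨h0.trans ha.1.le, ha.2.le⟩
    ⟨h0.trans hb.1.le, hb.2.le⟩ hab) B.γ₁_nonneg

lemma resolutionRate_of_lt {t : ℝ} (ht : t < T) :
    B.resolutionRate σ₁ T t = B.challengeRate σ₁ T t + B.lam₁ + B.lam₂ := if_pos ht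

lemma resolutionRate_of_le (hp : B.HasProfile σ₁ σ₂ T) {t : ℝ} (ht : T ≤ t) :
    B.resolutionRate σ₁ T t = B.γ₁ :=
  (if_neg (not_lt.2 ht)).trans (hp.challengeRate_of_le ht)

lemma tendsto_inv (hp : B.HasProfile σ₁ σ₂ T) {t : ℝ} (ht : 0 < t) :
    Tendsto (fun t => (B.inversePosterior σ₁ t)⁻¹) (𝓝 t) (𝓝 (B.inversePosterior σ₁ t)⁻¹) :=
  (hp.continuousOn_inv t ht.le).continuousAt (Ici_mem_nhds ht)

lemma tendsto_challengeRate_left (hp : B.HasProfile σ₁ σ₂ T) (h : 0 < B.lastChallengeTime T) :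
    Tendsto (B.challengeRate σ₁ T) (𝓝[<] B.lastChallengeTime T)
      (𝓝 ((B.inversePosterior σ₁ (B.lastChallengeTime T))⁻¹ / B.nuStar * B.γ₁)) := by
  refine ((((hp.tendsto_inv h).mono_left nhdsWithin_le_nhds).div_const _).mul_const _).congr' ?_
  filter_upwards [Ioo_mem_nhdsLT h] with t ht using (challengeRate_of_lt ht.2 ht.1.le).symm

lemma tendsto_challengeRate_right (hp : B.HasProfile σ₁ σ₂ T) (h : 0 < B.lastChallengeTime T) :
    Tendsto (B.challengeRate σ₁ T) (𝓝[>] B.lastChallengeTime T)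
      (𝓝 ((B.inversePosterior σ₁ (B.lastChallengeTime T))⁻¹ * B.γ₁)) := by
  refine (((hp.tendsto_inv h).mono_left nhdsWithin_le_nhds).mul_const _).congr' ?_
  filter_upwards [self_mem_nhdsWithin] with t ht using (challengeRate_of_gt ht).symm

lemma challengeRate_jump (h : 0 < B.lastChallengeTime T) (t : ℝ) :
    (B.inversePosterior σ₁ t)⁻¹ / B.nuStar * B.γ₁ ≠ (B.inversePosterior σ₁ t)⁻¹ * B.γ₁ := by
  intro heq
  have hγ := (lastChallengeTime_of_pos h).1
  have h1 := inv_pos.2 (inversePosterior_pos (B := B) (σ₁ := σ₁) t)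
  have h2 := mul_right_cancel₀ hγ.ne' heq
  rw [div_eq_iff nuStar_pos.ne'] at h2
  nlinarith [B.nuStar_lt_one]

lemma not_continuousAt_challengeRate (hp : B.HasProfile σ₁ σ₂ T)
    (h : 0 < B.lastChallengeTime T) :
    ¬ ContinuousAt (B.challengeRate σ₁ T) (B.lastChallengeTime T) :=
  not_continuousAt_of_ne_oneSided (hp.tendsto_challengeRate_left h) (hp.tendsto_challengeRate_right h)
    (challengeRate_jump h _)

lemma not_continuousAt_resolutionRate (hp : B.HasProfile σ₁ σ₂ T)
    (h : 0 < B.lastChallengeTime T) :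
    ¬ ContinuousAt (B.resolutionRate σ₁ T) (B.lastChallengeTime T) := by
  have hT := lastChallengeTime_lt (B := B) hp.T_pos
  have hev : ∀ᶠ t in 𝓝 (B.lastChallengeTime T),
      B.challengeRate σ₁ T t + B.lam₁ + B.lam₂ = B.resolutionRate σ₁ T t := by
    filter_upwards [Iio_mem_nhds hT] with t ht using (resolutionRate_of_lt ht).symm
  refine not_continuousAt_of_ne_oneSided
    ((((hp.tendsto_challengeRate_left h).add_const B.lam₁).add_const B.lam₂).congr'
      (nhdsWithin_le_nhds hev))
    ((((hp.tendsto_challengeRate_right h).add_const B.lam₁).add_const B.lam₂).congr'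
      (nhdsWithin_le_nhds hev)) fun heq => ?_
  exact challengeRate_jump h _ (add_right_cancel (add_right_cancel heq))

/-- The challenge rate tends to `γ₁` from the left because the reputation tends to 1, while
concessions at total rate `λ₁ + λ₂` stop. -/
lemma not_continuousAt_resolutionRate_last (hp : B.HasProfile σ₁ σ₂ T) :
    ¬ ContinuousAt (B.resolutionRate σ₁ T) T := by
  have hT := lastChallengeTime_lt (B := B) hp.T_pos
  refine not_continuousAt_of_ne_oneSided (l := 1 * B.γ₁ + B.lam₁ + B.lam₂) (r := B.γ₁) ?_ ?_ ?_
  · have h1 := (hp.tendsto_inv hp.T_pos).mono_left (nhdsWithin_le_nhds (s := Iio T))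
    rw [hp.inversePosterior_of_le le_rfl, inv_one] at h1
    refine (((h1.mul_const _).add_const _).add_const _).congr' ?_
    filter_upwards [Ioo_mem_nhdsLT hT] with t ht
    rw [resolutionRate_of_lt ht.2, challengeRate_of_gt ht.1]
  · refine tendsto_const_nhds.congr' ?_
    filter_upwards [self_mem_nhdsWithin] with t ht using (hp.resolutionRate_of_le (le_of_lt ht)).symm
  · have h1 := B.lam₁_pos
    have h2 := B.lam₂_pos
    intro heq
    linarith

end HasProfile

end BargainingGame
end

/-! ### The hazard rates in every equilibrium -/

theorem mainTheorem5 (B : BargainingGame) :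
    ∃ T T₁ : ℝ, 0 ≤ T₁ ∧ T₁ < T ∧
      ∀ (σ₁ : Strategy₁) (σ₂ : Strategy₂), B.IsEquilibrium σ₁ σ₂ →
        -- `T` is the last time of concession of either unjustified player,
        -- and `T₁` is the last time at which the unjustified player 1 challenges
        IsLastTime σ₁.F T ∧ IsLastTime σ₂.F T ∧ IsLastTime σ₁.G T₁ ∧
        -- overall hazard rates of concession
        (∀ t ∈ Ico 0 T, B.IsConcessionHazard₁ σ₁ t B.lam₁) ∧
        (∀ t ∈ Ico 0 T, B.IsConcessionHazard₂ σ₂ t B.lam₂) ∧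
        -- overall hazard rates of challenging and of resolution
        ∃ χ ρ : ℝ → ℝ,
          (∀ t, 0 ≤ t → t ≠ T₁ → B.IsChallengeHazard σ₁ t (χ t)) ∧
          (∀ t, 0 ≤ t → t ≠ T₁ → B.IsResolutionHazard σ₁ σ₂ t (ρ t)) ∧
          (∀ t ∈ Ioo 0 T₁, χ t = B.reputation₁ σ₁ t / B.nuStar * B.γ₁) ∧
          (∀ t ∈ Ioo T₁ T, χ t = B.reputation₁ σ₁ t * B.γ₁) ∧
          (∀ t, T ≤ t → χ t = B.γ₁) ∧
          (∀ t ∈ Ioo 0 T₁,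
            ρ t = B.reputation₁ σ₁ t / B.nuStar * B.γ₁ + B.lam₁ + B.lam₂) ∧
          (∀ t ∈ Ioo T₁ T, ρ t = B.reputation₁ σ₁ t * B.γ₁ + B.lam₁ + B.lam₂) ∧
          (∀ t, T ≤ t → ρ t = B.γ₁) ∧
          -- at time 0 the formulas hold with the reputation right after time 0
          (0 < T₁ → ∃ m : ℝ, Tendsto (B.reputation₁ σ₁) (𝓝[>] 0) (𝓝 m) ∧
            χ 0 = m / B.nuStar * B.γ₁ ∧ ρ 0 = m / B.nuStar * B.γ₁ + B.lam₁ + B.lam₂) ∧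
          -- discontinuity
          (0 < T₁ → ¬ ContinuousAt χ T₁ ∧ ¬ ContinuousAt ρ T₁) ∧
          ¬ ContinuousAt ρ T ∧
          -- piecewise monotonicity
          MonotoneOn χ (Ioo 0 T₁) ∧ MonotoneOn χ (Ioo T₁ T) ∧ MonotoneOn χ (Ici T) ∧
          MonotoneOn ρ (Ioo 0 T₁) ∧ MonotoneOn ρ (Ioo T₁ T) ∧ MonotoneOn ρ (Ici T) := by
  obtain ⟨T, hT, huniq⟩ : ∃ T : ℝ, 0 < T ∧ ∀ (σ₁ : Strategy₁) (σ₂ : Strategy₂),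
      B.IsEquilibrium σ₁ σ₂ → B.HasProfile σ₁ σ₂ T := by
    by_cases hex : ∃ (σ₁ : Strategy₁) (σ₂ : Strategy₂), B.IsEquilibrium σ₁ σ₂
    · obtain ⟨τ₁, τ₂, hτ⟩ := hex
      obtain ⟨T, hT⟩ := hτ.exists_hasProfile
      refine ⟨T, hT.T_pos, fun σ₁ σ₂ hσ => ?_⟩
      obtain ⟨T', hT'⟩ := hσ.exists_hasProfile
      exact le_antisymm (hT.last_time_le hT') (hT'.last_time_le hT) ▸ hT'
    -- Without equilibria the claim is vacuous and any positive time serves.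
    · exact ⟨1, one_pos, fun σ₁ σ₂ hσ => absurd ⟨σ₁, σ₂, hσ⟩ hex⟩
  have h0 := B.lastChallengeTime_nonneg T
  have hlt := B.lastChallengeTime_lt hT
  refine ⟨T, B.lastChallengeTime T, h0, hlt, fun σ₁ σ₂ hσ => ?_⟩
  have hp := huniq σ₁ σ₂ hσ
  have hχ₁ : ∀ t ∈ Ioo 0 (B.lastChallengeTime T),
      B.challengeRate σ₁ T t = B.reputation₁ σ₁ t / B.nuStar * B.γ₁ := fun t ht => by
    rw [hp.reputation₁_eq ht.1, BargainingGame.challengeRate_of_lt ht.2 ht.1.le]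
  have hχ₂ : ∀ t ∈ Ioo (B.lastChallengeTime T) T,
      B.challengeRate σ₁ T t = B.reputation₁ σ₁ t * B.γ₁ := fun t ht => by
    rw [hp.reputation₁_eq (h0.trans_lt ht.1), BargainingGame.challengeRate_of_gt ht.1]
  have hρ : ∀ t, t < T → B.resolutionRate σ₁ T t = B.challengeRate σ₁ T t + B.lam₁ + B.lam₂ :=
    fun t ht => BargainingGame.HasProfile.resolutionRate_of_lt ht
  refine ⟨hp.isLastTime_F₁, hp.isLastTime_F₂, hp.isLastTime_G, fun t ht => hp.isConcessionHazard₁ ht,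
    fun t ht => hp.isConcessionHazard₂ ht, B.challengeRate σ₁ T, B.resolutionRate σ₁ T,
    fun t ht _ => hp.isChallengeHazard ht, fun t ht _ => hp.isResolutionHazard ht, hχ₁, hχ₂,
    fun t ht => hp.challengeRate_of_le ht, fun t ht => ?_, fun t ht => ?_,
    fun t ht => hp.resolutionRate_of_le ht, fun hpos => ?_,
    fun hpos => ⟨hp.not_continuousAt_challengeRate hpos, hp.not_continuousAt_resolutionRate hpos⟩,
    hp.not_continuousAt_resolutionRate_last, hp.monotoneOn_challengeRate_left,
    hp.monotoneOn_challengeRate_right, fun a ha b hb _ => ?_, fun a ha b hb hab => ?_,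
    fun a ha b hb hab => ?_, fun a ha b hb _ => ?_⟩
  · rw [hρ t (ht.2.trans hlt), hχ₁ t ht]
  · rw [hρ t ht.2, hχ₂ t ht]
  -- The inverse posterior at 0 already accounts for an atom of concession there, so its reciprocal
  -- is the reputation right after 0.
  · refine ⟨(B.inversePosterior σ₁ 0)⁻¹, ?_, BargainingGame.challengeRate_of_lt hpos le_rfl, ?_⟩
    · refine Tendsto.congr' ?_ ((hp.continuousOn_inv 0 self_mem_Ici).mono_left
        (nhdsWithin_mono 0 Ioi_subset_Ici_self))
      filter_upwards [self_mem_nhdsWithin] with t ht using (hp.reputation₁_eq ht).symm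
    · rw [hρ 0 hT, BargainingGame.challengeRate_of_lt hpos le_rfl]
  · exact ((hp.challengeRate_of_le ha).trans (hp.challengeRate_of_le hb).symm).le
  · rw [hρ a (ha.2.trans hlt), hρ b (hb.2.trans hlt)]
    linarith [hp.monotoneOn_challengeRate_left ha hb hab]
  · rw [hρ a ha.2, hρ b hb.2]
    linarith [hp.monotoneOn_challengeRate_right ha hb hab]
  · exact ((hp.resolutionRate_of_le ha).trans (hp.resolutionRate_of_le hb).symm).le
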